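/- **Conventions.** Lists $\langle a_i\rangle_{i=1}^n$ may be empty; all sets lie in one fixed universe. A *prop* $\mathcal T$ has a set of colours $\operatorname{Col}\mathcal T$, a set $\mathcal T(\langle a_i\rangle_{i=1}^n;\langle b_k\rangle_{k=1}^m)$ for every two finite lists of colours, identities $\mathrm{id}_c\in\mathcal T(c;c)$, a vertical composition $\circ_v$, a horizontal composition $\circ_h$ (juxtaposition of operations) with an empty composite $1\in\mathcal T(\,;\,)$, right actions $\sigma^*$ of permutations on the inputs and left actions $\tau_*$ of permutations on the outputs. These satisfy: associativity of $\circ_v$ and of $\circ_h$; $1$ is a unit for $\circ_h$, and $\mathrm{id}_{a_1}\circ_h\cdots\circ_h\mathrm{id}_{a_n}$ (which is $1$ for $n=0$) is an identity of the list $\langle a_i\rangle$ for $\circ_v$; interchange $(f\circ_v g)\circ_h(f'\circ_v g')=(f\circ_h f')\circ_v(g\circ_h g')$; the two actions commute with each other and are compatible with $\circ_v$ ($f\circ_v\sigma_*g=\sigma^*f\circ_v g$, $\sigma^*(f\circ_v g)=f\circ_v\sigma^*g$, $\tau_*(f\circ_v g)=\tau_*f\circ_v g$) and with $\circ_h$ (block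 sums of permutations act on $f\circ_h g$, and the block transpositions of inputs and outputs take $f\circ_h g$ to $g\circ_h f$). A map of props is a map on colours and operations that preserves all this structure. An *operad* is a symmetric coloured operad (symmetric multicategory); its composition is denoted by $\gamma$. The operad $U(\mathcal T)$ underlying a prop $\mathcal T$ has the colours of $\mathcal T$, the operations $U(\mathcal T)(\langle a_i\rangle;b)=\mathcal T(\langle a_i\rangle;b)$, and $\gamma(g,\langle f_i\rangle)=g\circ_v(f_1\circ_h\cdots\circ_h f_n)$. This gives a functor $U:\mathbf{Prop}\to\mathbf{Operad}$. For an operad $\mathcal O$, the prop $F(\mathcal O)$ has the colours of $\mathcal O$. An element of $F(\mathcal O)(\langle a_i\rangle_{i=1}^n;\langle b_j\rangle_{j=1}^m)$ is a pair $(\theta,\langle f_j\rangle_{j=1}^m)$ of a function $\theta:\{1,\dots,n\}\to\{1,\dots,m\}$ and operations $f_j\in\mathcal O(\langle a_i\rangle_{\theta(i)=j};b_j)$. Vertical composition composes the functions and applies $\gamma$ over each output (with the evident reordering of inputs), horizontal composition is disjoint union, and permutations relabel the inputs and the outputs. The map of operads $\eta:\mathcal O\to U(F(\mathcal O))$ is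 the identity on colours and takes $x$ to $(*,x)$, where $*$ is the function to a one-point set. For props $\mathcal R,\mathcal T$, the prop $\underline{\mathrm{Hom}}(\mathcal R,\mathcal T)$ has the maps of props $\mathcal R\to\mathcal T$ as colours. An operation $\langle f_1,\dots,f_p\rangle\to\langle g_1,\dots,g_q\rangle$ is a family $\xi_a\in\mathcal T(\langle f_ja\rangle_{j=1}^p;\langle g_la\rangle_{l=1}^q)$, $a\in\operatorname{Col}\mathcal R$, such that for every $\phi\in\mathcal R(\langle a_i\rangle_{i=1}^n;\langle b_k\rangle_{k=1}^m)$ the two composites $$\langle\langle f_ja_i\rangle_j\rangle_i\xrightarrow{\langle\xi_{a_i}\rangle_i}\langle\langle g_la_i\rangle_l\rangle_i\cong\langle\langle g_la_i\rangle_i\rangle_l\xrightarrow{\langle g_l\phi\rangle_l}\langle\langle g_lb_k\rangle_k\rangle_l\cong\langle\langle g_lb_k\rangle_l\rangle_k,$$ $$\langle\langle f_ja_i\rangle_j\rangle_i\cong\langle\langle f_ja_i\rangle_i\rangle_j\xrightarrow{\langle f_j\phi\rangle_j}\langle\langle f_jb_k\rangle_k\rangle_j\cong\langle\langle f_jb_k\rangle_j\rangle_k\xrightarrow{\langle\xi_{b_k}\rangle_k}\langle\langle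 g_lb_k\rangle_l\rangle_k$$ agree, where $\langle\ \rangle$ of operations is their horizontal composite and $\cong$ interchanges the two indices. The prop structure is that of $\mathcal T$ at each colour of $\mathcal R$. For operads $\mathcal O,\mathcal M$, the internal hom $\underline{\mathrm{Hom}}_{\mathbf{Operad}}(\mathcal O,\mathcal M)$ is the operad with the maps of operads $\mathcal O\to\mathcal M$ as colours. An operation $\langle f_1,\dots,f_p\rangle\to g$ is a family $\xi_a\in\mathcal M(\langle f_ja\rangle_{j=1}^p;ga)$, $a\in\operatorname{Col}\mathcal O$, such that for every $\phi\in\mathcal O(\langle a_i\rangle_{i=1}^n;b)$ the operations $\gamma(g\phi,\langle\xi_{a_i}\rangle_{i=1}^n)$ and $\gamma(\xi_b,\langle f_j\phi\rangle_{j=1}^p)$ agree up to the permutation that interchanges the two indices of the inputs. The operad structure is that of $\mathcal M$ at each colour of $\mathcal O$. **Proposition.** Let $\mathcal O$ be an operad and let $\mathcal T$ be a prop. The adjunction map $$\operatorname{Hom}_{\mathbf{Prop}}(F(\mathcal O),\mathcal T)\to\operatorname{Hom}_{\mathbf{Operad}}(\mathcal O,U(\mathcal T)),\qquad f\mapsto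 U(f)\circ\eta,$$ is a bijection, and it extends to an isomorphism of operads $$U(\underline{\mathrm{Hom}}(F(\mathcal O),\mathcal T))\cong\underline{\mathrm{Hom}}_{\mathbf{Operad}}(\mathcal O,U(\mathcal T)).$$ That is, there is an isomorphism of operads which is $f\mapsto U(f)\circ\eta$ on colours and takes an operation $\xi:\langle f_1,\dots,f_p\rangle\to g$ to the operation with the same components $\xi_a$, $a\in\operatorname{Col}\mathcal O=\operatorname{Col}F(\mathcal O)$. -/

import Mathlib

open CategoryTheory

universe u

namespace PropOperad

/-! ### Coloured props -/

/-- The data of a (coloured) prop: a set of colours, sets of operations between finite ordered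
lists of colours (a list of length `n` is a function on `Fin n`), identities, the empty horizontal
composite `unit`, vertical and horizontal composition, and the right and left actions of
permutations on inputs and outputs.

The actions are written along a bijection `σ : Fin n' ≃ Fin n` (which forces `n' = n`), and the
relabelled list is any list `a'` with `a' i = a (σ i)`; so `inp σ` is `σ^*`, `out τ` is `τ_*`,
and for `σ`, `τ` the identity they are transport along an equality of lists. -/
structure PropData where
  Col : Type u
  Op : {n m : ℕ} → (Fin n → Col) → (Fin m → Col) → Type u
  id : (c : Col) → Op (fun _ : Fin 1 => c) (fun _ : Fin 1 => c)
  unit : Op (Fin.elim0 : Fin 0 → Col) (Fin.elim0 : Fin 0 → Col)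
  vcomp : {n m k : ℕ} → {a : Fin n → Col} → {b : Fin m → Col} → {c : Fin k → Col} →
    Op a b → Op c a → Op c b
  hcomp : {n m p q : ℕ} → {a : Fin n → Col} → {b : Fin m → Col} → {a' : Fin p → Col} →
    {b' : Fin q → Col} → Op a b → Op a' b' → Op (Fin.append a a') (Fin.append b b')
  inp : {n n' m : ℕ} → {a : Fin n → Col} → {a' : Fin n' → Col} → {b : Fin m → Col} →
    (σ : Fin n' ≃ Fin n) → (∀ i, a' i = a (σ i)) → Op a b → Op a' b
  out : {n m m' : ℕ} → {a : Fin n → Col} → {b : Fin m → Col} → {b' : Fin m' → Col} →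
    (τ : Fin m ≃ Fin m') → (∀ k, b' k = b (τ.symm k)) → Op a b → Op a b'

/-- `σ × σ'` as a bijection of blocks: it is `σ` on the first block and `σ'` on the second. -/
def blockSum {n n' p p' : ℕ} (σ : Fin n ≃ Fin n') (σ' : Fin p ≃ Fin p') :
    Fin (n + p) ≃ Fin (n' + p') :=
  finSumFinEquiv.symm.trans ((σ.sumCongr σ').trans finSumFinEquiv)

theorem blockSum_refl (n p : ℕ) :
    blockSum (Equiv.refl (Fin n)) (Equiv.refl (Fin p)) = Equiv.refl (Fin (n + p)) := by
  simp [blockSum]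

theorem append_blockSum {C : Type u} {n n' p p' : ℕ} {a : Fin n → C} {a' : Fin n' → C}
    {c : Fin p → C} {c' : Fin p' → C} {σ : Fin n ≃ Fin n'} {σ' : Fin p ≃ Fin p'}
    (h : ∀ i, a i = a' (σ i)) (h' : ∀ i, c i = c' (σ' i)) (i : Fin (n + p)) :
    Fin.append a c i = Fin.append a' c' (blockSum σ σ' i) := by
  induction i using Fin.addCases <;> simp [blockSum, h, h']

theorem append_blockSum_symm {C : Type u} {n n' p p' : ℕ} {a : Fin n → C} {a' : Fin n' → C}
    {c : Fin p → C} {c' : Fin p' → C} {σ : Fin n ≃ Fin n'} {σ' : Fin p ≃ Fin p'}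
    (h : ∀ i, a' i = a (σ.symm i)) (h' : ∀ i, c' i = c (σ'.symm i)) (i : Fin (n' + p')) :
    Fin.append a' c' i = Fin.append a c ((blockSum σ σ').symm i) := by
  induction i using Fin.addCases <;> simp [blockSum, h, h']

theorem append_flip {C : Type u} {n p : ℕ} (a : Fin n → C) (c : Fin p → C) (i : Fin (p + n)) :
    Fin.append c a i = Fin.append a c ((finAddFlip : Fin (p + n) ≃ Fin (n + p)) i) := by
  induction i using Fin.addCases <;> simp

theorem append_flip_symm {C : Type u} {n p : ℕ} (a : Fin n → C) (c : Fin p → C)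
    (i : Fin (p + n)) :
    Fin.append c a i = Fin.append a c ((finAddFlip : Fin (n + p) ≃ Fin (p + n)).symm i) := by
  induction i using Fin.addCases <;> simp [finAddFlip]

theorem append_snoc {C : Type u} {n : ℕ} (a : Fin (n + 1) → C) (i : Fin (n + 1)) :
    a i = Fin.append (fun j : Fin n => a j.castSucc) (fun _ : Fin 1 => a (Fin.last n)) i := by
  induction i using Fin.lastCases with
  | last => exact (Fin.append_right (fun j : Fin n => a j.castSucc) (fun _ : Fin 1 => a (Fin.last n)) 0).symm
  | cast j => exact (Fin.append_left (fun j : Fin n => a j.castSucc) (fun _ : Fin 1 => a (Fin.last n)) j).symm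

theorem append_assoc_apply {C : Type u} {n p r : ℕ} (a : Fin n → C) (b : Fin p → C)
    (c : Fin r → C) (i : Fin (n + p + r)) :
    Fin.append (Fin.append a b) c i =
      Fin.append a (Fin.append b c) (finCongr (Nat.add_assoc n p r) i) :=
  congrFun (Fin.append_assoc a b c) i

theorem elim0_append_apply {C : Type u} {n : ℕ} (a : Fin n → C) (i : Fin (0 + n)) :
    Fin.append (Fin.elim0 : Fin 0 → C) a i = a (finCongr (Nat.zero_add n) i) :=
  congrFun (Fin.elim0_append a) i

theorem append_elim0_apply {C : Type u} {n : ℕ} (a : Fin n → C) (i : Fin (n + 0)) :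
    Fin.append a (Fin.elim0 : Fin 0 → C) i = a (finCongr (Nat.add_zero n) i) :=
  congrFun (Fin.append_elim0 a) i

theorem reflIn {C : Type u} {n : ℕ} {a a' : Fin n → C} (h : ∀ i, a' i = a i) (i : Fin n) :
    a' i = a (Equiv.refl (Fin n) i) := h i

theorem reflOut {C : Type u} {n : ℕ} {a a' : Fin n → C} (h : ∀ i, a' i = a i) (i : Fin n) :
    a' i = a ((Equiv.refl (Fin n)).symm i) := h i

theorem congrOut {C : Type u} {n m : ℕ} {a : Fin n → C} {a' : Fin m → C} {e : m = n}
    (h : ∀ i, a' i = a (finCongr e i)) (i : Fin m) :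
    a' i = a ((finCongr e.symm).symm i) := h i

theorem append_map {C D : Type u} (f : C → D) {n p : ℕ} (a : Fin n → C) (b : Fin p → C)
    (i : Fin (n + p)) :
    f (Fin.append a b i) = Fin.append (fun j => f (a j)) (fun j => f (b j)) i := by
  induction i using Fin.addCases <;> simp

namespace PropData

variable (P : PropData.{u})

/-- The action of permutations on inputs and outputs at once: `σ^* τ_*`. -/
def act {n n' m m' : ℕ} {a : Fin n → P.Col} {a' : Fin n' → P.Col} {b : Fin m → P.Col}
    {b' : Fin m' → P.Col} (σ : Fin n' ≃ Fin n) (τ : Fin m ≃ Fin m') (ha : ∀ i, a' i = a (σ i))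
    (hb : ∀ k, b' k = b (τ.symm k)) (x : P.Op a b) : P.Op a' b' :=
  P.inp σ ha (P.out τ hb x)

/-- The horizontal composite `id_{a_1} ∘ₕ ⋯ ∘ₕ id_{a_n}`; it is `unit` for `n = 0`. -/
def idList : {n : ℕ} → (a : Fin n → P.Col) → P.Op a a
  | 0, _ => P.act (Equiv.refl _) (Equiv.refl _) (reflIn fun i => i.elim0) (reflOut fun i => i.elim0) P.unit
  | n + 1, a => P.act (Equiv.refl (Fin (n + 1))) (Equiv.refl (Fin (n + 1)))
      (reflIn (append_snoc a)) (reflOut (append_snoc a))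
      (P.hcomp (idList fun j : Fin n => a j.castSucc) (P.id (a (Fin.last n))))

end PropData

/-- The axioms of a prop. -/
structure IsProp (P : PropData.{u}) : Prop where
  vcomp_assoc {n m k l : ℕ} {a : Fin n → P.Col} {b : Fin m → P.Col} {c : Fin k → P.Col}
    {d : Fin l → P.Col} (f : P.Op c d) (g : P.Op b c) (h : P.Op a b) :
    P.vcomp (P.vcomp f g) h = P.vcomp f (P.vcomp g h)
  vcomp_idList {n m : ℕ} {a : Fin n → P.Col} {b : Fin m → P.Col} (f : P.Op a b) :
    P.vcomp f (P.idList a) = f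
  idList_vcomp {n m : ℕ} {a : Fin n → P.Col} {b : Fin m → P.Col} (f : P.Op a b) :
    P.vcomp (P.idList b) f = f
  hcomp_assoc {n m p q r s : ℕ} {a : Fin n → P.Col} {b : Fin m → P.Col} {a' : Fin p → P.Col}
    {b' : Fin q → P.Col} {a'' : Fin r → P.Col} {b'' : Fin s → P.Col}
    (f : P.Op a b) (g : P.Op a' b') (h : P.Op a'' b'') :
    P.hcomp (P.hcomp f g) h =
      P.act (finCongr (Nat.add_assoc n p r)) (finCongr (Nat.add_assoc m q s).symm)
        (append_assoc_apply a a' a'') (congrOut (append_assoc_apply b b' b'')) (P.hcomp f (P.hcomp g h))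
  unit_hcomp {n m : ℕ} {a : Fin n → P.Col} {b : Fin m → P.Col} (f : P.Op a b) :
    P.hcomp P.unit f =
      P.act (finCongr (Nat.zero_add n)) (finCongr (Nat.zero_add m).symm)
        (elim0_append_apply a) (congrOut (elim0_append_apply b)) f
  hcomp_unit {n m : ℕ} {a : Fin n → P.Col} {b : Fin m → P.Col} (f : P.Op a b) :
    P.hcomp f P.unit =
      P.act (finCongr (Nat.add_zero n)) (finCongr (Nat.add_zero m).symm)
        (append_elim0_apply a) (congrOut (append_elim0_apply b)) f
  interchange {n m k n' m' k' : ℕ} {a : Fin n → P.Col} {b : Fin m → P.Col} {c : Fin k → P.Col}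
    {a' : Fin n' → P.Col} {b' : Fin m' → P.Col} {c' : Fin k' → P.Col}
    (f : P.Op b c) (g : P.Op a b) (f' : P.Op b' c') (g' : P.Op a' b') :
    P.hcomp (P.vcomp f g) (P.vcomp f' g') = P.vcomp (P.hcomp f f') (P.hcomp g g')
  vcomp_out {n m m' k : ℕ} {a : Fin n → P.Col} {b : Fin m → P.Col} {b' : Fin m' → P.Col}
    {c : Fin k → P.Col} (σ : Fin m ≃ Fin m') (h : ∀ k, b' k = b (σ.symm k))
    (h' : ∀ i, b i = b' (σ i)) (f : P.Op b' c) (g : P.Op a b) :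
    P.vcomp f (P.out σ h g) = P.vcomp (P.inp σ h' f) g
  inp_vcomp {n n' m k : ℕ} {a : Fin n → P.Col} {a' : Fin n' → P.Col} {b : Fin m → P.Col}
    {c : Fin k → P.Col} (σ : Fin n' ≃ Fin n) (h : ∀ i, a' i = a (σ i))
    (f : P.Op b c) (g : P.Op a b) :
    P.inp σ h (P.vcomp f g) = P.vcomp f (P.inp σ h g)
  out_vcomp {n m k k' : ℕ} {a : Fin n → P.Col} {b : Fin m → P.Col}
    {c : Fin k → P.Col} {c' : Fin k' → P.Col} (τ : Fin k ≃ Fin k')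
    (h : ∀ i, c' i = c (τ.symm i)) (f : P.Op b c) (g : P.Op a b) :
    P.out τ h (P.vcomp f g) = P.vcomp (P.out τ h f) g
  inp_hcomp {n n' m p p' q : ℕ} {a : Fin n → P.Col} {a₁ : Fin n' → P.Col} {b : Fin m → P.Col}
    {a' : Fin p → P.Col} {a₁' : Fin p' → P.Col} {b' : Fin q → P.Col}
    (σ : Fin n' ≃ Fin n) (h : ∀ i, a₁ i = a (σ i)) (σ' : Fin p' ≃ Fin p)
    (h' : ∀ i, a₁' i = a' (σ' i)) (f : P.Op a b) (g : P.Op a' b') :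
    P.hcomp (P.inp σ h f) (P.inp σ' h' g) =
      P.inp (blockSum σ σ') (append_blockSum h h') (P.hcomp f g)
  out_hcomp {n m m' p q q' : ℕ} {a : Fin n → P.Col} {b : Fin m → P.Col} {b₁ : Fin m' → P.Col}
    {a' : Fin p → P.Col} {b' : Fin q → P.Col} {b₁' : Fin q' → P.Col}
    (τ : Fin m ≃ Fin m') (h : ∀ i, b₁ i = b (τ.symm i)) (τ' : Fin q ≃ Fin q')
    (h' : ∀ i, b₁' i = b' (τ'.symm i)) (f : P.Op a b) (g : P.Op a' b') :
    P.hcomp (P.out τ h f) (P.out τ' h' g) =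
      P.out (blockSum τ τ') (append_blockSum_symm h h') (P.hcomp f g)
  /- `finAddFlip : Fin (x + y) ≃ Fin (y + x)` is increasing on the first `x` elements, which go to
  the last `x` ones, and on the last `y` elements, which go to the first `y` ones. -/
  hcomp_swap {n m p q : ℕ} {a : Fin n → P.Col} {b : Fin m → P.Col} {a' : Fin p → P.Col}
    {b' : Fin q → P.Col} (f : P.Op a b) (g : P.Op a' b') :
    P.inp finAddFlip (append_flip a a') (P.out finAddFlip (append_flip_symm b b') (P.hcomp f g)) =
      P.hcomp g f
  inp_out {n n' m m' : ℕ} {a : Fin n → P.Col} {a' : Fin n' → P.Col} {b : Fin m → P.Col}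
    {b' : Fin m' → P.Col} (σ : Fin n' ≃ Fin n) (h : ∀ i, a' i = a (σ i)) (τ : Fin m ≃ Fin m')
    (h' : ∀ k, b' k = b (τ.symm k)) (f : P.Op a b) :
    P.inp σ h (P.out τ h' f) = P.out τ h' (P.inp σ h f)
  inp_refl {n m : ℕ} {a : Fin n → P.Col} {b : Fin m → P.Col} (f : P.Op a b) :
    P.inp (Equiv.refl _) (reflIn fun _ => rfl) f = f
  out_refl {n m : ℕ} {a : Fin n → P.Col} {b : Fin m → P.Col} (f : P.Op a b) :
    P.out (Equiv.refl _) (reflOut fun _ => rfl) f = f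
  inp_inp {n n' n'' m : ℕ} {a : Fin n → P.Col} {a' : Fin n' → P.Col} {a'' : Fin n'' → P.Col}
    {b : Fin m → P.Col} (σ : Fin n'' ≃ Fin n') (h : ∀ i, a'' i = a' (σ i)) (σ' : Fin n' ≃ Fin n)
    (h' : ∀ i, a' i = a (σ' i)) (f : P.Op a b) :
    P.inp σ h (P.inp σ' h' f) = P.inp (σ.trans σ') (fun i => by simp only [Equiv.trans_apply, h, h']) f
  out_out {n m m' m'' : ℕ} {a : Fin n → P.Col} {b : Fin m → P.Col} {b' : Fin m' → P.Col}
    {b'' : Fin m'' → P.Col} (τ : Fin m' ≃ Fin m'') (h : ∀ k, b'' k = b' (τ.symm k))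
    (τ' : Fin m ≃ Fin m') (h' : ∀ k, b' k = b (τ'.symm k)) (f : P.Op a b) :
    P.out τ h (P.out τ' h' f) = P.out (τ'.trans τ) (fun k => by simp only [Equiv.symm_trans_apply, h, h']) f

/-- A (coloured) prop. -/
structure ColoredProp extends PropData.{u} where
  laws : IsProp toPropData

/-- A homomorphism of props. -/
@[ext]
structure PropHom (R T : ColoredProp.{u}) where
  col : R.Col → T.Col
  map : {n m : ℕ} → {a : Fin n → R.Col} → {b : Fin m → R.Col} → R.Op a b →
    T.Op (fun i => col (a i)) (fun k => col (b k))
  map_id (c : R.Col) : map (R.id c) = T.id (col c)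
  map_unit : map R.unit =
    T.act (Equiv.refl _) (Equiv.refl _) (reflIn fun i => i.elim0) (reflOut fun i => i.elim0) T.unit
  map_vcomp {n m k : ℕ} {a : Fin n → R.Col} {b : Fin m → R.Col} {c : Fin k → R.Col}
    (f : R.Op b c) (g : R.Op a b) : map (R.vcomp f g) = T.vcomp (map f) (map g)
  map_hcomp {n m p q : ℕ} {a : Fin n → R.Col} {b : Fin m → R.Col} {a' : Fin p → R.Col}
    {b' : Fin q → R.Col} (f : R.Op a b) (g : R.Op a' b') :
    map (R.hcomp f g) = T.act (Equiv.refl _) (Equiv.refl _) (reflIn (append_map col a a'))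
      (reflOut (append_map col b b')) (T.hcomp (map f) (map g))
  map_inp {n n' m : ℕ} {a : Fin n → R.Col} {a' : Fin n' → R.Col} {b : Fin m → R.Col}
    (σ : Fin n' ≃ Fin n) (h : ∀ i, a' i = a (σ i)) (f : R.Op a b) :
    map (R.inp σ h f) = T.inp σ (fun i => congrArg col (h i)) (map f)
  map_out {n m m' : ℕ} {a : Fin n → R.Col} {b : Fin m → R.Col} {b' : Fin m' → R.Col}
    (τ : Fin m ≃ Fin m') (h : ∀ k, b' k = b (τ.symm k)) (f : R.Op a b) :
    map (R.out τ h f) = T.out τ (fun k => congrArg col (h k)) (map f)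

namespace ColoredProp
variable (T : ColoredProp.{u})

theorem act_act {n n' n'' m m' m'' : ℕ} {a : Fin n → T.Col} {a' : Fin n' → T.Col}
    {a'' : Fin n'' → T.Col} {b : Fin m → T.Col} {b' : Fin m' → T.Col} {b'' : Fin m'' → T.Col}
    (σ : Fin n'' ≃ Fin n') (τ : Fin m' ≃ Fin m'') (h : ∀ i, a'' i = a' (σ i))
    (k : ∀ k, b'' k = b' (τ.symm k)) (σ' : Fin n' ≃ Fin n) (τ' : Fin m ≃ Fin m')
    (h' : ∀ i, a' i = a (σ' i)) (k' : ∀ k, b' k = b (τ'.symm k)) (f : T.Op a b) :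
    T.act σ τ h k (T.act σ' τ' h' k' f) = T.act (σ.trans σ') (τ'.trans τ)
      (fun i => by simp only [Equiv.trans_apply, h, h']) (fun j => by simp only [Equiv.symm_trans_apply, k, k']) f := by
  unfold PropData.act
  rw [← T.laws.inp_out, T.laws.inp_inp, T.laws.out_out]

theorem act_congr {n n' m m' : ℕ} {a : Fin n → T.Col} {a' : Fin n' → T.Col}
    {b : Fin m → T.Col} {b' : Fin m' → T.Col}
    {σ σ' : Fin n' ≃ Fin n} {τ τ' : Fin m ≃ Fin m'} (h : ∀ i, a' i = a (σ i))
    (k : ∀ k, b' k = b (τ.symm k)) (h' : ∀ i, a' i = a (σ' i)) (k' : ∀ k, b' k = b (τ'.symm k))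
    (hσ : ∀ i, σ i = σ' i) (hτ : ∀ i, τ i = τ' i) (f : T.Op a b) :
    T.act σ τ h k f = T.act σ' τ' h' k' f := by
  obtain rfl := Equiv.ext hσ
  obtain rfl := Equiv.ext hτ
  rfl

theorem act_refl {n m : ℕ} {a : Fin n → T.Col} {b : Fin m → T.Col} (f : T.Op a b) :
    T.act (Equiv.refl _) (Equiv.refl _) (reflIn fun _ => rfl) (reflOut fun _ => rfl) f = f := by
  unfold PropData.act
  rw [T.laws.out_refl, T.laws.inp_refl]

theorem act_hcomp {n n' m m' p p' q q' : ℕ} {a : Fin n → T.Col} {a₁ : Fin n' → T.Col}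
    {b : Fin m → T.Col} {b₁ : Fin m' → T.Col}
    {a' : Fin p → T.Col} {a₁' : Fin p' → T.Col} {b' : Fin q → T.Col} {b₁' : Fin q' → T.Col}
    (σ : Fin n' ≃ Fin n) (τ : Fin m ≃ Fin m') (h : ∀ i, a₁ i = a (σ i))
    (k : ∀ i, b₁ i = b (τ.symm i)) (σ' : Fin p' ≃ Fin p) (τ' : Fin q ≃ Fin q')
    (h' : ∀ i, a₁' i = a' (σ' i)) (k' : ∀ i, b₁' i = b' (τ'.symm i))
    (f : T.Op a b) (g : T.Op a' b') :
    T.hcomp (T.act σ τ h k f) (T.act σ' τ' h' k' g) =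
      T.act (blockSum σ σ') (blockSum τ τ') (append_blockSum h h') (append_blockSum_symm k k')
        (T.hcomp f g) := by
  unfold PropData.act
  rw [T.laws.inp_hcomp, T.laws.out_hcomp]

theorem inp_id {n m : ℕ} {a : Fin n → T.Col} {b : Fin m → T.Col} {σ : Fin n ≃ Fin n}
    (h : ∀ i, a i = a (σ i)) (hσ : ∀ i, σ i = i) (f : T.Op a b) : T.inp σ h f = f := by
  obtain rfl : σ = Equiv.refl _ := Equiv.ext hσ
  exact T.laws.inp_refl f

theorem vcomp_act {n n' m m' k k' : ℕ} {a : Fin n → T.Col} {a' : Fin n' → T.Col}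
    {b : Fin m → T.Col} {b' : Fin m' → T.Col} {c : Fin k → T.Col} {c' : Fin k' → T.Col}
    (σ : Fin n' ≃ Fin n) (τ : Fin m ≃ Fin m') (τ' : Fin m' ≃ Fin m) (ρ : Fin k ≃ Fin k')
    (ha : ∀ i, a' i = a (σ i)) (hb : ∀ i, b' i = b (τ.symm i)) (hb' : ∀ i, b' i = b (τ' i))
    (hc : ∀ i, c' i = c (ρ.symm i)) (hτ : ∀ i, τ' (τ i) = i) (f : T.Op b c) (g : T.Op a b) :
    T.vcomp (T.act τ' ρ hb' hc f) (T.act σ τ ha hb g) = T.act σ ρ ha hc (T.vcomp f g) := by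
  obtain rfl : τ' = τ.symm := Equiv.ext fun i => by
    obtain ⟨i, rfl⟩ := τ.surjective i
    simp [hτ]
  unfold PropData.act
  have e : T.inp τ (fun i => by simp [hb]) (T.inp τ.symm hb' (T.out ρ hc f)) = T.out ρ hc f :=
    (T.laws.inp_inp ..).trans (T.inp_id _ (by simp) _)
  rw [T.laws.inp_out σ, T.laws.vcomp_out τ hb (fun i => by simp [hb]), e,
    ← T.laws.inp_vcomp, ← T.laws.out_vcomp]

theorem act_id {n m : ℕ} {a : Fin n → T.Col} {b : Fin m → T.Col} {σ : Fin n ≃ Fin n}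
    {τ : Fin m ≃ Fin m} (h : ∀ i, a i = a (σ i)) (k : ∀ i, b i = b (τ.symm i))
    (hσ : ∀ i, σ i = i) (hτ : ∀ i, τ i = i) (f : T.Op a b) : T.act σ τ h k f = f :=
  (T.act_congr h k (reflIn fun _ => rfl) (reflOut fun _ => rfl) hσ hτ f).trans (T.act_refl f)

theorem idList_succ {n : ℕ} (a : Fin (n + 1) → T.Col) :
    T.idList a = T.act (Equiv.refl (Fin (n + 1))) (Equiv.refl (Fin (n + 1)))
      (reflIn (append_snoc a)) (reflOut (append_snoc a))
      (T.hcomp (T.idList fun j : Fin n => a j.castSucc) (T.id (a (Fin.last n)))) := rfl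

theorem idList_congr {n : ℕ} {a a' : Fin n → T.Col} (h : ∀ i, a' i = a i) :
    T.idList a' = T.act (Equiv.refl _) (Equiv.refl _) (reflIn h) (reflOut h) (T.idList a) := by
  obtain rfl := funext h
  exact (T.act_refl _).symm

theorem id_congr {c c' : T.Col} (h : c' = c) :
    T.id c' = T.act (Equiv.refl _) (Equiv.refl _) (reflIn fun _ => h) (reflOut fun _ => h) (T.id c) := by
  subst h
  exact (T.act_refl _).symm

theorem idList_append {n m : ℕ} (a : Fin n → T.Col) (b : Fin m → T.Col) :
    T.idList (Fin.append a b) = T.hcomp (T.idList a) (T.idList b) := by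
  induction m with
  | zero =>
    obtain rfl : b = Fin.elim0 := Subsingleton.elim _ _
    have e0 : T.idList (Fin.elim0 : Fin 0 → T.Col) = T.unit := T.act_refl _
    rw [e0, T.laws.hcomp_unit]
    refine (T.idList_congr fun i => append_elim0_apply a i).trans (T.act_congr _ _ _ _ ?_ ?_ _) <;>
      intro i <;> rfl
  | succ m ih =>
    have e1 (i : Fin (n + m)) :
        Fin.append a b i.castSucc = Fin.append a (fun j : Fin m => b j.castSucc) i := by
      induction i using Fin.addCases with
      | left i =>
        rw [Fin.append_left]
        exact Fin.append_left a b i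
      | right i =>
        rw [Fin.append_right]
        exact Fin.append_right a b i.castSucc
    have e2 : Fin.append a b (Fin.last (n + m)) = b (Fin.last m) :=
      Fin.append_right a b (Fin.last m)
    refine (T.idList_succ (n := n + m) (@Fin.append n (m + 1) _ a b)).trans ?_
    rw [T.idList_congr e1, T.id_congr e2, ih, T.act_hcomp, T.laws.hcomp_assoc, T.idList_succ b]
    conv_rhs => rw [← T.act_refl (T.idList a), T.act_hcomp]
    refine (T.act_act ..).trans ((T.act_act ..).trans (T.act_congr _ _ _ _ ?_ ?_ _))
    all_goals
      intro i
      simp only [blockSum_refl]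
      rfl

end ColoredProp
end PropOperad

namespace PropOperad

/-- A finite totally ordered index set, given by its increasing enumeration. -/
class Listed (I : Type) where
  size : ℕ
  enum : Fin size ≃ I

namespace Listed

instance instFin (n : ℕ) : Listed (Fin n) := ⟨n, Equiv.refl _⟩

instance instUnit : Listed Unit := ⟨1, Equiv.ofUnique (Fin 1) Unit⟩

/-- The left summand comes first. -/
instance instSum (I J : Type) [Listed I] [Listed J] : Listed (I ⊕ J) :=
  ⟨size I + size J, finSumFinEquiv.symm.trans (enum.sumCongr enum)⟩

/-- The lexicographic order. -/
instance instSigma (I : Type) (J : I → Type) [Listed I] [∀ i, Listed (J i)] :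
    Listed (Σ i, J i) :=
  ⟨∑ k : Fin (size I), size (J (enum k)),
    finSigmaFinEquiv.symm.trans
      ((Equiv.sigmaCongrRight fun k => (enum : _ ≃ J (enum k))).trans
        (Equiv.sigmaCongrLeft (β := J) (enum : _ ≃ I)))⟩

open Classical in
/-- A subset with the induced order. -/
noncomputable instance instSubtype (I : Type) [Listed I] (p : I → Prop) : Listed {i // p i} :=
  ⟨(Finset.univ.filter fun k : Fin (size I) => p (enum k)).card,
    (Finset.orderIsoOfFin _ rfl).toEquiv.trans
      ((enum : _ ≃ I).subtypeEquiv fun k => by simp)⟩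

end Listed

open Listed

theorem pf {p : Prop} (h : p) : p := h

/-- Interchange of the two indices of a double family. -/
def sigmaSwap (I J : Type) : (Σ _ : I, J) ≃ Σ _ : J, I where
  toFun s := ⟨s.2, s.1⟩
  invFun s := ⟨s.2, s.1⟩
  left_inv _ := rfl
  right_inv _ := rfl

/-- Splitting off the first block. -/
def sigmaSucc {n : ℕ} (I : Fin (n + 1) → Type) :
    (I 0 ⊕ Σ i : Fin n, I i.succ) ≃ Σ i, I i where
  toFun := Sum.elim (fun x => ⟨0, x⟩) (fun s => ⟨s.1.succ, s.2⟩)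
  invFun s := Fin.cases (motive := fun i => I i → I 0 ⊕ Σ i : Fin n, I i.succ)
    (fun x => Sum.inl x) (fun i x => Sum.inr ⟨i, x⟩) s.1 s.2
  left_inv := by rintro (x | ⟨i, x⟩) <;> rfl
  right_inv := by
    rintro ⟨i, x⟩
    induction i using Fin.cases <;> rfl

section
variable {I J : Type} [Listed I] [Listed J]

theorem enum_castAdd (i : Fin (size I)) :
    (@enum (I ⊕ J) _) (Fin.castAdd _ i) = Sum.inl (enum i) := by
  change Sum.map _ _ (finSumFinEquiv.symm (Fin.castAdd _ i)) = _
  rw [finSumFinEquiv_symm_apply_castAdd]; rfl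

theorem enum_natAdd (i : Fin (size J)) :
    (@enum (I ⊕ J) _) (Fin.natAdd _ i) = Sum.inr (enum i) := by
  change Sum.map _ _ (finSumFinEquiv.symm (Fin.natAdd _ i)) = _
  rw [finSumFinEquiv_symm_apply_natAdd]; rfl

theorem enum_symm_inl (i : I) :
    (@enum (I ⊕ J) _).symm (Sum.inl i) = Fin.castAdd _ (enum.symm i) := by
  rw [Equiv.symm_apply_eq, enum_castAdd, Equiv.apply_symm_apply]

theorem enum_symm_inr (i : J) :
    (@enum (I ⊕ J) _).symm (Sum.inr i) = Fin.natAdd _ (enum.symm i) := by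
  rw [Equiv.symm_apply_eq, enum_natAdd, Equiv.apply_symm_apply]

theorem elim_enum {C : Type u} (a : I → C) (b : J → C) (i : Fin (size I + size J)) :
    Sum.elim a b ((@enum (I ⊕ J) _) i) =
      Fin.append (fun i => a (enum i)) (fun i => b (enum i)) i := by
  induction i using Fin.addCases with
  | left i => rw [enum_castAdd, Fin.append_left]; rfl
  | right i => rw [enum_natAdd, Fin.append_right]; rfl

theorem enum_sumCongr {I' J' : Type} [Listed I'] [Listed J'] (σ : I ≃ I') (ρ : J ≃ J')
    (i : Fin (size I + size J)) :
    (@enum (I' ⊕ J') _).symm ((σ.sumCongr ρ) ((@enum (I ⊕ J) _) i)) =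
      blockSum ((enum.trans σ).trans enum.symm) ((enum.trans ρ).trans enum.symm) i := by
  refine (Equiv.symm_apply_eq _).2 ?_
  induction i using Fin.addCases with
  | left i =>
    rw [enum_castAdd, blockSum, Equiv.trans_apply, finSumFinEquiv_symm_apply_castAdd,
      Equiv.trans_apply, Equiv.sumCongr_apply, Equiv.sumCongr_apply]
    refine ((enum_castAdd _).trans ?_).symm
    exact congrArg Sum.inl (Equiv.apply_symm_apply _ _)
  | right i =>
    rw [enum_natAdd, blockSum, Equiv.trans_apply, finSumFinEquiv_symm_apply_natAdd,
      Equiv.trans_apply, Equiv.sumCongr_apply, Equiv.sumCongr_apply]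
    refine ((enum_natAdd _).trans ?_).symm
    exact congrArg Sum.inr (Equiv.apply_symm_apply _ _)

theorem enum_sumComm (i : Fin (size I + size J)) :
    (@enum (J ⊕ I) _).symm (Equiv.sumComm I J ((@enum (I ⊕ J) _) i)) = finAddFlip i := by
  refine (Equiv.symm_apply_eq _).2 ?_
  induction i using Fin.addCases with
  | left i => rw [enum_castAdd, finAddFlip_apply_castAdd]; exact (enum_natAdd i).symm
  | right i => rw [enum_natAdd, finAddFlip_apply_natAdd]; exact (enum_castAdd i).symm

theorem enum_sumAssoc {K : Type} [Listed K] (i : Fin (size I + size J + size K)) :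
    (@enum (I ⊕ J ⊕ K) _).symm (Equiv.sumAssoc I J K ((@enum ((I ⊕ J) ⊕ K) _) i)) =
      finCongr (Nat.add_assoc _ _ _) i := by
  refine (Equiv.symm_apply_eq _).2 ?_
  induction i using Fin.addCases with
  | left i =>
    refine (congrArg _ (enum_castAdd (I := I ⊕ J) i)).trans ?_
    induction i using Fin.addCases with
    | left i =>
      rw [enum_castAdd]
      exact (enum_castAdd (J := J ⊕ K) i).symm
    | right i =>
      rw [enum_natAdd]
      refine Eq.trans ?_ ((congrArg _ (Fin.ext ?_)).trans
        (enum_natAdd (J := J ⊕ K) (Fin.castAdd _ i))).symm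
      · exact (congrArg Sum.inr (enum_castAdd i)).symm
      · simp
  | right i =>
    refine (congrArg _ (enum_natAdd (I := I ⊕ J) i)).trans ?_
    refine Eq.trans ?_ ((congrArg _ (Fin.ext ?_)).trans
      (enum_natAdd (J := J ⊕ K) (Fin.natAdd _ i))).symm
    · exact (congrArg Sum.inr (enum_natAdd i)).symm
    · simp [Nat.add_assoc]

theorem enum_sumEmpty (i : Fin (size I)) :
    (@enum (I ⊕ Fin 0) _).symm ((Equiv.sumEmpty I (Fin 0)).symm (enum i)) =
      finCongr (Nat.add_zero _).symm i := by
  refine (Equiv.symm_apply_eq _).2 ?_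
  exact (enum_castAdd i).symm
end

namespace ColoredProp
variable (T : ColoredProp.{u})

/-- Operations between lists of colours indexed by finite ordered sets. -/
abbrev Ext {I J : Type} [Listed I] [Listed J] (a : I → T.Col) (b : J → T.Col) : Type u :=
  T.Op (fun i => a (enum i)) (fun j => b (enum j))

section
variable {T}
variable {I I' I'' J J' J'' K K' L L' : Type} [Listed I] [Listed I'] [Listed I''] [Listed J]
  [Listed J'] [Listed J''] [Listed K] [Listed K'] [Listed L] [Listed L']

/-- The action of bijections of the index sets of inputs and outputs, carrying the entry at `i`
to the entry at `σ i`. -/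
def rel {a : I → T.Col} {a' : I' → T.Col} {b : J → T.Col} {b' : J' → T.Col} (σ : I ≃ I')
    (τ : J ≃ J') (ha : ∀ i, a' (σ i) = a i) (hb : ∀ j, b' (τ j) = b j) (x : T.Ext a b) :
    T.Ext a' b' :=
  T.act ((enum.trans σ.symm).trans enum.symm) ((enum.trans τ).trans enum.symm)
    (fun i => by simp [← ha]) (fun j => by simp [← hb]) x

/-- Vertical composition. -/
def vc {a : I → T.Col} {b : J → T.Col} {c : K → T.Col} (f : T.Ext b c) (g : T.Ext a b) :
    T.Ext a c :=
  T.vcomp f g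

/-- Horizontal composition. -/
def hc {a : I → T.Col} {b : J → T.Col} {a' : I' → T.Col} {b' : J' → T.Col} (f : T.Ext a b)
    (g : T.Ext a' b') : T.Ext (Sum.elim a a') (Sum.elim b b') :=
  T.act (Equiv.refl _) (Equiv.refl _) (reflIn (elim_enum a a')) (reflOut (elim_enum b b'))
    (T.hcomp f g)

/-- The identity of a list. -/
def il (a : I → T.Col) : T.Ext a a := T.idList fun i => a (enum i)

/-- The empty horizontal composite. -/
def un : T.Ext (Fin.elim0 : Fin 0 → T.Col) (Fin.elim0 : Fin 0 → T.Col) :=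
  T.act (Equiv.refl _) (Equiv.refl _) (reflIn fun i => i.elim0) (reflOut fun i => i.elim0) T.unit

theorem rel_congr {a : I → T.Col} {a' : I' → T.Col} {b : J → T.Col} {b' : J' → T.Col}
    {σ σ' : I ≃ I'} {τ τ' : J ≃ J'} (ha : ∀ i, a' (σ i) = a i) (hb : ∀ j, b' (τ j) = b j)
    (ha' : ∀ i, a' (σ' i) = a i) (hb' : ∀ j, b' (τ' j) = b j) (x : T.Ext a b)
    (hσ : ∀ i, σ i = σ' i) (hτ : ∀ i, τ i = τ' i) : rel σ τ ha hb x = rel σ' τ' ha' hb' x := by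
  obtain rfl := Equiv.ext hσ
  obtain rfl := Equiv.ext hτ
  rfl

theorem rel_rel {a : I → T.Col} {a' : I' → T.Col} {a'' : I'' → T.Col} {b : J → T.Col}
    {b' : J' → T.Col} {b'' : J'' → T.Col} (σ : I ≃ I') (τ : J ≃ J')
    (ha : ∀ i, a' (σ i) = a i) (hb : ∀ j, b' (τ j) = b j) (σ' : I' ≃ I'') (τ' : J' ≃ J'')
    (ha' : ∀ i, a'' (σ' i) = a' i) (hb' : ∀ j, b'' (τ' j) = b' j) (x : T.Ext a b) :
    rel σ' τ' ha' hb' (rel σ τ ha hb x) = rel (σ.trans σ') (τ.trans τ')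
      (fun i => by rw [Equiv.trans_apply, ha', ha]) (fun i => by rw [Equiv.trans_apply, hb', hb])
      x := by
  unfold rel
  rw [T.act_act]
  refine T.act_congr _ _ _ _ ?_ ?_ x <;> intro i <;> simp

theorem rel_id {a : I → T.Col} {b : J → T.Col} {σ : I ≃ I} {τ : J ≃ J}
    (ha : ∀ i, a (σ i) = a i) (hb : ∀ j, b (τ j) = b j) (x : T.Ext a b)
    (hσ : ∀ i, σ i = i) (hτ : ∀ i, τ i = i) : rel σ τ ha hb x = x := by
  obtain rfl : σ = Equiv.refl _ := Equiv.ext hσ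
  obtain rfl : τ = Equiv.refl _ := Equiv.ext hτ
  unfold rel
  refine T.act_id _ _ ?_ ?_ _ <;> simp

theorem vc_rel {a : I → T.Col} {a' : I' → T.Col} {b : J → T.Col} {b' : J' → T.Col}
    {c : K → T.Col} {c' : K' → T.Col} (σ : I ≃ I') (τ τ' : J ≃ J') (ρ : K ≃ K')
    (ha : ∀ i, a' (σ i) = a i) (hb : ∀ j, b' (τ j) = b j) (hb' : ∀ j, b' (τ' j) = b j)
    (hc : ∀ k, c' (ρ k) = c k) (hτ : ∀ i, τ i = τ' i) (f : T.Ext b c) (g : T.Ext a b) :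
    vc (rel τ ρ hb hc f) (rel σ τ' ha hb' g) = rel σ ρ ha hc (vc f g) := by
  obtain rfl : τ = τ' := Equiv.ext hτ
  unfold vc rel
  exact T.vcomp_act _ _ _ _ _ _ _ _ (fun i => by simp) f g

theorem vc_assoc {a : I → T.Col} {b : J → T.Col} {c : K → T.Col} {d : L → T.Col}
    (f : T.Ext c d) (g : T.Ext b c) (h : T.Ext a b) : vc (vc f g) h = vc f (vc g h) :=
  T.laws.vcomp_assoc f g h

theorem il_vc {a : I → T.Col} {b : J → T.Col} (f : T.Ext a b) : vc (il b) f = f :=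
  T.laws.idList_vcomp f

theorem vc_il {a : I → T.Col} {b : J → T.Col} (f : T.Ext a b) : vc f (il a) = f :=
  T.laws.vcomp_idList f

theorem rel_il {a : I → T.Col} {a' : I' → T.Col} (σ σ' : I ≃ I') (ha : ∀ i, a' (σ i) = a i)
    (ha' : ∀ i, a' (σ' i) = a i) (hσ : ∀ i, σ i = σ' i) :
    rel σ σ' ha ha' (il a) = il a' := by
  obtain rfl : σ = σ' := Equiv.ext hσ
  have hs : ∀ i, a (σ.symm i) = a' i := fun i => by rw [← ha, Equiv.apply_symm_apply]
  have e (x : T.Ext a' a') : rel σ σ ha ha (rel σ.symm σ.symm hs hs x) = x := by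
    rw [rel_rel]
    exact rel_id _ _ _ (by simp) (by simp)
  rw [← il_vc (rel σ σ ha ha' (il a)), ← e (il a'), vc_rel _ _ _ _ _ _ _ _ fun _ => rfl, vc_il]

theorem hc_rel {a : I → T.Col} {a' : I' → T.Col} {b : J → T.Col} {b' : J' → T.Col}
    {c : K → T.Col} {c' : K' → T.Col} {d : L → T.Col} {d' : L' → T.Col} (σ : I ≃ I')
    (τ : J ≃ J') (ρ : K ≃ K') (π : L ≃ L')
    (ha : ∀ i, a' (σ i) = a i) (hb : ∀ j, b' (τ j) = b j) (hcc : ∀ k, c' (ρ k) = c k)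
    (hd : ∀ l, d' (π l) = d l) (f : T.Ext a b) (g : T.Ext c d) :
    hc (rel σ τ ha hb f) (rel ρ π hcc hd g) = rel (σ.sumCongr ρ) (τ.sumCongr π)
      (pf <| by rintro (i | i) <;> simp [ha, hcc]) (pf <| by rintro (i | i) <;> simp [hb, hd]) (hc f g) := by
  unfold hc rel
  rw [T.act_hcomp]
  refine (T.act_act ..).trans (Eq.trans ?_ (T.act_act ..).symm)
  refine T.act_congr _ _ _ _ ?_ ?_ _ <;> intro i <;> exact (enum_sumCongr _ _ i).symm

theorem ext_act {a : I → T.Col} {b : J → T.Col} (f : T.Ext a b) :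
    f = T.act (Equiv.refl _) (Equiv.refl _) (reflIn fun _ => rfl) (reflOut fun _ => rfl) f :=
  (T.act_refl f).symm

theorem hc_assoc {a : I → T.Col} {b : J → T.Col} {a' : I' → T.Col} {b' : J' → T.Col}
    {c : K → T.Col} {d : L → T.Col} (f : T.Ext a b) (g : T.Ext a' b') (h : T.Ext c d) :
    hc f (hc g h) = rel (Equiv.sumAssoc ..) (Equiv.sumAssoc ..)
      (pf <| by rintro ((i | i) | i) <;> rfl) (pf <| by rintro ((i | i) | i) <;> rfl) (hc (hc f g) h) := by
  unfold hc rel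
  conv_lhs => rw [ext_act f]
  conv_rhs => rw [ext_act h]
  rw [T.act_hcomp, T.act_hcomp, T.laws.hcomp_assoc]
  refine (T.act_act ..).trans (Eq.trans ?_ ((congrArg _ (T.act_act ..)).trans
    ((congrArg _ (T.act_act ..)).trans (T.act_act ..))).symm)
  refine T.act_congr _ _ _ _ ?_ ?_ _
  · intro i
    simp only [blockSum_refl]
    have h := enum_sumAssoc ((@enum ((I ⊕ I') ⊕ K) _).symm
      ((Equiv.sumAssoc I I' K).symm (enum i)))
    rw [Equiv.apply_symm_apply, Equiv.apply_symm_apply, Equiv.symm_apply_apply] at h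
    exact h
  · intro i
    simp only [blockSum_refl]
    exact (enum_sumAssoc ((finCongr (Nat.add_assoc ..)).symm i)).symm

theorem hc_comm {a : I → T.Col} {b : J → T.Col} {a' : I' → T.Col} {b' : J' → T.Col}
    (f : T.Ext a b) (g : T.Ext a' b') :
    hc g f = rel (Equiv.sumComm ..) (Equiv.sumComm ..)
      (pf <| by rintro (i | i) <;> rfl) (pf <| by rintro (i | i) <;> rfl) (hc f g) := by
  unfold hc rel
  rw [← T.laws.hcomp_swap]
  refine (T.act_act ..).trans (Eq.trans ?_ (T.act_act ..).symm)
  refine T.act_congr _ _ _ _ ?_ ?_ _ <;> intro i <;> exact (enum_sumComm i).symm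

theorem hc_un {a : I → T.Col} {b : J → T.Col} (f : T.Ext a b) :
    hc f un = rel (Equiv.sumEmpty I (Fin 0)).symm (Equiv.sumEmpty J (Fin 0)).symm
      (fun _ => rfl) (fun _ => rfl) f := by
  unfold hc rel un
  conv_lhs => rw [ext_act f]
  rw [T.act_hcomp, T.laws.hcomp_unit]
  refine (T.act_act ..).trans ((T.act_act ..).trans ?_)
  refine T.act_congr _ _ _ _ ?_ ?_ _
  · intro i
    simp only [blockSum_refl]
    have h := enum_sumEmpty ((@enum I _).symm ((Equiv.sumEmpty I (Fin 0)) (enum i)))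
    rw [Equiv.apply_symm_apply, Equiv.symm_apply_apply, Equiv.symm_apply_apply] at h
    exact (congrArg (finCongr (Nat.add_zero _)) h)
  · intro i
    simp only [blockSum_refl]
    exact (enum_sumEmpty i).symm

theorem hc_vc {a : I → T.Col} {b : J → T.Col} {c : K → T.Col} {a' : I' → T.Col}
    {b' : J' → T.Col} {c' : K' → T.Col} (f : T.Ext b c) (g : T.Ext a b) (f' : T.Ext b' c')
    (g' : T.Ext a' b') : hc (vc f g) (vc f' g') = vc (hc f f') (hc g g') := by
  unfold hc vc
  rw [T.laws.interchange]
  exact (T.vcomp_act _ _ _ _ _ _ _ _ (fun i => rfl) _ _).symm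

theorem il_sum (a : I → T.Col) (b : J → T.Col) : il (Sum.elim a b) = hc (il a) (il b) := by
  unfold hc il
  rw [← T.idList_append]
  exact T.idList_congr (elim_enum a b)

end
end ColoredProp
end PropOperad

namespace PropOperad
open Listed

namespace ColoredProp
variable {T : ColoredProp.{u}}

/-- The horizontal composite `f 0 ∘ₕ f 1 ∘ₕ ⋯ ∘ₕ f (n-1)`; it is the empty composite for `n = 0`. -/
def hl : {n : ℕ} → {I J : Fin n → Type} → [∀ i, Listed (I i)] → [∀ i, Listed (J i)] →
    {a : ∀ i, I i → T.Col} → {b : ∀ i, J i → T.Col} → (∀ i, T.Ext (a i) (b i)) →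
    T.Ext (fun s : Σ i, I i => a s.1 s.2) (fun s : Σ i, J i => b s.1 s.2)
  | 0, _, _, _, _, _, _, _ =>
    rel (Equiv.equivOfIsEmpty _ _) (Equiv.equivOfIsEmpty _ _) (fun i => i.elim0)
      (fun i => i.elim0) un
  | _ + 1, I, J, _, _, _, _, f =>
    rel (sigmaSucc I) (sigmaSucc J) (pf <| by rintro (i | i) <;> rfl) (pf <| by rintro (i | i) <;> rfl)
      (hc (f 0) (hl fun i => f i.succ))

section
variable {K L : Type} [Listed K] [Listed L] {I J : K → Type} [∀ k, Listed (I k)]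
  [∀ k, Listed (J k)] {a : ∀ k, I k → T.Col} {b : ∀ k, J k → T.Col}

/-- The horizontal composite of a family along an enumeration of its index set. -/
def bigE {n : ℕ} (e : Fin n ≃ K) (f : ∀ k, T.Ext (a k) (b k)) :
    T.Ext (fun s : Σ k, I k => a s.1 s.2) (fun s : Σ k, J k => b s.1 s.2) :=
  rel (a := fun s : Σ i, I (e i) => a (e s.1) s.2) (b := fun s : Σ i, J (e i) => b (e s.1) s.2)
    (Equiv.sigmaCongrLeft e) (Equiv.sigmaCongrLeft e) (pf fun _ => rfl) (pf fun _ => rfl)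
    (hl fun k => f (e k))

/-- The horizontal composite `⟨f k⟩_{k ∈ K}` of a finite ordered family. -/
def big (f : ∀ k, T.Ext (a k) (b k)) :
    T.Ext (fun s : Σ k, I k => a s.1 s.2) (fun s : Σ k, J k => b s.1 s.2) :=
  bigE enum f
end

section
variable {n : ℕ} {I J I' J' : Fin n → Type} [∀ k, Listed (I k)]
  [∀ k, Listed (J k)] [∀ k, Listed (I' k)] [∀ k, Listed (J' k)] {a : ∀ k, I k → T.Col}
  {b : ∀ k, J k → T.Col} {a' : ∀ k, I' k → T.Col} {b' : ∀ k, J' k → T.Col}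

theorem hl_succ {I J : Fin (n + 1) → Type} [∀ k, Listed (I k)]
    [∀ k, Listed (J k)] {a : ∀ k, I k → T.Col} {b : ∀ k, J k → T.Col}
    (f : ∀ k, T.Ext (a k) (b k)) : hl f =
      rel (sigmaSucc I) (sigmaSucc J) (pf <| by rintro (i | i) <;> rfl)
        (pf <| by rintro (i | i) <;> rfl) (hc (f 0) (hl fun i => f i.succ)) := rfl

theorem hl_rel (σ : ∀ i, I i ≃ I' i) (τ : ∀ i, J i ≃ J' i)
    (ha : ∀ i k, a' i (σ i k) = a i k) (hb : ∀ i k, b' i (τ i k) = b i k)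
    (f : ∀ k, T.Ext (a k) (b k)) :
    hl (fun i => rel (σ i) (τ i) (ha i) (hb i) (f i)) =
      rel (Equiv.sigmaCongrRight σ) (Equiv.sigmaCongrRight τ) (pf fun i => ha i.1 i.2)
        (pf fun i => hb i.1 i.2) (hl f) := by
  induction n with
  | zero =>
    refine Eq.trans ?_ (rel_rel ..).symm
    exact rel_congr _ _ _ _ _ (fun i => i.elim0) (fun i => i.elim0)
  | succ n ih =>
    have := ih (fun i => σ i.succ) (fun i => τ i.succ) (fun i => ha i.succ) (fun i => hb i.succ)
      (fun i => f i.succ)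
    unfold hl
    rw [this, hc_rel]
    refine (rel_rel ..).trans (Eq.trans ?_ (rel_rel ..).symm)
    refine rel_congr _ _ _ _ _ ?_ ?_ <;> rintro (i | i) <;> rfl

theorem hl_vc {M : Fin n → Type} [∀ k, Listed (M k)] {c : ∀ k, M k → T.Col}
    (f : ∀ k, T.Ext (b k) (c k)) (g : ∀ k, T.Ext (a k) (b k)) :
    hl (fun i => vc (f i) (g i)) = vc (hl f) (hl g) := by
  induction n with
  | zero =>
    have e : (un : T.Ext _ _) = vc un un := by
      have : (un : T.Ext _ _) = il _ := rfl
      conv_rhs => rw [this, il_vc, ← this]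
    unfold hl
    refine Eq.trans ?_ (vc_rel _ _ _ _ _ _ _ _ ?_ _ _).symm
    · conv_lhs => rw [e]
    · exact fun _ => rfl
  | succ n ih =>
    have := ih (fun i => f i.succ) (fun i => g i.succ)
    unfold hl
    rw [this, hc_vc]
    exact (vc_rel _ _ _ _ _ _ _ _ (fun _ => rfl) _ _).symm

theorem hl_il (a : ∀ k, I k → T.Col) : hl (fun i => il (a i)) = il _ := by
  induction n with
  | zero =>
    unfold hl
    have : (un : T.Ext _ _) = il _ := rfl
    rw [this]
    exact rel_il _ _ _ _ fun _ => rfl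
  | succ n ih =>
    have := ih (fun i => a i.succ)
    unfold hl
    rw [this, ← il_sum]
    exact rel_il _ _ _ _ fun _ => rfl

/-- Exchange of the first two of three blocks. -/
def sumLeftComm (A B C : Type) : A ⊕ B ⊕ C ≃ B ⊕ A ⊕ C where
  toFun := Sum.elim (fun x => .inr (.inl x)) (Sum.elim .inl fun x => .inr (.inr x))
  invFun := Sum.elim (fun x => .inr (.inl x)) (Sum.elim .inl fun x => .inr (.inr x))
  left_inv := by rintro (x | x | x) <;> rfl
  right_inv := by rintro (x | x | x) <;> rfl

end

section
variable {A B C D A' B' C' D' : Type} [Listed A] [Listed B] [Listed C] [Listed D]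
    [Listed A'] [Listed B'] [Listed C'] [Listed D'] {a : A → T.Col} {b : B → T.Col}
    {c : C → T.Col} {d : D → T.Col} {a' : A' → T.Col} {b' : B' → T.Col}
    {c' : C' → T.Col} {d' : D' → T.Col}

theorem hc_rel_left (σ : A ≃ B) (τ : A' ≃ B') (h : ∀ i, b (σ i) = a i)
    (h' : ∀ i, b' (τ i) = a' i) (f : T.Ext a a') (g : T.Ext c c') :
    hc (rel σ τ h h' f) g = rel (σ.sumCongr (Equiv.refl _)) (τ.sumCongr (Equiv.refl _))
      (pf <| by rintro (i | i) <;> simp [h]) (pf <| by rintro (i | i) <;> simp [h']) (hc f g) := by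
  refine Eq.trans ?_ (hc_rel σ τ (Equiv.refl _) (Equiv.refl _) h h' (fun _ => rfl)
    (fun _ => rfl) f g)
  exact congrArg _ (rel_id _ _ _ (fun _ => rfl) (fun _ => rfl)).symm

theorem hc_rel_right (σ : A ≃ B) (τ : A' ≃ B') (h : ∀ i, b (σ i) = a i)
    (h' : ∀ i, b' (τ i) = a' i) (f : T.Ext a a') (g : T.Ext c c') :
    hc g (rel σ τ h h' f) = rel ((Equiv.refl _).sumCongr σ) ((Equiv.refl _).sumCongr τ)
      (pf <| by rintro (i | i) <;> simp [h]) (pf <| by rintro (i | i) <;> simp [h']) (hc g f) := by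
  refine Eq.trans ?_ (hc_rel (Equiv.refl _) (Equiv.refl _) σ τ (fun _ => rfl) (fun _ => rfl)
    h h' g f)
  exact congrArg (fun x => hc x _) (rel_id _ _ _ (fun _ => rfl) (fun _ => rfl)).symm

theorem hc_assoc' (x : T.Ext a a') (y : T.Ext b b') (z : T.Ext c c') :
    hc (hc x y) z = rel (Equiv.sumAssoc ..).symm (Equiv.sumAssoc ..).symm
      (pf <| by rintro (i | i | i) <;> rfl) (pf <| by rintro (i | i | i) <;> rfl) (hc x (hc y z)) := by
  rw [hc_assoc, rel_rel]
  exact (rel_id _ _ _ (by simp) (by simp)).symm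

theorem hc_left_comm (g : T.Ext b b') (h : T.Ext c c') (k : T.Ext d d') : hc g (hc h k) =
    rel (sumLeftComm ..) (sumLeftComm ..) (pf <| by rintro (i | i | i) <;> rfl)
      (pf <| by rintro (i | i | i) <;> rfl) (hc h (hc g k)) := by
  rw [hc_assoc, hc_comm h g, hc_assoc h g k, hc_rel_left, rel_rel, rel_rel]
  refine rel_congr _ _ _ _ _ ?_ ?_ <;> rintro ((i | i) | i) <;> rfl

theorem hc_medial (x : T.Ext a a') (y : T.Ext b b') (z : T.Ext c c') (w : T.Ext d d') :
    hc (hc x y) (hc z w) = rel (Equiv.sumSumSumComm ..) (Equiv.sumSumSumComm ..)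
      (pf <| by rintro ((i | i) | (i | i)) <;> rfl) (pf <| by rintro ((i | i) | (i | i)) <;> rfl)
      (hc (hc x z) (hc y w)) := by
  rw [hc_assoc', hc_left_comm y, hc_rel_right, hc_assoc, rel_rel, rel_rel]
  refine rel_congr _ _ _ _ _ ?_ ?_ <;> rintro ((i | i) | (i | i)) <;> rfl
end

section
variable {n : ℕ} {I J I' J' : Fin n → Type} [∀ k, Listed (I k)]
  [∀ k, Listed (J k)] [∀ k, Listed (I' k)] [∀ k, Listed (J' k)] {a : ∀ k, I k → T.Col}
  {b : ∀ k, J k → T.Col} {a' : ∀ k, I' k → T.Col} {b' : ∀ k, J' k → T.Col}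

theorem hl_hc (f : ∀ k, T.Ext (a k) (b k)) (g : ∀ k, T.Ext (a' k) (b' k)) :
    hl (fun i => hc (f i) (g i)) =
      rel (Equiv.sigmaSumDistrib I I').symm (Equiv.sigmaSumDistrib J J').symm
        (pf <| by rintro (i | i) <;> rfl) (pf <| by rintro (i | i) <;> rfl) (hc (hl f) (hl g)) := by
  induction n with
  | zero =>
    unfold hl
    rw [hc_rel, hc_un, rel_rel]
    refine (Eq.trans ?_ (rel_rel ..).symm)
    exact rel_congr _ _ _ _ _ (fun i => i.elim0) (fun i => i.elim0)
  | succ n ih =>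
    have := ih (fun i => f i.succ) (fun i => g i.succ)
    unfold hl
    rw [this, hc_rel, hc_rel_right, hc_medial]
    refine (congrArg _ (rel_rel ..)).trans ((rel_rel ..).trans
      (Eq.trans ?_ (rel_rel ..).symm))
    refine rel_congr _ _ _ _ _ ?_ ?_ <;> rintro ((i | i) | (i | i)) <;> rfl

end
end ColoredProp
end PropOperad

namespace PropOperad
open Listed

/-- The extension of a permutation by the fixed point `0`. -/
def finExt {n : ℕ} (σ : Fin n ≃ Fin n) : Fin (n + 1) ≃ Fin (n + 1) where
  toFun := Fin.cases 0 fun i => (σ i).succ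
  invFun := Fin.cases 0 fun i => (σ.symm i).succ
  left_inv i := by induction i using Fin.cases <;> simp
  right_inv i := by induction i using Fin.cases <;> simp

/-- The exchange of `0` and `1`. -/
def finSwap (n : ℕ) : Fin (n + 2) ≃ Fin (n + 2) where
  toFun := Fin.cases (Fin.succ 0) (Fin.cases 0 fun i => i.succ.succ)
  invFun := Fin.cases (Fin.succ 0) (Fin.cases 0 fun i => i.succ.succ)
  left_inv i := by
    induction i using Fin.cases with
    | zero => rfl
    | succ i => induction i using Fin.cases <;> rfl
  right_inv i := by
    induction i using Fin.cases with
    | zero => rfl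
    | succ i => induction i using Fin.cases <;> rfl

theorem exists_finExt {n : ℕ} (τ : Fin (n + 1) ≃ Fin (n + 1)) (h : τ 0 = 0) :
    ∃ σ, τ = finExt σ := by
  obtain ⟨⟨p, e⟩, rfl⟩ := Equiv.Perm.decomposeFin.symm.surjective τ
  rw [Equiv.Perm.decomposeFin_symm_apply_zero] at h
  subst h
  refine ⟨e, Equiv.ext fun i => ?_⟩
  induction i using Fin.cases with
  | zero => rw [Equiv.Perm.decomposeFin_symm_apply_zero]; rfl
  | succ i => rw [Equiv.Perm.decomposeFin_symm_apply_succ, Equiv.swap_self]; rfl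

theorem perm_ind (P : ∀ n, (Fin n ≃ Fin n) → Prop) (hrefl : ∀ n, P n (Equiv.refl _))
    (htrans : ∀ n σ τ, P n σ → P n τ → P n (σ.trans τ)) (hext : ∀ n σ, P n σ → P (n + 1) (finExt σ))
    (hswap : ∀ n, P (n + 2) (finSwap n)) (n : ℕ) (σ : Fin n ≃ Fin n) : P n σ := by
  induction n with
  | zero =>
    obtain rfl : σ = Equiv.refl _ := Equiv.ext fun i => i.elim0
    exact hrefl 0
  | succ n ih =>
    rcases Fin.eq_zero_or_eq_succ (σ 0) with h | ⟨k, h⟩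
    · obtain ⟨τ, rfl⟩ := exists_finExt σ h
      exact hext _ _ (ih τ)
    · cases n with
      | zero => exact k.elim0
      | succ n =>
        obtain ⟨τ, hτ⟩ := exists_finExt ((σ.trans (finExt (Equiv.swap k 0))).trans (finSwap n)) (by
          rw [Equiv.trans_apply, Equiv.trans_apply, h]
          change finSwap n (Fin.succ (Equiv.swap k 0 k)) = 0
          rw [Equiv.swap_apply_left]
          rfl)
        have e : σ = ((finExt τ).trans (finSwap n).symm).trans (finExt (Equiv.swap k 0)).symm := by
          rw [← hτ]
          ext i
          simp
        rw [e]
        exact htrans _ _ _ (htrans _ _ _ (hext _ _ (ih τ)) (hswap n)) (hext _ _ (ih _))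

namespace ColoredProp
variable {T : ColoredProp.{u}}

theorem hl_perm (n : ℕ) (σ : Fin n ≃ Fin n) : ∀ {I J : Fin n → Type} [∀ i, Listed (I i)]
    [∀ i, Listed (J i)] {a : ∀ i, I i → T.Col} {b : ∀ i, J i → T.Col}
    (f : ∀ i, T.Ext (a i) (b i)), hl f = bigE σ f := by
  refine perm_ind (fun n σ => ∀ {I J : Fin n → Type} [∀ i, Listed (I i)]
    [∀ i, Listed (J i)] {a : ∀ i, I i → T.Col} {b : ∀ i, J i → T.Col}
    (f : ∀ i, T.Ext (a i) (b i)), hl f = bigE σ f) ?_ ?_ ?_ ?_ n σ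
  · intro n I J _ _ a b f
    exact (rel_id _ _ _ (fun _ => rfl) (fun _ => rfl)).symm
  · intro n σ τ hσ hτ I J _ _ a b f
    rw [hτ f]
    unfold bigE
    rw [hσ fun k => f (τ k)]
    exact (rel_rel ..).trans (rel_congr _ _ _ _ _ (fun _ => rfl) fun _ => rfl)
  · intro n σ hσ I J _ _ a b f
    unfold bigE
    rw [hl_succ f, hσ fun k => f k.succ]
    refine Eq.trans ?_ (congrArg _ (hl_succ fun k => f (finExt σ k))).symm
    unfold bigE
    rw [hc_rel_right]
    refine (rel_rel ..).trans (Eq.trans ?_ (rel_rel ..).symm)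
    refine rel_congr _ _ _ _ (hc (f 0) (hl fun i => f (σ i).succ)) ?_ ?_ <;>
      rintro (i | i) <;> rfl
  · intro n I J _ _ a b f
    unfold bigE
    rw [hl_succ f, hl_succ fun k => f k.succ, hc_rel_right, hc_left_comm, rel_rel, rel_rel]
    refine Eq.trans ?_ (congrArg _ ((hl_succ fun k => f (finSwap n k)).trans (congrArg _
      ((congrArg _ (hl_succ fun k => f (finSwap n k.succ))).trans (hc_rel_right ..))))).symm
    refine Eq.trans ?_ ((congrArg _ (rel_rel ..)).trans (rel_rel ..)).symm
    refine rel_congr _ _ _ _ (hc (f (Fin.succ 0)) (hc (f 0) (hl fun i => f i.succ.succ))) ?_ ?_ <;>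
      rintro (i | i | i) <;> rfl

section
variable {K L : Type} [Listed K] [Listed L] {I J : K → Type} [∀ k, Listed (I k)]
  [∀ k, Listed (J k)] {a : ∀ k, I k → T.Col} {b : ∀ k, J k → T.Col}

theorem bigE_congr {n m : ℕ} (e : Fin n ≃ K) (e' : Fin m ≃ K) (f : ∀ k, T.Ext (a k) (b k)) :
    bigE e f = bigE e' f := by
  obtain rfl : n = m := by simpa using Fintype.card_congr (e.trans e'.symm)
  have h : bigE e' f = bigE ((e.trans e'.symm).trans e') f := by
    conv_lhs => unfold bigE
    rw [hl_perm _ (e.trans e'.symm) fun k => f (e' k)]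
    unfold bigE
    exact (rel_rel ..).trans (rel_congr _ _ _ _ _ (fun _ => rfl) fun _ => rfl)
  rw [h]
  congr 1
  ext i
  simp

/-- Reindexing of a horizontal composite. -/
theorem big_equiv (ε : L ≃ K) (f : ∀ k, T.Ext (a k) (b k)) :
    big f = rel (a := fun s : Σ i, I (ε i) => a (ε s.1) s.2)
      (b := fun s : Σ i, J (ε i) => b (ε s.1) s.2) (Equiv.sigmaCongrLeft ε) (Equiv.sigmaCongrLeft ε) (pf fun _ => rfl)
      (pf fun _ => rfl) (big fun l => f (ε l)) := by
  unfold big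
  rw [bigE_congr enum (enum.trans ε) f]
  unfold bigE
  refine Eq.trans ?_ (rel_rel ..).symm
  exact rel_congr _ _ _ _ _ (fun _ => rfl) fun _ => rfl

theorem big_fin {n : ℕ} {I J : Fin n → Type} [∀ i, Listed (I i)]
    [∀ i, Listed (J i)] {a : ∀ i, I i → T.Col} {b : ∀ i, J i → T.Col}
    (f : ∀ i, T.Ext (a i) (b i)) : big f = hl f := by
  unfold big
  rw [bigE_congr enum (Equiv.refl _) f]
  exact rel_id _ _ _ (fun _ => rfl) (fun _ => rfl)

theorem big_rel {I' J' : K → Type} [∀ k, Listed (I' k)] [∀ k, Listed (J' k)]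
    {a' : ∀ k, I' k → T.Col} {b' : ∀ k, J' k → T.Col} (σ : ∀ i, I i ≃ I' i) (τ : ∀ i, J i ≃ J' i)
    (ha : ∀ i k, a' i (σ i k) = a i k) (hb : ∀ i k, b' i (τ i k) = b i k)
    (f : ∀ k, T.Ext (a k) (b k)) :
    big (fun i => rel (σ i) (τ i) (ha i) (hb i) (f i)) =
      rel (Equiv.sigmaCongrRight σ) (Equiv.sigmaCongrRight τ) (pf fun i => ha i.1 i.2)
        (pf fun i => hb i.1 i.2) (big f) := by
  unfold big bigE
  rw [hl_rel (fun k => σ (enum k)) (fun k => τ (enum k)) (fun k => ha (enum k))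
    (fun k => hb (enum k))]
  refine (rel_rel ..).trans (Eq.trans ?_ (rel_rel ..).symm)
  exact rel_congr _ _ _ _ _ (fun _ => rfl) fun _ => rfl

theorem big_vc {M : K → Type} [∀ k, Listed (M k)] {c : ∀ k, M k → T.Col}
    (f : ∀ k, T.Ext (b k) (c k)) (g : ∀ k, T.Ext (a k) (b k)) :
    big (fun i => vc (f i) (g i)) = vc (big f) (big g) := by
  unfold big bigE
  rw [hl_vc]
  exact (vc_rel _ _ _ _ _ _ _ _ (fun _ => rfl) _ _).symm

theorem big_il (a : ∀ k, I k → T.Col) :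
    big (fun i => il (a i)) = il (fun s : Σ k, I k => a s.1 s.2) := by
  unfold big bigE
  rw [hl_il]
  exact rel_il _ _ _ _ fun _ => rfl

theorem big_hc {I' J' : K → Type} [∀ k, Listed (I' k)] [∀ k, Listed (J' k)]
    {a' : ∀ k, I' k → T.Col} {b' : ∀ k, J' k → T.Col} (f : ∀ k, T.Ext (a k) (b k))
    (g : ∀ k, T.Ext (a' k) (b' k)) :
    big (fun i => hc (f i) (g i)) =
      rel (Equiv.sigmaSumDistrib I I').symm (Equiv.sigmaSumDistrib J J').symm
        (pf <| by rintro (i | i) <;> rfl) (pf <| by rintro (i | i) <;> rfl)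
        (hc (big f) (big g)) := by
  unfold big bigE
  rw [hl_hc, hc_rel]
  refine (rel_rel ..).trans (Eq.trans ?_ (rel_rel ..).symm)
  refine rel_congr _ _ _ _ _ ?_ ?_ <;> rintro (i | i) <;> rfl

/-- A composite over a one-element index set. -/
theorem big_unique [Unique K] (f : ∀ k, T.Ext (a k) (b k)) :
    big f = rel (Equiv.uniqueSigma I).symm (Equiv.uniqueSigma J).symm (pf fun _ => rfl)
      (pf fun _ => rfl) (f default) := by
  unfold big
  rw [bigE_congr enum (Equiv.ofUnique (Fin 1) K) f]
  unfold bigE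
  rw [hl_succ]
  have h (g : T.Ext (a default) (b default)) {I J : Fin 0 → Type} [∀ i, Listed (I i)]
      [∀ i, Listed (J i)] {a' : ∀ i, I i → T.Col} {b' : ∀ i, J i → T.Col}
      (f' : ∀ i, T.Ext (a' i) (b' i)) : hc g (hl f') =
      rel (Equiv.sumEmpty ..).symm (Equiv.sumEmpty ..).symm (pf fun _ => rfl) (pf fun _ => rfl)
        g := by
    refine (hc_rel_right (f := un) ..).trans ?_
    rw [hc_un]
    refine (rel_rel ..).trans (rel_congr _ _ _ _ _ (fun _ => rfl) fun _ => rfl)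
  refine (congrArg _ (congrArg _ (h (f default) _))).trans ?_
  refine (congrArg _ (rel_rel ..)).trans ((rel_rel ..).trans ?_)
  exact rel_congr _ _ _ _ _ (fun _ => rfl) fun _ => rfl

theorem big_empty [IsEmpty K] (f : ∀ k, T.Ext (a k) (b k)) :
    big f = rel (Equiv.equivOfIsEmpty _ _) (Equiv.equivOfIsEmpty _ _) (pf fun i => i.elim0)
      (pf fun i => i.elim0) un := by
  unfold big
  rw [bigE_congr enum (Equiv.equivOfIsEmpty (Fin 0) K)]
  refine (rel_rel ..).trans (rel_congr _ _ _ _ _ ?_ ?_) <;> exact fun i => i.elim0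

/-- A composite over a set with a distinguished element. -/
def sigmaOption {M : Type} (I : Option M → Type) :
    (I none ⊕ Σ m, I (some m)) ≃ Σ k, I k where
  toFun := Sum.elim (fun x => ⟨none, x⟩) fun s => ⟨some s.1, s.2⟩
  invFun
    | ⟨none, x⟩ => .inl x
    | ⟨some m, x⟩ => .inr ⟨m, x⟩
  left_inv := by rintro (x | ⟨m, x⟩) <;> rfl
  right_inv := by rintro ⟨_ | m, x⟩ <;> rfl

instance instOption : Listed (Option K) :=
  ⟨size K + 1,
    { toFun := Fin.cases none fun i => some (enum i)
      invFun
        | none => 0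
        | some k => (enum.symm k).succ
      left_inv := fun i => by induction i using Fin.cases <;> simp
      right_inv := by rintro (_ | k) <;> simp }⟩

theorem big_option {I J : Option K → Type} [∀ k, Listed (I k)]
    [∀ k, Listed (J k)] {a : ∀ k, I k → T.Col} {b : ∀ k, J k → T.Col}
    (f : ∀ k, T.Ext (a k) (b k)) :
    big f = rel (sigmaOption I) (sigmaOption J)
      (pf <| by rintro (i | i) <;> rfl) (pf <| by rintro (i | i) <;> rfl)
      (hc (f none) (big fun k => f (some k))) := by
  unfold big bigE
  rw [hc_rel_right]
  refine (congrArg _ (hl_succ (n := size K) fun k => f (@enum (Option K) _ k))).trans ?_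
  refine (rel_rel ..).trans (Eq.trans ?_ (rel_rel ..).symm)
  refine rel_congr _ _ _ _ (hc (f none) (hl fun k => f (some (enum k)))) ?_ ?_ <;>
    rintro (i | i) <;> rfl

def optionSum (n : ℕ) (L : Type) : Option (Fin n ⊕ L) ≃ Fin (n + 1) ⊕ L where
  toFun
    | none => .inl 0
    | some (.inl i) => .inl i.succ
    | some (.inr l) => .inr l
  invFun := Sum.elim (Fin.cases none fun i => some (.inl i)) fun l => some (.inr l)
  left_inv := by rintro (_ | i | l) <;> rfl
  right_inv := by
    rintro (i | l)
    · induction i using Fin.cases <;> rfl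
    · rfl

theorem big_sum_fin {n : ℕ} {I J : Fin n ⊕ L → Type} [∀ k, Listed (I k)]
    [∀ k, Listed (J k)] {a : ∀ k, I k → T.Col} {b : ∀ k, J k → T.Col}
    (f : ∀ k, T.Ext (a k) (b k)) :
    big f = rel (Equiv.sumSigmaDistrib I).symm (Equiv.sumSigmaDistrib J).symm
      (pf <| by rintro (i | i) <;> rfl) (pf <| by rintro (i | i) <;> rfl)
      (hc (hl fun k => f (.inl k)) (big fun k => f (.inr k))) := by
  induction n with
  | zero =>
    rw [big_equiv (Equiv.emptySum (Fin 0) L).symm f, hc_comm, ← big_fin, big_empty fun k : Fin 0 => f (.inl k), hc_rel_right,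
      hc_un]
    refine Eq.trans ?_ ((rel_rel ..).trans ((rel_rel ..).trans (rel_rel ..))).symm
    exact rel_congr _ _ _ _ _ (fun _ => rfl) fun _ => rfl
  | succ n ih =>
    rw [big_equiv (optionSum n L) f, big_option]
    have h := ih fun k => f (optionSum n L (some k))
    rw [h, hc_rel_right, hl_succ, hc_rel_left, hc_assoc']
    refine ((congrArg _ (rel_rel ..)).trans (rel_rel ..)).trans
      (Eq.trans ?_ ((congrArg _ (rel_rel ..)).trans (rel_rel ..)).symm)
    refine rel_congr _ _ _ _ (hc (f (.inl 0)) (hc (hl fun i => f (.inl i.succ))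
      (big fun k => f (.inr k)))) ?_ ?_ <;> rintro (i | i | i) <;> rfl

/-- A composite over a disjoint union. -/
theorem big_sum {I J : K ⊕ L → Type} [∀ k, Listed (I k)]
    [∀ k, Listed (J k)] {a : ∀ k, I k → T.Col} {b : ∀ k, J k → T.Col}
    (f : ∀ k, T.Ext (a k) (b k)) :
    big f = rel (Equiv.sumSigmaDistrib I).symm (Equiv.sumSigmaDistrib J).symm
      (pf <| by rintro (i | i) <;> rfl) (pf <| by rintro (i | i) <;> rfl)
      (hc (big fun k => f (.inl k)) (big fun k => f (.inr k))) := by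
  rw [big_equiv (enum.sumCongr (Equiv.refl L)) f, big_sum_fin, big_equiv enum fun k => f (.inl k),
    hc_rel_left, big_fin]
  refine (rel_rel ..).trans (Eq.trans ?_ (rel_rel ..).symm)
  refine rel_congr _ _ _ _ (hc (hl fun i => f (.inl (enum i))) (big fun k => f (.inr k))) ?_ ?_ <;>
    rintro (i | i) <;> rfl

theorem hl_big {n : ℕ} {M : Fin n → Type} [∀ k, Listed (M k)] {I J : ∀ k, M k → Type}
    [∀ k m, Listed (I k m)] [∀ k m, Listed (J k m)] {a : ∀ k m, I k m → T.Col}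
    {b : ∀ k m, J k m → T.Col} (f : ∀ k m, T.Ext (a k m) (b k m)) :
    hl (fun k => big (f k)) = rel (a := fun s : Σ s : Σ k, M k, I s.1 s.2 => a s.1.1 s.1.2 s.2)
      (b := fun s : Σ s : Σ k, M k, J s.1 s.2 => b s.1.1 s.1.2 s.2)
      (Equiv.sigmaAssoc I) (Equiv.sigmaAssoc J) (pf fun _ => rfl)
      (pf fun _ => rfl) (big fun s : Σ k, M k => f s.1 s.2) := by
  induction n with
  | zero =>
    rw [← big_fin, big_empty, big_empty, rel_rel]
    exact rel_congr _ _ _ _ _ (fun i => i.elim0) fun i => i.elim0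
  | succ n ih =>
    rw [hl_succ, ih fun k => f k.succ, big_equiv (sigmaSucc M), big_sum, hc_rel_right]
    refine (rel_rel ..).trans (Eq.trans ?_ ((congrArg _ (rel_rel ..)).trans (rel_rel ..)).symm)
    refine rel_congr _ _ _ _ (hc (big (f 0))
      (big fun s : Σ k : Fin n, M k.succ => f s.1.succ s.2)) ?_ ?_ <;> rintro (i | i) <;> rfl

/-- A composite of composites. -/
theorem big_big {M : K → Type} [∀ k, Listed (M k)] {I J : ∀ k, M k → Type}
    [∀ k m, Listed (I k m)] [∀ k m, Listed (J k m)] {a : ∀ k m, I k m → T.Col}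
    {b : ∀ k m, J k m → T.Col} (f : ∀ k m, T.Ext (a k m) (b k m)) :
    big (fun k => big (f k)) = rel (a := fun s : Σ s : Σ k, M k, I s.1 s.2 => a s.1.1 s.1.2 s.2)
      (b := fun s : Σ s : Σ k, M k, J s.1 s.2 => b s.1.1 s.1.2 s.2)
      (Equiv.sigmaAssoc I) (Equiv.sigmaAssoc J) (pf fun _ => rfl)
      (pf fun _ => rfl) (big fun s : Σ k, M k => f s.1 s.2) := by
  conv_lhs => unfold big bigE
  refine (congrArg _ (hl_big fun k => f (enum k))).trans ?_
  rw [big_equiv (Equiv.sigmaCongrLeft (β := M) enum)]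
  refine (rel_rel ..).trans (Eq.trans ?_ (rel_rel ..).symm)
  exact rel_congr _ _ _ _ _ (fun _ => rfl) fun _ => rfl

end
end ColoredProp
end PropOperad

namespace PropOperad
open Listed

/-! ### Coloured operads -/

/-- The concatenation of a list of lists `⟨⟨b i j⟩_j⟩_i`. -/
abbrev flat {C : Type u} {n : ℕ} {p : Fin n → ℕ} (b : ∀ i, Fin (p i) → C) (k : Fin (∑ i, p i)) : C :=
  b (finSigmaFinEquiv.symm k).1 (finSigmaFinEquiv.symm k).2

/-- A bijection between double indices, as a bijection between positions in the concatenations. -/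
def flatMap {n m : ℕ} {p : Fin n → ℕ} {q : Fin m → ℕ}
    (σ : (Σ i, Fin (p i)) ≃ Σ j, Fin (q j)) : Fin (∑ i, p i) ≃ Fin (∑ j, q j) :=
  finSigmaFinEquiv.symm.trans (σ.trans finSigmaFinEquiv)

/-- The two ways of concatenating a list of lists of lists. -/
def flatAssoc {n : ℕ} {p : Fin n → ℕ} (q : ∀ i, Fin (p i) → ℕ) :
    Fin (∑ k, flat q k) ≃ Fin (∑ i, ∑ j, q i j) :=
  finSigmaFinEquiv.symm.trans
    ((Equiv.sigmaCongrLeft (β := fun s : Σ i, Fin (p i) => Fin (q s.1 s.2))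
      finSigmaFinEquiv.symm).trans ((Equiv.sigmaAssoc fun i j => Fin (q i j)).trans
      ((Equiv.sigmaCongrRight fun _ => finSigmaFinEquiv).trans finSigmaFinEquiv)))

/-- A list of lists with only one entry. -/
def sigmaOne (I : Type) : (Σ _ : Fin 1, I) ≃ I where
  toFun s := s.2
  invFun i := ⟨0, i⟩
  left_inv := by
    rintro ⟨k, i⟩
    obtain rfl := Subsingleton.elim k 0
    rfl
  right_inv _ := rfl

/-- A list of lists of length one. -/
def sigmaOnes (I : Type) : (Σ _ : I, Fin 1) ≃ I where
  toFun s := s.1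
  invFun i := ⟨i, 0⟩
  left_inv := by
    rintro ⟨i, k⟩
    obtain rfl := Subsingleton.elim k 0
    rfl
  right_inv _ := rfl

def flatOne (n : ℕ) : Fin (∑ _ : Fin 1, n) ≃ Fin n :=
  finSigmaFinEquiv.symm.trans (sigmaOne (Fin n))

def flatOnes (n : ℕ) : Fin (∑ _ : Fin n, 1) ≃ Fin n :=
  finSigmaFinEquiv.symm.trans (sigmaOnes (Fin n))

theorem flat_flatMap {C : Type u} {n m : ℕ} {p : Fin n → ℕ} {q : Fin m → ℕ}
    {b : ∀ i, Fin (p i) → C} {b' : ∀ i, Fin (q i) → C}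
    {σ : (Σ i, Fin (p i)) ≃ Σ j, Fin (q j)} (h : ∀ s, b s.1 s.2 = b' (σ s).1 (σ s).2)
    (k : Fin (∑ i, p i)) : flat b k = flat b' (flatMap σ k) := by
  have e : finSigmaFinEquiv.symm (flatMap σ k) = σ (finSigmaFinEquiv.symm k) :=
    Equiv.symm_apply_apply _ _
  unfold flat
  rw [e]
  exact h _

theorem flat_flatAssoc {C : Type u} {n : ℕ} {p : Fin n → ℕ} {q : ∀ i, Fin (p i) → ℕ}
    (c : ∀ i j, Fin (q i j) → C) (k : Fin (∑ k, flat q k)) :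
    flat (p := flat q)
        (fun k => c (finSigmaFinEquiv.symm k).1 (finSigmaFinEquiv.symm k).2) k =
      flat (fun i => flat (c i)) (flatAssoc q k) := by
  have e : finSigmaFinEquiv.symm (flatAssoc q k) =
      ⟨(finSigmaFinEquiv.symm (finSigmaFinEquiv.symm k).1).1,
        finSigmaFinEquiv ⟨(finSigmaFinEquiv.symm (finSigmaFinEquiv.symm k).1).2,
          (finSigmaFinEquiv.symm k).2⟩⟩ := Equiv.symm_apply_apply _ _
  unfold flat
  rw [e]
  dsimp only
  rw [Equiv.symm_apply_apply]

/-- A (symmetric, coloured) operad: a set of colours, sets of operations from a finite list of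
colours to a colour, identities, permutation of the inputs (written along `σ : Fin n' ≃ Fin n` as
for props), and composition `comp g ⟨f i⟩_i`, subject to associativity, unitality and
equivariance. -/
structure ColoredOperad where
  Col : Type u
  Op : {n : ℕ} → (Fin n → Col) → Col → Type u
  id : (c : Col) → Op (fun _ : Fin 1 => c) c
  perm : {n n' : ℕ} → {a : Fin n → Col} → {a' : Fin n' → Col} → {c : Col} →
    (σ : Fin n' ≃ Fin n) → (∀ i, a' i = a (σ i)) → Op a c → Op a' c
  comp : {n : ℕ} → {p : Fin n → ℕ} → {a : Fin n → Col} → {c : Col} →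
    {b : ∀ i, Fin (p i) → Col} → Op a c → (∀ i, Op (b i) (a i)) → Op (flat b) c
  perm_refl {n : ℕ} {a : Fin n → Col} {c : Col} (f : Op a c) :
    perm (Equiv.refl _) (reflIn fun _ => rfl) f = f
  perm_perm {n n' n'' : ℕ} {a : Fin n → Col} {a' : Fin n' → Col} {a'' : Fin n'' → Col}
    {c : Col} (σ : Fin n'' ≃ Fin n') (h : ∀ i, a'' i = a' (σ i)) (σ' : Fin n' ≃ Fin n)
    (h' : ∀ i, a' i = a (σ' i)) (f : Op a c) :
    perm σ h (perm σ' h' f) =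
      perm (σ.trans σ') (fun i => by simp only [Equiv.trans_apply, h, h']) f
  id_comp {n : ℕ} {a : Fin n → Col} {c : Col} (f : Op a c) :
    comp (p := fun _ => n) (b := fun _ => a) (id c) (fun _ : Fin 1 => f) =
      perm (a' := flat fun _ => a) (flatOne n) (pf fun _ => rfl) f
  comp_id {n : ℕ} {a : Fin n → Col} {c : Col} (f : Op a c) :
    comp (p := fun _ => 1) (b := fun i _ => a i) f (fun i => id (a i)) =
      perm (a' := flat fun i _ => a i) (flatOnes n) (pf fun _ => rfl) f
  assoc {n : ℕ} {p : Fin n → ℕ} {q : ∀ i, Fin (p i) → ℕ} {a : Fin n → Col} {d : Col}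
    {b : ∀ i, Fin (p i) → Col} {c : ∀ i j, Fin (q i j) → Col} (f : Op a d)
    (g : ∀ i, Op (b i) (a i)) (h : ∀ i j, Op (c i j) (b i j)) :
    comp (p := flat q) (comp f g)
        (fun k => h (finSigmaFinEquiv.symm k).1 (finSigmaFinEquiv.symm k).2) =
      perm (flatAssoc q) (flat_flatAssoc c) (comp f fun i => comp (g i) (h i))
  perm_comp {n n' : ℕ} {p : Fin n → ℕ} {a : Fin n → Col} {c : Col}
    {b : ∀ i, Fin (p i) → Col} (σ : Fin n' ≃ Fin n) (f : Op a c) (g : ∀ i, Op (b i) (a i)) :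
    comp (perm (a' := fun i => a (σ i)) σ (pf fun _ => rfl) f) (fun i => g (σ i)) =
      perm (flatMap (Equiv.sigmaCongrLeft (β := fun i => Fin (p i)) σ))
        (flat_flatMap (pf fun _ => rfl)) (comp f g)
  comp_perm {n : ℕ} {p p' : Fin n → ℕ} {a : Fin n → Col} {c : Col}
    {b : ∀ i, Fin (p i) → Col} {b' : ∀ i, Fin (p' i) → Col} (σ : ∀ i, Fin (p' i) ≃ Fin (p i))
    (h : ∀ i j, b' i j = b i (σ i j)) (f : Op a c) (g : ∀ i, Op (b i) (a i)) :
    comp f (fun i => perm (σ i) (h i) (g i)) =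
      perm (flatMap (Equiv.sigmaCongrRight σ)) (flat_flatMap (pf fun s => h s.1 s.2)) (comp f g)

theorem flat_map {C D : Type u} (f : C → D) {n : ℕ} {p : Fin n → ℕ} (b : ∀ i, Fin (p i) → C)
    (k : Fin (∑ i, p i)) : f (flat b k) = flat (fun i j => f (b i j)) k := rfl

/-- A homomorphism of operads. -/
@[ext]
structure OperadHom (O P : ColoredOperad.{u}) where
  col : O.Col → P.Col
  map : {n : ℕ} → {a : Fin n → O.Col} → {c : O.Col} → O.Op a c →
    P.Op (fun i => col (a i)) (col c)
  map_id (c : O.Col) : map (O.id c) = P.id (col c)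
  map_perm {n n' : ℕ} {a : Fin n → O.Col} {a' : Fin n' → O.Col} {c : O.Col}
    (σ : Fin n' ≃ Fin n) (h : ∀ i, a' i = a (σ i)) (f : O.Op a c) :
    map (O.perm σ h f) = P.perm σ (fun i => congrArg col (h i)) (map f)
  map_comp {n : ℕ} {p : Fin n → ℕ} {a : Fin n → O.Col} {c : O.Col}
    {b : ∀ i, Fin (p i) → O.Col} (g : O.Op a c) (f : ∀ i, O.Op (b i) (a i)) :
    map (O.comp g f) = P.comp (map g) (fun i => map (f i))

instance : Category ColoredOperad.{u} where
  Hom := OperadHom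
  id O := ⟨_root_.id, _root_.id, fun _ => rfl, fun _ _ _ => rfl, fun _ _ => rfl⟩
  comp F G :=
    { col := fun c => G.col (F.col c)
      map := fun f => G.map (F.map f)
      map_id := fun c => by rw [F.map_id, G.map_id]
      map_perm := fun σ h f => by rw [F.map_perm, G.map_perm]
      map_comp := fun g f => by rw [F.map_comp, G.map_comp] }

instance : Category ColoredProp.{u} where
  Hom := PropHom
  id T := ⟨_root_.id, _root_.id, fun _ => rfl, (T.act_refl T.unit).symm, fun _ _ => rfl,
    fun _ _ => (T.act_refl _).symm, fun _ _ _ => rfl, fun _ _ _ => rfl⟩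
  comp {R S T} F G :=
    { col := fun c => G.col (F.col c)
      map := fun f => G.map (F.map f)
      map_id := fun c => by rw [F.map_id, G.map_id]
      map_unit := by
        rw [F.map_unit]
        unfold PropData.act
        rw [G.map_inp, G.map_out, G.map_unit]
        exact T.act_act ..
      map_vcomp := fun f g => by rw [F.map_vcomp, G.map_vcomp]
      map_hcomp := fun f g => by
        rw [F.map_hcomp]
        unfold PropData.act
        rw [G.map_inp, G.map_out, G.map_hcomp]
        exact T.act_act ..
      map_inp := fun σ h f => by rw [F.map_inp, G.map_inp]
      map_out := fun σ h f => by rw [F.map_out, G.map_out] }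

namespace ColoredOperad
variable {O : ColoredOperad.{u}}
variable {I I' I'' J J' K : Type} [Listed I] [Listed I'] [Listed I''] [Listed J]
  [Listed J'] [Listed K]

variable (O) in
/-- Operations out of a list of colours indexed by a finite ordered set. -/
abbrev Ext {I : Type} [Listed I] (a : I → O.Col) (c : O.Col) : Type u :=
  O.Op (fun i => a (enum i)) c

/-- The action of bijections of the index sets of inputs, carrying the entry at `i` to the entry
at `σ i`. -/
def rel {a : I → O.Col} {a' : I' → O.Col} {c c' : O.Col} (σ : I ≃ I') (ha : ∀ i, a' (σ i) = a i)
    (hc : c' = c) (x : O.Ext a c) : O.Ext a' c' :=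
  hc ▸ O.perm ((enum.trans σ.symm).trans enum.symm) (fun i => by simp [← ha]) x

/-- Composition. -/
def cp {I : J → Type} [∀ j, Listed (I j)] {b : J → O.Col} {c : O.Col} {a : ∀ j, I j → O.Col}
    (g : O.Ext b c) (f : ∀ j, O.Ext (a j) (b j)) : O.Ext (fun s : Σ j, I j => a s.1 s.2) c :=
  O.comp g fun k => f (enum k)

theorem perm_congr {n n' : ℕ} {a : Fin n → O.Col} {a' : Fin n' → O.Col} {c : O.Col}
    {σ σ' : Fin n' ≃ Fin n} (h : ∀ i, a' i = a (σ i)) (h' : ∀ i, a' i = a (σ' i))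
    (hσ : ∀ i, σ i = σ' i) (x : O.Op a c) : O.perm σ h x = O.perm σ' h' x := by
  obtain rfl := Equiv.ext hσ
  rfl

theorem rel_congr {a : I → O.Col} {a' : I' → O.Col} {c c' : O.Col} {σ σ' : I ≃ I'}
    (ha : ∀ i, a' (σ i) = a i) (ha' : ∀ i, a' (σ' i) = a i) (hc hc' : c' = c) (x : O.Ext a c)
    (hσ : ∀ i, σ i = σ' i) : rel σ ha hc x = rel σ' ha' hc' x := by
  obtain rfl := Equiv.ext hσ
  rfl

theorem rel_rel {a : I → O.Col} {a' : I' → O.Col} {a'' : I'' → O.Col} {c c' c'' : O.Col}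
    (σ : I ≃ I') (ha : ∀ i, a' (σ i) = a i) (hc : c' = c) (σ' : I' ≃ I'')
    (ha' : ∀ i, a'' (σ' i) = a' i) (hc' : c'' = c') (x : O.Ext a c) :
    rel σ' ha' hc' (rel σ ha hc x) = rel (σ.trans σ')
      (fun i => by rw [Equiv.trans_apply, ha', ha]) (hc'.trans hc) x := by
  subst hc hc'
  unfold rel
  refine (O.perm_perm ..).trans (perm_congr _ _ ?_ x)
  intro i
  simp

theorem rel_id {a : I → O.Col} {c : O.Col} {σ : I ≃ I} (ha : ∀ i, a (σ i) = a i) (hc : c = c)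
    (x : O.Ext a c) (hσ : ∀ i, σ i = i) : rel σ ha hc x = x := by
  obtain rfl : σ = Equiv.refl _ := Equiv.ext hσ
  unfold rel
  refine (perm_congr _ _ ?_ x).trans (O.perm_refl x)
  simp

theorem conj_eq {σ : I ≃ I'} {j : Fin (size I)} {k : Fin (size I')}
    (h : enum k = σ (enum j)) : j = ((enum.trans σ.symm).trans enum.symm) k := by
  rw [Equiv.trans_apply, Equiv.trans_apply, h, Equiv.symm_apply_apply, Equiv.symm_apply_apply]

/-- Change of the output colour. -/
theorem rel_cp {I : J → Type} [∀ j, Listed (I j)] {b : J → O.Col} {c c' : O.Col}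
    {a : ∀ j, I j → O.Col} (hc : c' = c) (g : O.Ext b c) (f : ∀ j, O.Ext (a j) (b j)) :
    cp (rel (a := b) (Equiv.refl _) (pf fun _ => rfl) hc g) f =
      rel (a := fun s : Σ j, I j => a s.1 s.2) (Equiv.refl _) (pf fun _ => rfl) hc (cp g f) := by
  subst hc
  rw [rel_id _ _ _ (fun _ => rfl), rel_id _ _ _ (fun _ => rfl)]

/-- Change of the intermediate colours. -/
theorem cp_cast {I : J → Type} [∀ j, Listed (I j)] {b b' : J → O.Col} {c : O.Col}
    {a : ∀ j, I j → O.Col} (hb : ∀ j, b' j = b j) (g : O.Ext b c) (f : ∀ j, O.Ext (a j) (b' j)) :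
    cp (rel (a := b) (a' := b') (Equiv.refl _) (pf hb) rfl g) f =
      cp g fun j => rel (a := a j) (Equiv.refl _) (pf fun _ => rfl) (hb j).symm (f j) := by
  obtain rfl := funext hb
  rw [rel_id _ _ _ (fun _ => rfl)]
  congr 1
  funext j
  exact (rel_id _ _ _ (fun _ => rfl)).symm

theorem rel_cp_left {Q : Type} [inst : Listed Q] {I : Q → Type} [∀ j, Listed (I j)] {b : Q → O.Col}
    {c : O.Col} {a : ∀ j, I j → O.Col} (σ : J ≃ Q)
    (g : O.Ext (fun j => b (σ j)) c) (f : ∀ j, O.Ext (a j) (b j)) :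
    cp (rel (a := fun j => b (σ j)) σ (pf fun _ => rfl) rfl g) f =
      rel (a := fun s : Σ j, I (σ j) => a (σ s.1) s.2) (Equiv.sigmaCongrLeft σ)
        (pf fun _ => rfl) rfl (cp g fun j => f (σ j)) := by
  obtain ⟨m, e⟩ := inst
  obtain ⟨ρ, rfl⟩ : ∃ ρ : Fin m ≃ Fin (size J), e = ρ.trans (enum.trans σ) :=
    ⟨e.trans (σ.symm.trans enum.symm), by ext; simp⟩
  let inst : Listed Q := ⟨m, ρ.trans (enum.trans σ)⟩
  refine Eq.trans ?_ ((O.perm_comp ρ g fun i => f (σ (enum i))).trans ?_)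
  · refine congrArg (fun x => O.comp x _) (perm_congr _ _ ?_ g)
    intro i
    exact (conj_eq (σ := σ) rfl).symm
  · refine perm_congr _ _ (fun k => ?_) _
    refine conj_eq (σ := Equiv.sigmaCongrLeft (β := I) σ) ?_
    exact congrArg (fun s : Σ i : Fin (size J), Fin (size (I (σ (enum i)))) =>
      (⟨σ (enum s.1), enum s.2⟩ : Σ j, I j)) (Equiv.symm_apply_apply finSigmaFinEquiv
      (Equiv.sigmaCongrLeft (β := fun i : Fin (size J) => Fin (size (I (σ (enum i))))) ρ
        (finSigmaFinEquiv.symm k))).symm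

theorem cp_rel {I I' : J → Type} [∀ j, Listed (I j)] [∀ j, Listed (I' j)] {b : J → O.Col}
    {c : O.Col} {a : ∀ j, I j → O.Col} {a' : ∀ j, I' j → O.Col} (σ : ∀ j, I j ≃ I' j)
    (ha : ∀ j i, a' j (σ j i) = a j i) (g : O.Ext b c) (f : ∀ j, O.Ext (a j) (b j)) :
    cp g (fun j => rel (σ j) (ha j) rfl (f j)) =
      rel (a := fun s : Σ j, I j => a s.1 s.2) (a' := fun s : Σ j, I' j => a' s.1 s.2)
        (Equiv.sigmaCongrRight σ) (pf fun s => ha s.1 s.2) rfl (cp g f) := by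
  refine (O.comp_perm (fun i : Fin (size J) => (enum.trans (σ (enum i)).symm).trans enum.symm)
    _ g fun i => f (enum i)).trans (perm_congr _ _ (fun k => ?_) _)
  refine conj_eq (σ := Equiv.sigmaCongrRight σ) ?_
  refine Eq.trans ?_ (congrArg (fun s : Σ i : Fin (size J), Fin (size (I (enum i))) =>
      (⟨enum s.1, σ _ (enum s.2)⟩ : Σ j, I' j))
      (Equiv.symm_apply_apply finSigmaFinEquiv _).symm)
  refine Sigma.ext rfl (heq_of_eq ?_)
  refine (Eq.trans (congrArg _ (Equiv.apply_symm_apply _ _)) ?_).symm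
  exact Equiv.apply_symm_apply _ _

theorem cp_assoc {I : J → Type} [∀ j, Listed (I j)] {M : ∀ j, I j → Type}
    [∀ j i, Listed (M j i)] {b : J → O.Col} {c : O.Col} {a : ∀ j, I j → O.Col}
    {d : ∀ j i, M j i → O.Col} (h : O.Ext b c) (g : ∀ j, O.Ext (a j) (b j))
    (f : ∀ j i, O.Ext (d j i) (a j i)) :
    cp (cp h g) (fun s : Σ j, I j => f s.1 s.2) =
      rel (a := fun s : Σ j, Σ i, M j i => d s.1 s.2.1 s.2.2)
        (a' := fun s : Σ s : Σ j, I j, M s.1 s.2 => d s.1.1 s.1.2 s.2)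
        (Equiv.sigmaAssoc M).symm (pf fun _ => rfl) rfl (cp h fun j => cp (g j) (f j)) := by
  refine (O.assoc h (fun i => g (enum i)) fun i j => f (enum i) (enum j)).trans
    (perm_congr _ _ (fun k => ?_) _)
  refine conj_eq (σ := (Equiv.sigmaAssoc M).symm) ?_
  rw [Equiv.eq_symm_apply]
  let s := finSigmaFinEquiv.symm k
  let t := finSigmaFinEquiv.symm s.1
  have e : finSigmaFinEquiv.symm (flatAssoc (fun i j => size (M (enum i) (enum j))) k) =
      ⟨t.1, finSigmaFinEquiv ⟨t.2, s.2⟩⟩ := Equiv.symm_apply_apply _ _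
  have e' : finSigmaFinEquiv.symm (finSigmaFinEquiv (n := fun j => size (M (enum t.1) (enum j)))
    ⟨t.2, s.2⟩) = ⟨t.2, s.2⟩ := Equiv.symm_apply_apply _ _
  refine Eq.trans ?_ (congrArg (fun s : Σ i : Fin (size J), Fin (∑ j, size (M (enum i) (enum j))) =>
    (⟨enum s.1, enum (finSigmaFinEquiv.symm s.2).1, enum (finSigmaFinEquiv.symm s.2).2⟩ :
      Σ j, Σ i, M j i)) e).symm
  exact (congrArg (fun s : Σ j, Fin (size (M (enum t.1) (enum j))) =>
    (⟨enum t.1, enum s.1, enum s.2⟩ : Σ j, Σ i, M j i)) e').symm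

theorem cp_id {b : J → O.Col} {c : O.Col} (g : O.Ext b c) :
    cp (I := fun _ => Fin 1) (a := fun j _ => b j) g (fun j => O.id (b j)) =
      rel (a := b) (a' := fun s : Σ _ : J, Fin 1 => b s.1) (sigmaOnes J).symm (pf fun _ => rfl)
        rfl g := by
  refine (O.comp_id g).trans (perm_congr _ _ (fun k => ?_) _)
  exact conj_eq (σ := (sigmaOnes J).symm) (Sigma.ext rfl (heq_of_eq (Subsingleton.elim _ _)))

theorem id_cp {b : J → O.Col} {c : O.Col} (g : O.Ext b c) :
    cp (J := Fin 1) (I := fun _ => J) (b := fun _ => c) (a := fun _ => b) (O.id c) (fun _ => g) =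
      rel (a := b) (a' := fun s : Σ _ : Fin 1, J => b s.2) (sigmaOne J).symm (pf fun _ => rfl)
        rfl g := by
  refine (O.id_comp g).trans (perm_congr _ _ (fun k => ?_) _)
  exact conj_eq (σ := (sigmaOne J).symm) (Sigma.ext (Subsingleton.elim _ _) HEq.rfl)

end ColoredOperad
end PropOperad

namespace PropOperad
open Listed

namespace ColoredProp
variable {T : ColoredProp.{u}}

section
variable {I I' J J' K K' : Type} [Listed I] [Listed I'] [Listed J]
  [Listed J'] [Listed K] [Listed K']

theorem inp_eq_rel {a : I → T.Col} {a' : I' → T.Col} {b : J → T.Col} (σ : I ≃ I')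
    (ρ : Fin (size I') ≃ Fin (size I)) (h : ∀ k, a' (enum k) = a (enum (ρ k)))
    (hρ : ∀ k, enum k = σ (enum (ρ k))) (ha : ∀ i, a' (σ i) = a i) (x : T.Ext a b) :
    T.inp (a := fun i => a (enum i)) (a' := fun i => a' (enum i)) ρ h x =
      rel (a := a) (a' := a') (b := b) (b' := b) σ (Equiv.refl _) ha (pf fun _ => rfl) x := by
  have e : T.inp (a := fun i => a (enum i)) (a' := fun i => a' (enum i)) ρ h x =
      T.act (a := fun i => a (enum i)) (a' := fun i => a' (enum i)) ρ (Equiv.refl _) h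
        (reflOut fun _ => rfl) x := by
    unfold PropData.act
    rw [T.laws.out_refl]
  rw [e]
  refine T.act_congr _ _ _ _ (fun k => ColoredOperad.conj_eq (hρ k)) ?_ x
  intro i
  simp

theorem out_eq_rel {a : I → T.Col} {b : J → T.Col} {b' : J' → T.Col} (σ : J ≃ J')
    (ρ : Fin (size J) ≃ Fin (size J')) (h : ∀ k, b' (enum k) = b (enum (ρ.symm k)))
    (hρ : ∀ k, enum (ρ k) = σ (enum k)) (hb : ∀ i, b' (σ i) = b i) (x : T.Ext a b) :
    T.out (b := fun i => b (enum i)) (b' := fun i => b' (enum i)) ρ h x =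
      rel (a := a) (a' := a) (b := b) (b' := b') (Equiv.refl _) σ (pf fun _ => rfl) hb x := by
  have e : T.out (b := fun i => b (enum i)) (b' := fun i => b' (enum i)) ρ h x =
      T.act (b := fun i => b (enum i)) (b' := fun i => b' (enum i)) (Equiv.refl _) ρ
        (reflIn fun _ => rfl) h x := by
    unfold PropData.act
    rw [T.laws.inp_refl]
  rw [e]
  refine T.act_congr _ _ _ _ ?_ (fun k => ?_) x
  · intro i
    simp
  · exact ((Equiv.symm_apply_eq _).2 (hρ k).symm).symm

theorem vc_rel_out {a : I → T.Col} {b : J → T.Col} {c : K → T.Col} {c' : K' → T.Col}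
    (ρ : K ≃ K') (hc : ∀ k, c' (ρ k) = c k) (f : T.Ext b c) (g : T.Ext a b) :
    vc (rel (a := b) (a' := b) (Equiv.refl _) ρ (pf fun _ => rfl) hc f) g =
      rel (a := a) (a' := a) (Equiv.refl _) ρ (pf fun _ => rfl) hc (vc f g) := by
  refine Eq.trans ?_ (vc_rel (Equiv.refl _) (Equiv.refl _) (Equiv.refl _) ρ (fun _ => rfl)
    (fun _ => rfl) (fun _ => rfl) hc (fun _ => rfl) f g)
  exact congrArg _ (rel_id _ _ _ (fun _ => rfl) (fun _ => rfl)).symm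

theorem vc_rel_in {a : I → T.Col} {a' : I' → T.Col} {b : J → T.Col} {c : K → T.Col}
    (σ : I ≃ I') (ha : ∀ k, a' (σ k) = a k) (f : T.Ext b c) (g : T.Ext a b) :
    vc f (rel (b := b) (b' := b) σ (Equiv.refl _) ha (pf fun _ => rfl) g) =
      rel (b := c) (b' := c) σ (Equiv.refl _) ha (pf fun _ => rfl) (vc f g) := by
  refine Eq.trans ?_ (vc_rel σ (Equiv.refl _) (Equiv.refl _) (Equiv.refl _) ha
    (fun _ => rfl) (fun _ => rfl) (fun _ => rfl) (fun _ => rfl) f g)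
  exact congrArg (fun x => vc x _) (rel_id _ _ _ (fun _ => rfl) (fun _ => rfl)).symm

theorem il_one (c : T.Col) : (il (fun _ : Fin 1 => c) : T.Ext _ _) = T.id c := by
  refine (T.idList_succ fun _ : Fin 1 => c).trans ?_
  have e (a₀ : Fin 0 → T.Col) (h : ∀ i, Fin.append a₀ (fun _ : Fin 1 => c) i = c) :
      T.hcomp (T.idList a₀) (T.id c) = T.act (finCongr (Nat.zero_add 1))
        (finCongr (Nat.zero_add 1).symm) (pf h) (pf h) (T.id c) := by
    obtain rfl : a₀ = Fin.elim0 := Subsingleton.elim _ _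
    have e0 : T.idList (Fin.elim0 : Fin 0 → T.Col) = T.unit := T.act_refl _
    rw [e0, T.laws.unit_hcomp]
  refine (congrArg _ (e _ fun i => ?_)).trans
    ((T.act_act ..).trans (T.act_id _ _ ?_ ?_ _))
  · exact congrFun (Fin.elim0_append (α := T.Col) fun _ : Fin 1 => c) i
  all_goals exact fun _ => Subsingleton.elim _ _

/-- The horizontal composite of operations `f j` with one output each. -/
def hs {I : J → Type} [∀ j, Listed (I j)] {a : ∀ j, I j → T.Col} {b : J → T.Col}
    (f : ∀ j, T.Ext (a j) (fun _ : Fin 1 => b j)) : T.Ext (fun s : Σ j, I j => a s.1 s.2) b :=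
  rel (b := fun s : Σ _ : J, Fin 1 => b s.1) (Equiv.refl _) (sigmaOnes J) (pf fun _ => rfl)
    (pf fun _ => rfl) (big f)

theorem hs_one {I : Type} [Listed I] {a : I → T.Col} {c : T.Col} (f : T.Ext a (fun _ : Fin 1 => c)) :
    hs (J := Fin 1) (I := fun _ => I) (a := fun _ => a) (b := fun _ => c) (fun _ => f) =
      rel (a := a) (b := fun _ : Fin 1 => c) (a' := fun s : Σ _ : Fin 1, I => a s.2)
        (b' := fun _ : Fin 1 => c) (sigmaOne I).symm
        (Equiv.refl _) (pf fun _ => rfl) (pf fun _ => rfl) f := by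
  unfold hs
  refine (congrArg _ (big_unique (K := Fin 1) (I := fun _ => I) (J := fun _ => Fin 1)
    (a := fun _ => a) (b := fun _ _ => c) fun _ => f)).trans ?_
  refine (rel_rel ..).trans (rel_congr _ _ _ _ f (fun _ => rfl) fun _ => Subsingleton.elim _ _)

theorem hs_id (b : J → T.Col) :
    hs (I := fun _ => Fin 1) (a := fun j _ => b j) (b := b) (fun j => T.id (b j)) =
      rel (a := b) (b := b) (a' := fun s : Σ _ : J, Fin 1 => b s.1)
        (b' := b) (sigmaOnes J).symm
        (Equiv.refl _) (pf fun _ => rfl) (pf fun _ => rfl) (il b) := by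
  unfold hs
  have e : (fun j => T.id (b j)) = fun j => (il (fun _ : Fin 1 => b j) : T.Ext _ _) :=
    funext fun j => (il_one (b j)).symm
  rw [e]
  refine (congrArg _ (big_il (I := fun _ : J => Fin 1) fun j _ => b j)).trans ?_
  refine (congrArg _ (rel_il (a := b) (a' := fun s : Σ _ : J, Fin 1 => b s.1) (sigmaOnes J).symm
    (sigmaOnes J).symm (fun _ => rfl) (fun _ => rfl) fun _ => rfl).symm).trans ?_
  refine (rel_rel ..).trans (rel_congr _ _ _ _ (il b) (fun _ => rfl) fun _ => rfl)

theorem hs_rel {I I' : J → Type} [∀ j, Listed (I j)] [∀ j, Listed (I' j)] {a : ∀ j, I j → T.Col}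
    {a' : ∀ j, I' j → T.Col} {b : J → T.Col} (σ : ∀ j, I j ≃ I' j)
    (ha : ∀ j i, a' j (σ j i) = a j i) (f : ∀ j, T.Ext (a j) (fun _ : Fin 1 => b j)) :
    hs (a := a') (b := b) (fun j => rel (b := fun _ : Fin 1 => b j) (b' := fun _ : Fin 1 => b j) (σ j)
        (Equiv.refl _) (ha j) (pf fun _ => rfl) (f j)) =
      rel (b := b) (b' := b) (Equiv.sigmaCongrRight σ) (Equiv.refl _)
        (pf fun s => ha s.1 s.2) (pf fun _ => rfl) (hs (a := a) (b := b) f) := by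
  unfold hs
  refine (congrArg _ (big_rel (b := fun j (_ : Fin 1) => b j) (b' := fun j (_ : Fin 1) => b j) σ
    (fun _ => Equiv.refl _) ha (fun _ _ => rfl) f)).trans ?_
  refine (rel_rel ..).trans (Eq.trans ?_ (rel_rel ..).symm)
  exact rel_congr _ _ _ _ (big f) (fun _ => rfl) fun _ => rfl

theorem hs_equiv {Q : Type} [Listed Q] {I : Q → Type} [∀ j, Listed (I j)] {a : ∀ j, I j → T.Col}
    {b : Q → T.Col} (σ : J ≃ Q) (f : ∀ j, T.Ext (a j) (fun _ : Fin 1 => b j)) :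
    hs (a := a) (b := b) f =
      rel (a := fun s : Σ j, I (σ j) => a (σ s.1) s.2) (b := fun j => b (σ j)) (b' := b)
        (Equiv.sigmaCongrLeft σ) σ (pf fun _ => rfl) (pf fun _ => rfl)
        (hs (a := fun j => a (σ j)) (b := fun j => b (σ j)) fun j => f (σ j)) := by
  unfold hs
  refine (congrArg _ (big_equiv σ f)).trans ?_
  refine (rel_rel ..).trans (Eq.trans ?_ (rel_rel ..).symm)
  exact rel_congr _ _ _ _ (big fun j => f (σ j)) (fun _ => rfl) fun _ => rfl

theorem hs_hs {I : J → Type} [∀ j, Listed (I j)] {M : ∀ j, I j → Type}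
    [∀ j i, Listed (M j i)] {b : J → T.Col} {a : ∀ j, I j → T.Col}
    {d : ∀ j i, M j i → T.Col} (g : ∀ j, T.Ext (a j) (fun _ : Fin 1 => b j))
    (f : ∀ j i, T.Ext (d j i) (fun _ : Fin 1 => a j i)) :
    vc (hs (a := a) (b := b) g) (hs (J := Σ j, I j) (a := fun s => d s.1 s.2)
      (b := fun s => a s.1 s.2) fun s => f s.1 s.2) =
      rel (a := fun s : Σ j, Σ i, M j i => d s.1 s.2.1 s.2.2) (b := b)
        (a' := fun s : Σ s : Σ j, I j, M s.1 s.2 => d s.1.1 s.1.2 s.2) (b' := b)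
        (Equiv.sigmaAssoc M).symm (Equiv.refl _) (pf fun _ => rfl) (pf fun _ => rfl)
        (hs (a := fun j (s : Σ i, M j i) => d j s.1 s.2) (b := b)
          fun j => vc (g j) (hs (a := d j) (b := a j) (f j))) := by
  have h : big (fun j => hs (a := d j) (b := a j) (f j)) =
      rel (a := fun s : Σ s : Σ j, I j, M s.1 s.2 => d s.1.1 s.1.2 s.2)
        (b := fun s : Σ j, I j => a s.1 s.2) (a' := fun s : Σ j, Σ i, M j i => d s.1 s.2.1 s.2.2)
        (b' := fun s : Σ j, I j => a s.1 s.2)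
        (Equiv.sigmaAssoc M) (Equiv.refl _) (pf fun _ => rfl) (pf fun _ => rfl)
        (hs (J := Σ j, I j) (a := fun s => d s.1 s.2)
          (b := fun s => a s.1 s.2) fun s => f s.1 s.2) := by
    refine (big_rel (a := fun j (s : Σ i, M j i) => d j s.1 s.2)
      (b := fun j (s : Σ _ : I j, Fin 1) => a j s.1) (b' := a) (fun _ => Equiv.refl _)
      (fun j => sigmaOnes (I j)) (fun _ _ => rfl) (fun _ _ => rfl) fun j => big (f j)).trans ?_
    refine (congrArg _ (big_big f)).trans ((rel_rel ..).trans (Eq.trans ?_ (rel_rel ..).symm))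
    refine rel_congr _ _ _ _ (big fun s : Σ j, I j => f s.1 s.2) (fun _ => rfl) fun _ => rfl
  refine (vc_rel_out (a := fun s : Σ s : Σ j, I j, M s.1 s.2 => d s.1.1 s.1.2 s.2)
    (b := fun s : Σ j, I j => a s.1 s.2)
    (c := fun s : Σ _ : J, Fin 1 => b s.1) (c' := b) (sigmaOnes J) (fun _ => rfl) (big g) _).trans ?_
  unfold hs
  refine Eq.trans ?_ (congrArg _ (congrArg _ ((big_vc (c := fun j (_ : Fin 1) => b j) g
    fun j => hs (a := d j) (b := a j) (f j)).trans
    ((congrArg _ h).trans (vc_rel_in (c := fun s : Σ _ : J, Fin 1 => b s.1) _ _ _ _))))).symm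
  refine Eq.trans ?_ ((congrArg _ (rel_rel ..)).trans (rel_rel ..)).symm
  refine rel_congr _ _ _ _ (vc (big g) (hs (J := Σ j, I j) (a := fun s => d s.1 s.2)
          (b := fun s => a s.1 s.2) fun s => f s.1 s.2)) (fun _ => rfl) fun _ => rfl



theorem rel_id' {a : I → T.Col} {b : J → T.Col} (x : T.Ext a b) :
    rel (a := a) (b := b) (a' := a) (b' := b) (Equiv.refl _) (Equiv.refl _) (pf fun _ => rfl)
      (pf fun _ => rfl) x = x :=
  rel_id _ _ _ (fun _ => rfl) (fun _ => rfl)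

/-- Renaming of the intermediate list. -/
theorem vc_mid {a : I → T.Col} {a' : I' → T.Col} {b : J → T.Col} {b' : J' → T.Col}
    {c : K → T.Col} (ρ : I ≃ I') (ha : ∀ i, a' (ρ i) = a i) (σ : J ≃ J') (h : ∀ j, b' (σ j) = b j)
    (f : T.Ext b c) (f' : T.Ext b' c)
    (hf : rel (a := b) (b := c) (a' := b') (b' := c) σ (Equiv.refl _) h (pf fun _ => rfl) f = f')
    (g : T.Ext a b) :
    vc f' (rel (b := b) ρ σ ha h g) = rel (a := a) (b := c) (b' := c) ρ (Equiv.refl _)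
      ha (pf fun _ => rfl) (vc f g) := by
  subst hf
  exact vc_rel _ _ _ _ _ _ _ _ (fun _ => rfl) f g

theorem inp_flatMap {n m : ℕ} {p : Fin n → ℕ} {q : Fin m → ℕ}
    {b : ∀ i, Fin (p i) → T.Col} {b' : ∀ i, Fin (q i) → T.Col} {c : T.Col}
    (σ : (Σ i, Fin (p i)) ≃ Σ j, Fin (q j)) (h : ∀ s, b s.1 s.2 = b' (σ s).1 (σ s).2)
    (h' : ∀ s, b (σ.symm s).1 (σ.symm s).2 = b' s.1 s.2)
    (x : T.Ext (fun s : Σ i, Fin (q i) => b' s.1 s.2) (fun _ : Fin 1 => c)) :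
    T.inp (a := flat b') (a' := flat b) (b := fun _ : Fin 1 => c) (flatMap σ) (flat_flatMap h) x =
      rel (b := fun _ : Fin 1 => c) (b' := fun _ : Fin 1 => c)
        (a' := fun s : Σ i, Fin (p i) => b s.1 s.2) σ.symm (Equiv.refl _) h'
        (pf fun _ => rfl) x := by
  refine inp_eq_rel (I := Σ i, Fin (q i)) (I' := Σ i, Fin (p i))
    (a := fun s => b' s.1 s.2) (a' := fun s => b s.1 s.2)
    (b := fun _ : Fin 1 => c) σ.symm _ _ (fun k => ?_) _ x
  refine (Equiv.eq_symm_apply _).2 (Eq.symm ?_)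
  exact Equiv.symm_apply_apply finSigmaFinEquiv (σ (finSigmaFinEquiv.symm k))

end
end ColoredProp

open ColoredProp

/-- The operad underlying a prop: the operations with exactly one output, with
`γ(g, ⟨f i⟩_i) = g ∘ᵥ (f 0 ∘ₕ ⋯ ∘ₕ f (n-1))`. -/
def underlying (T : ColoredProp.{u}) : ColoredOperad.{u} where
  Col := T.Col
  Op a c := T.Op a (fun _ : Fin 1 => c)
  id := T.id
  perm := T.inp
  comp {n p a c b} g f := vc (T := T) (I := Σ i, Fin (p i)) (J := Fin n) (K := Fin 1)
    (a := fun s => b s.1 s.2) (b := a) (c := fun _ => c) g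
    (hs (I := fun i => Fin (p i)) (a := b) (b := a) f)
  perm_refl := T.laws.inp_refl
  perm_perm := T.laws.inp_inp
  id_comp {n a c} f := by
    refine (congrArg (fun x => vc (T := T) x _) (il_one c).symm).trans ((il_vc _).trans ?_)
    refine (hs_one (I := Fin n) (a := a) (c := c) f).trans (inp_eq_rel (I := Fin n)
      (I' := Σ _ : Fin 1, Fin n)
      (a := a) (a' := fun s : Σ _ : Fin 1, Fin n => a s.2) (b := fun _ : Fin 1 => c)
      (sigmaOne (Fin n)).symm _ _ ?_ (fun _ => rfl) f).symm
    exact fun k => Sigma.ext (Subsingleton.elim _ _) HEq.rfl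
  comp_id {n a c} f := by
    refine (congrArg _ (hs_id (T := T) (J := Fin n) a)).trans ?_
    refine (vc_rel_in (I := Fin n) (I' := Σ _ : Fin n, Fin 1) (J := Fin n) (K := Fin 1)
      (a := a) (b := a) (c := fun _ => c) _ _ f (il a)).trans ?_
    refine (congrArg _ (vc_il _)).trans (inp_eq_rel (I := Fin n)
      (I' := Σ _ : Fin n, Fin 1)
      (a := a) (a' := fun s : Σ _ : Fin n, Fin 1 => a s.1) (b := fun _ : Fin 1 => c)
      (sigmaOnes (Fin n)).symm _ _ ?_ (fun _ => rfl) f).symm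
    exact fun k => Sigma.ext rfl (heq_of_eq (Subsingleton.elim _ _))
  assoc {n p q a d b c} f g h := by
    let e : Fin (∑ i, p i) ≃ Σ i, Fin (p i) := finSigmaFinEquiv.symm
    let hh (s : Σ i, Fin (p i)) : T.Ext (c s.1 s.2) (fun _ : Fin 1 => b s.1 s.2) := h s.1 s.2
    let Y := vc (T := T) (I := Σ k, Fin (flat q k)) (J := Fin (∑ i, p i)) (K := Fin 1)
      (a := fun s => c (e s.1).1 (e s.1).2 s.2) (b := fun k => b (e k).1 (e k).2) (c := fun _ => d)
      (vc (T := T) (I := Σ i, Fin (p i)) (J := Fin n) (K := Fin 1)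
        (a := fun s => b s.1 s.2) (b := a) (c := fun _ => d) f
          (hs (I := fun i => Fin (p i)) (a := b) (b := a) g))
      (hs (T := T) (J := Fin (∑ i, p i)) (I := fun k => Fin (flat q k))
        (a := fun k => c (e k).1 (e k).2) (b := fun k => b (e k).1 (e k).2) fun k => hh (e k))
    have h1 : vc (T := T) (vc (T := T) (K := Fin 1) (b := a) (c := fun _ => d) f
          (hs (I := fun i => Fin (p i)) (a := b) (b := a) g))
          (hs (T := T) (a := fun s => c s.1 s.2) (b := fun s : Σ i, Fin (p i) => b s.1 s.2) hh) =
        rel (T := T) (a := fun s : Σ k : Fin (∑ i, p i), Fin (q (e k).1 (e k).2) =>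
            c (e s.1).1 (e s.1).2 s.2) (b := fun _ : Fin 1 => d)
          (a' := fun s : Σ s : Σ i, Fin (p i), Fin (q s.1 s.2) => c s.1.1 s.1.2 s.2)
          (b' := fun _ : Fin 1 => d)
          (Equiv.sigmaCongrLeft (β := fun s : Σ i, Fin (p i) => Fin (q s.1 s.2)) e)
          (Equiv.refl _) (pf fun _ => rfl) (pf fun _ => rfl) Y := by
      refine (congrArg _ (hs_equiv e hh)).trans (vc_mid _ _ _ _ _ _ ?_ _)
      refine T.act_id _ _ (fun i => ?_) (fun _ => rfl) _
      exact finSigmaFinEquiv.apply_symm_apply i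
    have h2 : vc (T := T) (vc (T := T) (K := Fin 1) (b := a) (c := fun _ => d) f
          (hs (I := fun i => Fin (p i)) (a := b) (b := a) g))
          (hs (T := T) (a := fun s => c s.1 s.2) (b := fun s : Σ i, Fin (p i) => b s.1 s.2) hh) =
        rel (T := T) (a := fun s : Σ i, Σ j, Fin (q i j) => c s.1 s.2.1 s.2.2)
          (b := fun _ : Fin 1 => d)
          (a' := fun s : Σ s : Σ i, Fin (p i), Fin (q s.1 s.2) => c s.1.1 s.1.2 s.2)
          (b' := fun _ : Fin 1 => d)
          (Equiv.sigmaAssoc fun i j => Fin (q i j)).symm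
          (Equiv.refl _) (pf fun _ => rfl) (pf fun _ => rfl)
          (vc (T := T) (b := a) f
            (hs (a := fun j (s : Σ i, Fin (q j i)) => c j s.1 s.2) (b := a)
          fun j => vc (T := T) (c := fun _ : Fin 1 => a j) (g j)
            (hs (T := T) (a := c j) (b := b j) (h j)))) := by
      refine (vc_assoc (T := T) (c := a) (d := fun _ : Fin 1 => d) f _ _).trans ((congrArg _ (hs_hs (T := T) (J := Fin n)
        (I := fun i => Fin (p i)) (M := fun i j => Fin (q i j)) (b := a) (a := b) (d := c) g
        h)).trans ?_)
      exact vc_rel_in _ _ _ _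
    let W (j : Fin n) := vc (T := T) (c := fun _ : Fin 1 => a j) (g j)
            (hs (T := T) (a := c j) (b := b j) (h j))
    have h3 : hs (T := T) (J := Fin n) (I := fun i => Fin (∑ j, q i j)) (a := fun i => flat (c i))
        (b := a) W =
        rel (T := T) (b := a) (b' := a) (a := fun s : Σ i, Σ j, Fin (q i j) => c s.1 s.2.1 s.2.2)
          (a' := fun s : Σ i, Fin (∑ j, q i j) => flat (c s.1) s.2)
          (Equiv.sigmaCongrRight fun i => finSigmaFinEquiv) (Equiv.refl _)
          (pf fun s => congrArg (fun t : Σ j, Fin (q s.1 j) => c s.1 t.1 t.2)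
            (finSigmaFinEquiv.symm_apply_apply s.2)) (pf fun _ => rfl)
          (hs (a := fun j (s : Σ i, Fin (q j i)) => c j s.1 s.2) (b := a) W) := by
      refine Eq.trans ?_ (hs_rel (T := T) (a := fun j (s : Σ i, Fin (q j i)) => c j s.1 s.2)
        (a' := fun i => flat (c i)) (b := a)
        (fun i => finSigmaFinEquiv) (fun i j => congrArg (fun t : Σ j, Fin (q i j) => c i t.1 t.2)
            (finSigmaFinEquiv.symm_apply_apply j)) W)
      refine congrArg _ (funext fun i => (T.act_id _ _ (fun i => ?_) (fun _ => rfl) _).symm)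
      exact finSigmaFinEquiv.apply_symm_apply i
    have h4 := (congrArg (fun X => vc (T := T) (I := Σ i, Fin (∑ j, q i j)) (J := Fin n)
      (K := Fin 1) (a := fun s => flat (c s.1) s.2) (b := a) (c := fun _ => d) f X) h3).trans
      (vc_rel_in (T := T) (b := a) (c := fun _ : Fin 1 => d) _ _ f _)
    refine Eq.trans ?_ (congrArg (T.inp (a := flat fun i => flat (c i)) (b := fun _ : Fin 1 => d)
      (flatAssoc q) (flat_flatAssoc c)) h4).symm
    have H (s : Σ k : Fin (∑ i, p i), Fin (q (e k).1 (e k).2)) :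
        c (e s.1).1 (e s.1).2 s.2 = flat (c (e s.1).1) (finSigmaFinEquiv ⟨(e s.1).2, s.2⟩) :=
      congrArg (fun t : Σ j, Fin (q (e s.1).1 j) => c (e s.1).1 t.1 t.2)
        (finSigmaFinEquiv.symm_apply_apply (⟨(e s.1).2, s.2⟩ : Σ j, Fin (q (e s.1).1 j))).symm
    refine Eq.trans ?_ (inp_flatMap (p := flat q) (b := fun k => c (e k).1 (e k).2)
      (b' := fun i => flat (c i))
      ((Equiv.sigmaCongrLeft (β := fun s : Σ i, Fin (p i) => Fin (q s.1 s.2)) e).trans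
        ((Equiv.sigmaAssoc fun i j => Fin (q i j)).trans
          (Equiv.sigmaCongrRight fun _ => finSigmaFinEquiv))) ?_ ?_ _).symm
    · have h5 := congrArg (rel (T := T)
          (a' := fun s : Σ k : Fin (∑ i, p i), Fin (q (e k).1 (e k).2) =>
            c (e s.1).1 (e s.1).2 s.2) (b' := fun _ : Fin 1 => d)
          (Equiv.sigmaCongrLeft (β := fun s : Σ i, Fin (p i) => Fin (q s.1 s.2)) e).symm
          (Equiv.refl _) (pf fun s => congrArg (fun s : Σ s : Σ i, Fin (p i), Fin (q s.1 s.2) =>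
            c s.1.1 s.1.2 s.2) ((Equiv.sigmaCongrLeft
              (β := fun s : Σ i, Fin (p i) => Fin (q s.1 s.2)) e).apply_symm_apply s))
          (pf fun _ => rfl)) (h1.symm.trans h2)
      refine Eq.trans ?_ (h5.trans ?_)
      · refine Eq.symm ((rel_rel ..).trans (rel_id _ _ _ (fun i => ?_) fun _ => rfl))
        simp
      · refine (rel_rel ..).trans (Eq.trans ?_ (rel_rel ..).symm)
        refine ColoredProp.rel_congr _ _ _ _ (vc (T := T) (b := a) (c := fun _ : Fin 1 => d) f
            (hs (a := fun j (s : Σ i, Fin (q j i)) => c j s.1 s.2) (b := a) W)) ?_ fun _ => rfl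
        intro i
        simp only [Equiv.trans_apply, Equiv.symm_trans_apply, Equiv.symm_apply_apply]
    · exact fun s => H s
    · intro s
      refine (H _).trans ?_
      exact congrArg (fun s : Σ i, Fin (∑ j, q i j) => flat (c s.1) s.2)
        (((Equiv.sigmaCongrLeft (β := fun s : Σ i, Fin (p i) => Fin (q s.1 s.2)) e).trans
        ((Equiv.sigmaAssoc fun i j => Fin (q i j)).trans
          (Equiv.sigmaCongrRight fun _ => finSigmaFinEquiv))).apply_symm_apply s)
  perm_comp {n n' p a c b} σ f g := by
    let X := hs (T := T) (I := fun i => Fin (p (σ i))) (a := fun j => b (σ j))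
      (b := fun j => a (σ j)) fun j => g (σ j)
    let Y := vc (T := T) (I := Σ i, Fin (p (σ i))) (J := Fin n') (K := Fin 1)
      (b := fun j => a (σ j)) (c := fun _ => c) (T.inp σ (pf fun _ => rfl) f) X
    have h : vc (T := T) (I := Σ i, Fin (p i)) (J := Fin n) (K := Fin 1)
        (a := fun s => b s.1 s.2) (b := a) (c := fun _ => c) f
        (hs (I := fun i => Fin (p i)) (a := b) (b := a) g) =
        rel (T := T) (a := fun s : Σ i, Fin (p (σ i)) => b (σ s.1) s.2) (b := fun _ : Fin 1 => c)
          (a' := fun s : Σ i, Fin (p i) => b s.1 s.2) (b' := fun _ : Fin 1 => c)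
          (Equiv.sigmaCongrLeft (β := fun i => Fin (p i)) σ)
          (Equiv.refl _) (pf fun _ => rfl) (pf fun _ => rfl) Y := by
      refine (congrArg _ (hs_equiv (I := fun i => Fin (p i)) (a := b) (b := a) σ g)).trans ?_
      refine vc_mid _ _ _ _ _ _ ?_ _
      refine (congrArg _ (inp_eq_rel (I := Fin n) (I' := Fin n') (a := a) (a' := fun i => a (σ i))
        (b := fun _ : Fin 1 => c) σ.symm σ _ ?_ ?_ f)).trans ?_
      · exact fun k => (σ.symm_apply_apply k).symm
      · exact fun k => congrArg a (σ.apply_symm_apply k)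
      refine (rel_rel ..).trans (rel_id _ _ _ (fun i => ?_) fun _ => rfl)
      simp
    refine Eq.trans ?_ (congrArg (T.inp _ _) h).symm
    refine Eq.trans ?_ (inp_flatMap (b := fun i => b (σ i)) (b' := b)
      (Equiv.sigmaCongrLeft (β := fun i => Fin (p i)) σ) (fun _ => rfl) (fun s => ?_) _).symm
    · refine Eq.symm ((rel_rel ..).trans (rel_id _ _ _ (fun i => ?_) fun _ => rfl))
      simp
    · exact congrArg (fun s : Σ i, Fin (p i) => b s.1 s.2)
        ((Equiv.sigmaCongrLeft (β := fun i => Fin (p i)) σ).apply_symm_apply s)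
  comp_perm {n p p' a c b b'} σ h f g := by
    have e : (fun i => T.inp (σ i) (h i) (g i)) = fun i => rel (T := T) (I := Fin (p i))
        (I' := Fin (p' i)) (a := b i) (a' := b' i) (b := fun _ : Fin 1 => a i)
        (b' := fun _ : Fin 1 => a i) (σ i).symm (Equiv.refl _)
        (pf fun j => (h i _).trans (congrArg (b i) ((σ i).apply_symm_apply j)))
        (pf fun _ => rfl) (g i) :=
      funext fun i => inp_eq_rel (I := Fin (p i)) (I' := Fin (p' i)) (a := b i) (a' := b' i)
        (b := fun _ : Fin 1 => a i) (σ i).symm (σ i) _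
        (fun k => ((σ i).symm_apply_apply k).symm) _ _
    rw [e]
    refine (congrArg _ (hs_rel (T := T) (J := Fin n) (a := b) (a' := b') (b := a)
      (fun i => (σ i).symm) _ g)).trans ((vc_rel_in (T := T) _ _ _ _).trans ?_)
    exact (inp_flatMap (T := T) (b := b') (b' := b) (c := c) (Equiv.sigmaCongrRight σ)
      (fun s => h s.1 s.2) (fun s => (h _ _).trans (congrArg (b s.1) ((σ s.1).apply_symm_apply s.2)))
      _).symm

end PropOperad

namespace PropOperad
open Listed

namespace PropHom
open ColoredProp
variable {R T : ColoredProp.{u}} (F : PropHom R T)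

section
variable {I I' J J' K : Type} [Listed I] [Listed I'] [Listed J]
  [Listed J'] [Listed K]

/-- The action of a homomorphism on operations between lists. -/
def app {a : I → R.Col} {b : J → R.Col} (x : R.Ext a b) :
    T.Ext (fun i => F.col (a i)) (fun j => F.col (b j)) := F.map x

theorem map_act {n n' m m' : ℕ} {a : Fin n → R.Col} {a' : Fin n' → R.Col} {b : Fin m → R.Col}
    {b' : Fin m' → R.Col} (σ : Fin n' ≃ Fin n) (τ : Fin m ≃ Fin m') (ha : ∀ i, a' i = a (σ i))
    (hb : ∀ k, b' k = b (τ.symm k)) (x : R.Op a b) :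
    F.map (R.act σ τ ha hb x) = T.act σ τ (fun i => congrArg F.col (ha i))
      (fun i => congrArg F.col (hb i)) (F.map x) := by
  unfold PropData.act
  rw [F.map_inp, F.map_out]

theorem app_rel {a : I → R.Col} {a' : I' → R.Col} {b : J → R.Col} {b' : J' → R.Col} (σ : I ≃ I')
    (τ : J ≃ J') (ha : ∀ i, a' (σ i) = a i) (hb : ∀ j, b' (τ j) = b j) (x : R.Ext a b) :
    F.app (rel σ τ ha hb x) = rel (a' := fun i => F.col (a' i)) (b' := fun i => F.col (b' i))
      σ τ (pf fun i => congrArg F.col (ha i)) (pf fun i => congrArg F.col (hb i)) (F.app x) :=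
  F.map_act ..

theorem app_vc {a : I → R.Col} {b : J → R.Col} {c : K → R.Col} (f : R.Ext b c) (g : R.Ext a b) :
    F.app (vc f g) = vc (F.app f) (F.app g) := F.map_vcomp f g

theorem app_hc {a : I → R.Col} {b : J → R.Col} {a' : I' → R.Col} {b' : J' → R.Col}
    (f : R.Ext a b) (g : R.Ext a' b') : F.app (hc f g) =
      rel (a' := fun i => F.col (Sum.elim a a' i)) (b' := fun i => F.col (Sum.elim b b' i))
        (Equiv.refl _) (Equiv.refl _) (pf <| by rintro (i | i) <;> rfl)
        (pf <| by rintro (i | i) <;> rfl) (hc (F.app f) (F.app g)) := by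
  refine (F.map_act ..).trans ((congrArg _ (F.map_hcomp ..)).trans ?_)
  refine (T.act_act ..).trans (Eq.trans ?_ (T.act_act ..).symm)
  refine T.act_congr _ _ _ _ ?_ ?_ _ <;> intro i <;> simp <;> rfl

theorem app_un : F.app (un : R.Ext _ _) =
    rel (a' := fun i => F.col (Fin.elim0 i)) (b' := fun i => F.col (Fin.elim0 i)) (Equiv.refl _)
      (Equiv.refl _) (pf fun i => i.elim0) (pf fun i => i.elim0) un := by
  refine (F.map_act ..).trans ((congrArg _ F.map_unit).trans ?_)
  refine (T.act_act ..).trans (Eq.trans ?_ (T.act_act ..).symm)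
  refine T.act_congr _ _ _ _ ?_ ?_ _ <;> intro i <;> exact i.elim0

theorem app_hl {n : ℕ} {I J : Fin n → Type} [∀ i, Listed (I i)] [∀ i, Listed (J i)]
    {a : ∀ i, I i → R.Col} {b : ∀ i, J i → R.Col} (f : ∀ i, R.Ext (a i) (b i)) :
    F.app (hl f) = hl fun i => F.app (f i) := by
  induction n with
  | zero =>
    refine (F.app_rel ..).trans ((congrArg _ F.app_un).trans ((rel_rel ..).trans ?_))
    refine rel_congr _ _ _ _ un ?_ ?_ <;> exact fun i => i.elim0
  | succ n ih =>
    refine (F.app_rel ..).trans ((congrArg _ (F.app_hc ..)).trans ((rel_rel ..).trans ?_))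
    have := ih fun i => f i.succ
    rw [this]
    exact rel_congr _ _ _ _ (hc (F.app (f 0)) (hl fun i => F.app (f i.succ))) (fun _ => rfl)
      fun _ => rfl

theorem app_big {I J : K → Type} [∀ i, Listed (I i)] [∀ i, Listed (J i)]
    {a : ∀ i, I i → R.Col} {b : ∀ i, J i → R.Col} (f : ∀ i, R.Ext (a i) (b i)) :
    F.app (big f) = big fun i => F.app (f i) := by
  unfold big bigE
  exact (F.app_rel ..).trans (congrArg _ (F.app_hl fun k => f (enum k)))

theorem app_hs {I : J → Type} [∀ j, Listed (I j)] {a : ∀ j, I j → R.Col} {b : J → R.Col}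
    (f : ∀ j, R.Ext (a j) (fun _ : Fin 1 => b j)) :
    F.app (hs (a := a) (b := b) f) = hs (a := fun j i => F.col (a j i)) (b := fun j => F.col (b j)) fun j => F.app (f j) := by
  unfold hs
  exact (F.app_rel ..).trans (congrArg _ (F.app_big f))

end

/-- The homomorphism of underlying operads. -/
def underlying : OperadHom (underlying R) (underlying T) where
  col := F.col
  map f := F.map f
  map_id c := F.map_id c
  map_perm σ h f := F.map_inp σ h f
  map_comp {n p a c b} g f := by
    refine (F.map_vcomp ..).trans (congrArg _ ?_)
    exact F.app_hs (J := Fin n) (I := fun i => Fin (p i)) (a := b) (b := a) f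

end PropHom

/-- The forgetful functor `U` from props to operads. -/
def U : ColoredProp.{u} ⥤ ColoredOperad.{u} where
  obj T := underlying T
  map F := PropHom.underlying F

end PropOperad

namespace PropOperad
open Listed ColoredProp

section
variable {R T : ColoredProp.{u}} {P P' Q Q' S : Type} [Listed P] [Listed P'] [Listed Q] [Listed Q']
  [Listed S]

/-- The horizontal composite `⟨f_j φ⟩_j` of the images of an operation under several maps. -/
def images (f : P → PropHom R T) {n m : ℕ} {a : Fin n → R.Col} {b : Fin m → R.Col}
    (φ : R.Op a b) : T.Ext (fun s : Σ _ : P, Fin n => (f s.1).col (a s.2))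
      (fun s : Σ _ : P, Fin m => (f s.1).col (b s.2)) :=
  big (I := fun _ => Fin n) (J := fun _ => Fin m) (a := fun p i => (f p).col (a i))
    (b := fun p i => (f p).col (b i)) fun p => (f p).map φ

/-- The horizontal composite `⟨ξ_{a_i}⟩_i` of the components of a family along a list. -/
def components {f : P → PropHom R T} {g : Q → PropHom R T}
    (ξ : ∀ c, T.Ext (fun p => (f p).col c) (fun q => (g q).col c)) {n : ℕ} (a : Fin n → R.Col) :
    T.Ext (fun s : Σ _ : Fin n, P => (f s.2).col (a s.1))
      (fun s : Σ _ : Fin n, Q => (g s.2).col (a s.1)) :=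
  big (I := fun _ => P) (J := fun _ => Q) (a := fun i p => (f p).col (a i))
    (b := fun i q => (g q).col (a i)) fun i => ξ (a i)

/-- A family `ξ_c : ⟨f_j c⟩_j → ⟨g_l c⟩_l` is a natural transformation if for every
`φ : ⟨a_i⟩_i → ⟨b_k⟩_k` the octagon
`τ'_* ⟨g_l φ⟩_l ∘ᵥ τ_* ⟨ξ_{a_i}⟩_i = σ'^* ⟨ξ_{b_k}⟩_k ∘ᵥ σ^* ⟨f_j φ⟩_j`
commutes, where `σ`, `σ'`, `τ`, `τ'` are interchanges of two indices. -/
def IsNatural (f : P → PropHom R T) (g : Q → PropHom R T)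
    (ξ : ∀ c, T.Ext (fun p => (f p).col c) (fun q => (g q).col c)) : Prop :=
  ∀ ⦃n m : ℕ⦄ ⦃a : Fin n → R.Col⦄ ⦃b : Fin m → R.Col⦄ (φ : R.Op a b),
    vc (rel (b := fun s : Σ _ : Q, Fin m => (g s.1).col (b s.2))
          (b' := fun s : Σ _ : Fin m, Q => (g s.2).col (b s.1))
          (a := fun s : Σ _ : Q, Fin n => (g s.1).col (a s.2))
          (a' := fun s : Σ _ : Q, Fin n => (g s.1).col (a s.2))
          (Equiv.refl _) (sigmaSwap Q (Fin m)) (pf fun _ => rfl) (pf fun _ => rfl) (images g φ))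
        (rel (a := fun s : Σ _ : Fin n, P => (f s.2).col (a s.1))
          (a' := fun s : Σ _ : Fin n, P => (f s.2).col (a s.1))
          (b := fun s : Σ _ : Fin n, Q => (g s.2).col (a s.1))
          (b' := fun s : Σ _ : Q, Fin n => (g s.1).col (a s.2))
          (Equiv.refl _) (sigmaSwap (Fin n) Q) (pf fun _ => rfl) (pf fun _ => rfl)
          (components ξ a)) =
      vc (rel (a := fun s : Σ _ : Fin m, P => (f s.2).col (b s.1))
          (a' := fun s : Σ _ : P, Fin m => (f s.1).col (b s.2))
          (b := fun s : Σ _ : Fin m, Q => (g s.2).col (b s.1))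
          (b' := fun s : Σ _ : Fin m, Q => (g s.2).col (b s.1))
          (sigmaSwap (Fin m) P) (Equiv.refl _) (pf fun _ => rfl) (pf fun _ => rfl)
          (components ξ b))
        (rel (a := fun s : Σ _ : P, Fin n => (f s.1).col (a s.2))
          (a' := fun s : Σ _ : Fin n, P => (f s.2).col (a s.1))
          (b := fun s : Σ _ : P, Fin m => (f s.1).col (b s.2))
          (b' := fun s : Σ _ : P, Fin m => (f s.1).col (b s.2))
          (sigmaSwap P (Fin n)) (Equiv.refl _) (pf fun _ => rfl) (pf fun _ => rfl) (images f φ))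

/-- The images of an operation, arranged by the inputs and outputs of the operation. -/
def simages (f : P → PropHom R T) {n m : ℕ} {a : Fin n → R.Col} {b : Fin m → R.Col}
    (φ : R.Op a b) : T.Ext (fun s : Σ _ : Fin n, P => (f s.2).col (a s.1))
      (fun s : Σ _ : Fin m, P => (f s.2).col (b s.1)) :=
  rel (a := fun s : Σ _ : P, Fin n => (f s.1).col (a s.2))
    (a' := fun s : Σ _ : Fin n, P => (f s.2).col (a s.1))
    (b := fun s : Σ _ : P, Fin m => (f s.1).col (b s.2))
    (b' := fun s : Σ _ : Fin m, P => (f s.2).col (b s.1))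
    (sigmaSwap P (Fin n)) (sigmaSwap P (Fin m)) (pf fun _ => rfl) (pf fun _ => rfl) (images f φ)

theorem isNatural_iff (f : P → PropHom R T) (g : Q → PropHom R T)
    (ξ : ∀ c, T.Ext (fun p => (f p).col c) (fun q => (g q).col c)) :
    IsNatural f g ξ ↔ ∀ ⦃n m : ℕ⦄ ⦃a : Fin n → R.Col⦄ ⦃b : Fin m → R.Col⦄ (φ : R.Op a b),
      vc (simages g φ) (components ξ a) = vc (components ξ b) (simages f φ) := by
  have e1 {n m : ℕ} {a : Fin n → R.Col} {b : Fin m → R.Col} (φ : R.Op a b) :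
      vc (rel (b := fun s : Σ _ : Q, Fin m => (g s.1).col (b s.2))
          (b' := fun s : Σ _ : Fin m, Q => (g s.2).col (b s.1))
          (a := fun s : Σ _ : Q, Fin n => (g s.1).col (a s.2))
          (a' := fun s : Σ _ : Q, Fin n => (g s.1).col (a s.2))
          (Equiv.refl _) (sigmaSwap Q (Fin m)) (pf fun _ => rfl) (pf fun _ => rfl) (images g φ))
        (rel (a := fun s : Σ _ : Fin n, P => (f s.2).col (a s.1))
          (a' := fun s : Σ _ : Fin n, P => (f s.2).col (a s.1))
          (b := fun s : Σ _ : Fin n, Q => (g s.2).col (a s.1))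
          (b' := fun s : Σ _ : Q, Fin n => (g s.1).col (a s.2))
          (Equiv.refl _) (sigmaSwap (Fin n) Q) (pf fun _ => rfl) (pf fun _ => rfl)
          (components ξ a)) = vc (simages g φ) (components ξ a) := by
    refine (vc_mid (a := fun s : Σ _ : Fin n, P => (f s.2).col (a s.1))
      (a' := fun s : Σ _ : Fin n, P => (f s.2).col (a s.1))
      (b := fun s : Σ _ : Fin n, Q => (g s.2).col (a s.1))
      (b' := fun s : Σ _ : Q, Fin n => (g s.1).col (a s.2))
      (c := fun s : Σ _ : Fin m, Q => (g s.2).col (b s.1))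
      (Equiv.refl _) (pf fun _ => rfl) (sigmaSwap (Fin n) Q) (pf fun _ => rfl)
      (simages g φ) _ ?_ (components ξ a)).trans (rel_id' _)
    exact (rel_rel ..).trans (rel_congr _ _ _ _ (images g φ) (fun _ => rfl) fun _ => rfl)
  have e2 {n m : ℕ} {a : Fin n → R.Col} {b : Fin m → R.Col} (φ : R.Op a b) :
      vc (rel (a := fun s : Σ _ : Fin m, P => (f s.2).col (b s.1))
          (a' := fun s : Σ _ : P, Fin m => (f s.1).col (b s.2))
          (b := fun s : Σ _ : Fin m, Q => (g s.2).col (b s.1))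
          (b' := fun s : Σ _ : Fin m, Q => (g s.2).col (b s.1))
          (sigmaSwap (Fin m) P) (Equiv.refl _) (pf fun _ => rfl) (pf fun _ => rfl)
          (components ξ b))
        (rel (a := fun s : Σ _ : P, Fin n => (f s.1).col (a s.2))
          (a' := fun s : Σ _ : Fin n, P => (f s.2).col (a s.1))
          (b := fun s : Σ _ : P, Fin m => (f s.1).col (b s.2))
          (b' := fun s : Σ _ : P, Fin m => (f s.1).col (b s.2))
          (sigmaSwap P (Fin n)) (Equiv.refl _) (pf fun _ => rfl) (pf fun _ => rfl) (images f φ)) =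
      vc (components ξ b) (simages f φ) := by
    have h : rel (a := fun s : Σ _ : P, Fin n => (f s.1).col (a s.2))
          (a' := fun s : Σ _ : Fin n, P => (f s.2).col (a s.1))
          (b := fun s : Σ _ : P, Fin m => (f s.1).col (b s.2))
          (b' := fun s : Σ _ : P, Fin m => (f s.1).col (b s.2))
          (sigmaSwap P (Fin n)) (Equiv.refl _) (pf fun _ => rfl) (pf fun _ => rfl) (images f φ) =
        rel (a := fun s : Σ _ : Fin n, P => (f s.2).col (a s.1))
          (a' := fun s : Σ _ : Fin n, P => (f s.2).col (a s.1))
          (b := fun s : Σ _ : Fin m, P => (f s.2).col (b s.1))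
          (b' := fun s : Σ _ : P, Fin m => (f s.1).col (b s.2))
          (Equiv.refl _) (sigmaSwap (Fin m) P) (pf fun _ => rfl) (pf fun _ => rfl)
          (simages f φ) := by
      refine Eq.trans ?_ (rel_rel ..).symm
      exact rel_congr _ _ _ _ (images f φ) (fun _ => rfl) fun _ => rfl
    rw [h]
    exact (vc_mid (a := fun s : Σ _ : Fin n, P => (f s.2).col (a s.1))
      (a' := fun s : Σ _ : Fin n, P => (f s.2).col (a s.1))
      (b := fun s : Σ _ : Fin m, P => (f s.2).col (b s.1))
      (b' := fun s : Σ _ : P, Fin m => (f s.1).col (b s.2))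
      (c := fun s : Σ _ : Fin m, Q => (g s.2).col (b s.1)) (Equiv.refl _) (pf fun _ => rfl)
      (sigmaSwap (Fin m) P) (pf fun _ => rfl) (components ξ b) _ rfl (simages f φ)).trans (rel_id' _)
  constructor
  · intro h n m a b φ
    refine (e1 φ).symm.trans (Eq.trans ?_ (e2 φ))
    exact h φ
  · intro h n m a b φ
    refine (e1 φ).trans (Eq.trans ?_ (e2 φ).symm)
    exact h φ

theorem IsNatural.vc {f : P → PropHom R T} {g : Q → PropHom R T} {h : S → PropHom R T}
    {ζ : ∀ c, T.Ext (fun p => (g p).col c) (fun q => (h q).col c)}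
    {ξ : ∀ c, T.Ext (fun p => (f p).col c) (fun q => (g q).col c)}
    (hζ : IsNatural g h ζ) (hξ : IsNatural f g ξ) : IsNatural f h fun c => vc (ζ c) (ξ c) := by
  rw [isNatural_iff] at *
  intro n m a b φ
  have e {n : ℕ} (a : Fin n → R.Col) : components (fun c => ColoredProp.vc (ζ c) (ξ c)) a =
      ColoredProp.vc (components ζ a) (components ξ a) := big_vc _ _
  rw [e, e, ← vc_assoc, hζ, vc_assoc, hξ, vc_assoc]

theorem isNatural_il (f : P → PropHom R T) :
    IsNatural f f fun c => il fun p => (f p).col c := by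
  rw [isNatural_iff]
  intro n m a b φ
  have e {n : ℕ} (a : Fin n → R.Col) : components (f := f) (g := f) (fun c => il fun p => (f p).col c) a =
      il _ := big_il fun i p => (f p).col (a i)
  rw [e, e, vc_il, il_vc]

theorem simages_equiv (σ : P ≃ P') (f' : P' → PropHom R T) {f : P → PropHom R T}
    (hf : ∀ p, f' (σ p) = f p) {n m : ℕ} {a : Fin n → R.Col} {b : Fin m → R.Col} (φ : R.Op a b) :
    simages f' φ = rel (Equiv.sigmaCongrRight fun _ => σ) (Equiv.sigmaCongrRight fun _ => σ)
      (pf fun s => congrArg (fun h => PropHom.col h (a s.1)) (hf s.2))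
      (pf fun s => congrArg (fun h => PropHom.col h (b s.1)) (hf s.2)) (simages f φ) := by
  obtain rfl : (fun p => f' (σ p)) = f := funext hf
  unfold simages images
  refine (congrArg _ (big_equiv σ _)).trans ((rel_rel ..).trans (Eq.trans ?_ (rel_rel ..).symm))
  exact rel_congr _ _ _ _ (images (fun p => f' (σ p)) φ) (fun _ => rfl) fun _ => rfl

theorem IsNatural.rel {f : P → PropHom R T} {g : Q → PropHom R T} {f' : P' → PropHom R T}
    {g' : Q' → PropHom R T} {ξ : ∀ c, T.Ext (fun p => (f p).col c) (fun q => (g q).col c)}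
    (σ : P ≃ P') (τ : Q ≃ Q') (hf : ∀ p, f' (σ p) = f p) (hg : ∀ q, g' (τ q) = g q)
    (hξ : IsNatural f g ξ) : IsNatural f' g' fun c => rel σ τ
      (pf fun p => congrArg (fun h => PropHom.col h c) (hf p))
      (pf fun p => congrArg (fun h => PropHom.col h c) (hg p)) (ξ c) := by
  rw [isNatural_iff] at *
  intro n m a b φ
  have e {n : ℕ} (a : Fin n → R.Col) : components (f := f') (g := g') (fun c => ColoredProp.rel σ τ
      (pf fun p => congrArg (fun h => PropHom.col h c) (hf p))
      (pf fun p => congrArg (fun h => PropHom.col h c) (hg p)) (ξ c)) a =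
      ColoredProp.rel (Equiv.sigmaCongrRight fun _ => σ) (Equiv.sigmaCongrRight fun _ => τ)
        (pf fun s => congrArg (fun h => PropHom.col h (a s.1)) (hf s.2))
        (pf fun s => congrArg (fun h => PropHom.col h (a s.1)) (hg s.2)) (components ξ a) :=
    big_rel (fun _ => σ) (fun _ => τ) _ _ _
  rw [e, e, simages_equiv σ f' hf, simages_equiv τ g' hg]
  refine (vc_rel _ _ _ _ _ _ _ _ (fun _ => rfl) _ _).trans ((congrArg _ (hξ φ)).trans
    (vc_rel _ _ _ _ _ _ _ _ (fun _ => rfl) _ _).symm)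

theorem simages_sum (f : P → PropHom R T) (f' : P' → PropHom R T)
    {n m : ℕ} {a : Fin n → R.Col} {b : Fin m → R.Col} (φ : R.Op a b) :
    simages (Sum.elim f f') φ = rel (Equiv.sigmaSumDistrib _ _).symm (Equiv.sigmaSumDistrib _ _).symm
      (pf <| by rintro (i | i) <;> rfl) (pf <| by rintro (i | i) <;> rfl)
      (hc (simages f φ) (simages f' φ)) := by
  unfold simages
  refine (congrArg _ (big_sum _)).trans ((rel_rel ..).trans
    (Eq.trans ?_ ((congrArg _ (hc_rel ..)).trans (rel_rel ..)).symm))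
  refine rel_congr _ _ _ _ (hc (images f φ) (images f' φ)) ?_ ?_ <;> rintro (i | i) <;> rfl

theorem IsNatural.hc {f : P → PropHom R T} {g : Q → PropHom R T} {f' : P' → PropHom R T}
    {g' : Q' → PropHom R T} {ξ : ∀ c, T.Ext (fun p => (f p).col c) (fun q => (g q).col c)}
    {ζ : ∀ c, T.Ext (fun p => (f' p).col c) (fun q => (g' q).col c)}
    (hξ : IsNatural f g ξ) (hζ : IsNatural f' g' ζ) :
    IsNatural (Sum.elim f f') (Sum.elim g g') fun c => ColoredProp.rel (Equiv.refl _) (Equiv.refl _)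
      (pf <| by rintro (i | i) <;> rfl) (pf <| by rintro (i | i) <;> rfl) (hc (ξ c) (ζ c)) := by
  rw [isNatural_iff] at *
  intro n m a b φ
  have e {n : ℕ} (a : Fin n → R.Col) : components (f := Sum.elim f f') (g := Sum.elim g g')
      (fun c => ColoredProp.rel (Equiv.refl _) (Equiv.refl _)
      (pf <| by rintro (i | i) <;> rfl) (pf <| by rintro (i | i) <;> rfl)
      (ColoredProp.hc (ξ c) (ζ c))) a =
      ColoredProp.rel (Equiv.sigmaSumDistrib _ _).symm (Equiv.sigmaSumDistrib _ _).symm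
        (pf <| by rintro (i | i) <;> rfl) (pf <| by rintro (i | i) <;> rfl)
        (ColoredProp.hc (components ξ a) (components ζ a)) := by
    refine (big_rel (fun _ => Equiv.refl _) (fun _ => Equiv.refl _) _ _ _).trans
      ((congrArg _ (big_hc _ _)).trans ((rel_rel ..).trans ?_))
    refine rel_congr _ _ _ _ (ColoredProp.hc (components ξ a) (components ζ a)) ?_ ?_ <;>
      rintro (i | i) <;> rfl
  rw [e, e, simages_sum, simages_sum]
  refine (vc_rel _ _ _ _ _ _ _ _ (fun _ => rfl) _ _).trans (Eq.trans (congrArg _ ?_)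
    (vc_rel _ _ _ _ _ _ _ _ (fun _ => rfl) _ _).symm)
  rw [← hc_vc, ← hc_vc, hξ, hζ]

end
end PropOperad

namespace PropOperad
open Listed ColoredProp

section
variable {R T : ColoredProp.{u}}

theorem hcomp_act_left {n n' m m' p q : ℕ} {a : Fin n → T.Col} {a₁ : Fin n' → T.Col}
    {b : Fin m → T.Col} {b₁ : Fin m' → T.Col} {a' : Fin p → T.Col} {b' : Fin q → T.Col}
    (σ : Fin n' ≃ Fin n) (τ : Fin m ≃ Fin m') (h : ∀ i, a₁ i = a (σ i))
    (k : ∀ i, b₁ i = b (τ.symm i)) (f : T.Op a b) (g : T.Op a' b') :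
    T.hcomp (T.act σ τ h k f) g = T.act (blockSum σ (Equiv.refl _)) (blockSum τ (Equiv.refl _))
      (append_blockSum h (reflIn fun _ => rfl)) (append_blockSum_symm k (reflOut fun _ => rfl))
      (T.hcomp f g) :=
  (congrArg _ (T.act_refl g).symm).trans (T.act_hcomp ..)

theorem hcomp_act_right {n n' m m' p q : ℕ} {a : Fin n → T.Col} {a₁ : Fin n' → T.Col}
    {b : Fin m → T.Col} {b₁ : Fin m' → T.Col} {a' : Fin p → T.Col} {b' : Fin q → T.Col}
    (σ : Fin n' ≃ Fin n) (τ : Fin m ≃ Fin m') (h : ∀ i, a₁ i = a (σ i))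
    (k : ∀ i, b₁ i = b (τ.symm i)) (f : T.Op a b) (g : T.Op a' b') :
    T.hcomp g (T.act σ τ h k f) = T.act (blockSum (Equiv.refl _) σ) (blockSum (Equiv.refl _) τ)
      (append_blockSum (reflIn fun _ => rfl) h) (append_blockSum_symm (reflOut fun _ => rfl) k)
      (T.hcomp g f) :=
  (congrArg (fun x => T.hcomp x _) (T.act_refl g).symm).trans (T.act_hcomp ..)

theorem IsNatural.congr {P Q : Type} [Listed P] [Listed Q] {f : P → PropHom R T}
    {g : Q → PropHom R T} {ξ ζ : ∀ c, T.Ext (fun p => (f p).col c) (fun q => (g q).col c)}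
    (h : IsNatural f g ξ) (e : ∀ c, ξ c = ζ c) : IsNatural f g ζ := by
  obtain rfl : ξ = ζ := funext e
  exact h

theorem isNatural_act {p p' q q' : ℕ} {f : Fin p → PropHom R T} {f' : Fin p' → PropHom R T}
    {g : Fin q → PropHom R T} {g' : Fin q' → PropHom R T} (σ : Fin p' ≃ Fin p)
    (τ : Fin q ≃ Fin q') (hf : ∀ i, f' i = f (σ i)) (hg : ∀ i, g' i = g (τ.symm i))
    {ξ : ∀ c, T.Op (fun p => (f p).col c) (fun q => (g q).col c)} (h : IsNatural f g ξ) :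
    IsNatural f' g' fun c => T.act
      (a' := fun i => (f' i).col c) (b' := fun i => (g' i).col c)
      (a := fun i => (f i).col c) (b := fun i => (g i).col c) σ τ (pf fun i => congrArg (fun h => PropHom.col h c) (hf i))
      (pf fun i => congrArg (fun h => PropHom.col h c) (hg i)) (ξ c) := by
  refine IsNatural.congr (h.rel (f' := f') (g' := g') σ.symm τ ?_ ?_) fun c => ?_
  · exact fun i => (hf _).trans (congrArg f (σ.apply_symm_apply i))
  · exact fun i => (hg _).trans (congrArg g (τ.symm_apply_apply i))
  · exact T.act_congr _ _ _ _ (fun _ => rfl) (fun _ => rfl) _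

theorem isNatural_inp {p p' q : ℕ} {f : Fin p → PropHom R T} {f' : Fin p' → PropHom R T}
    {g : Fin q → PropHom R T} (σ : Fin p' ≃ Fin p) (hf : ∀ i, f' i = f (σ i))
    {ξ : ∀ c, T.Op (fun p => (f p).col c) (fun q => (g q).col c)} (h : IsNatural f g ξ) :
    IsNatural f' g fun c => T.inp
      (a' := fun i => (f' i).col c) (a := fun i => (f i).col c) σ (pf fun i => congrArg (fun h => PropHom.col h c) (hf i))
      (ξ c) := by
  refine IsNatural.congr (isNatural_act σ (Equiv.refl _) hf (fun _ => rfl) h) fun c => ?_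
  exact congrArg _ (T.laws.out_refl _)

theorem isNatural_out {p q q' : ℕ} {f : Fin p → PropHom R T}
    {g : Fin q → PropHom R T} {g' : Fin q' → PropHom R T}
    (τ : Fin q ≃ Fin q') (hg : ∀ i, g' i = g (τ.symm i))
    {ξ : ∀ c, T.Op (fun p => (f p).col c) (fun q => (g q).col c)} (h : IsNatural f g ξ) :
    IsNatural f g' fun c => T.out (b' := fun i => (g' i).col c)
      (b := fun i => (g i).col c) τ
      (pf fun i => congrArg (fun h => PropHom.col h c) (hg i)) (ξ c) := by
  refine IsNatural.congr (isNatural_act (Equiv.refl _) τ (fun _ => rfl) hg h) fun c => ?_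
  exact T.laws.inp_refl _

theorem enum_finSum {p p' : ℕ} (i : Fin (p + p')) :
    (@enum (Fin p ⊕ Fin p') _) i = finSumFinEquiv.symm i := by
  change Sum.map _root_.id _root_.id _ = _
  simp

theorem isNatural_hcomp {p q p' q' : ℕ} {f : Fin p → PropHom R T} {f' : Fin p' → PropHom R T}
    {g : Fin q → PropHom R T} {g' : Fin q' → PropHom R T}
    {ξ : ∀ c, T.Op (fun p => (f p).col c) (fun q => (g q).col c)}
    {ζ : ∀ c, T.Op (fun p => (f' p).col c) (fun q => (g' q).col c)} (h : IsNatural f g ξ)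
    (h' : IsNatural f' g' ζ) :
    IsNatural (Fin.append f f') (Fin.append g g') fun c => T.act (a' := fun i => (Fin.append f f' i).col c)
      (b' := fun i => (Fin.append g g' i).col c) (Equiv.refl _) (Equiv.refl _)
      (reflIn (append_map (fun h => PropHom.col h c) f f'))
      (reflOut (append_map (fun h => PropHom.col h c) g g')) (T.hcomp (ξ c) (ζ c)) := by
  refine IsNatural.congr ((h.hc h').rel (f' := Fin.append f f') (g' := Fin.append g g')
    finSumFinEquiv finSumFinEquiv ?_ ?_) fun c => ?_
  · rintro (i | i)
    · exact Fin.append_left f f' i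
    · exact Fin.append_right f f' i
  · rintro (i | i)
    · exact Fin.append_left g g' i
    · exact Fin.append_right g g' i
  · refine (rel_rel ..).trans ((T.act_act ..).trans ?_)
    refine T.act_congr _ _ _ _ (fun i => ?_) (fun i => ?_) _
    · exact ((Equiv.symm_apply_eq (@enum (Fin p ⊕ Fin p') _)).2 (enum_finSum i).symm)
    · exact (Equiv.eq_symm_apply finSumFinEquiv).1 (enum_finSum (p := q) (p' := q') i)

/-- The set of natural transformations between lists of maps. -/
def NatTrans {p q : ℕ} (f : Fin p → PropHom R T) (g : Fin q → PropHom R T) : Type u :=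
  {ξ : ∀ c, T.Op (fun i => (f i).col c) (fun j => (g j).col c) // IsNatural f g ξ}

variable (R T) in
/-- The data of the mapping prop: its colours are the maps `R → T`, its operations are the natural
transformations, and the structure is that of `T` at each colour of `R`. -/
def propHomData : PropData.{u} where
  Col := PropHom R T
  Op f g := NatTrans f g
  id f := ⟨fun c => T.id (f.col c),
    (isNatural_il fun _ : Fin 1 => f).congr fun c => il_one (f.col c)⟩
  unit := ⟨fun c => T.act (Equiv.refl _) (Equiv.refl _) (reflIn fun i => i.elim0)
    (reflOut fun i => i.elim0) T.unit, isNatural_il Fin.elim0⟩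
  vcomp ξ ζ := ⟨fun c => T.vcomp (ξ.1 c) (ζ.1 c), ξ.2.vc ζ.2⟩
  hcomp ξ ζ := ⟨_, isNatural_hcomp ξ.2 ζ.2⟩
  inp σ h ξ := ⟨_, isNatural_inp σ h ξ.2⟩
  out τ h ξ := ⟨_, isNatural_out τ h ξ.2⟩

theorem idList_propHom {p : ℕ} (f : Fin p → PropHom R T) (c : R.Col) :
    ((propHomData R T).idList f).1 c = T.idList fun i => (f i).col c := by
  induction p with
  | zero => exact (T.act_act ..).trans (T.act_congr _ _ _ _ (fun _ => rfl) (fun _ => rfl) _)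
  | succ p ih =>
    have := ih fun i => f i.castSucc
    refine (congrArg (T.act _ _ _ _) (congrArg (T.act _ _ _ _) (congrArg (fun x => T.hcomp x _)
      this))).trans ?_
    exact (T.act_act ..).trans (T.act_congr _ _ _ _ (fun _ => rfl) (fun _ => rfl) _)

theorem propHom_act {p q p' q' : ℕ} {f : Fin p → PropHom R T} {f' : Fin p' → PropHom R T}
    {g : Fin q → PropHom R T} {g' : Fin q' → PropHom R T} (σ : Fin p' ≃ Fin p)
    (τ : Fin q ≃ Fin q') (hf : ∀ i, f' i = f (σ i)) (hg : ∀ i, g' i = g (τ.symm i))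
    (ξ : NatTrans f g) (c : R.Col) : ((propHomData R T).act σ τ hf hg ξ).1 c =
      T.act σ τ (pf fun i => congrArg (fun h => PropHom.col h c) (hf i))
        (pf fun i => congrArg (fun h => PropHom.col h c) (hg i)) (ξ.1 c) := rfl

theorem isProp_propHom : IsProp (propHomData R T) where
  vcomp_assoc f g h := Subtype.ext (funext fun c => T.laws.vcomp_assoc _ _ _)
  vcomp_idList f := Subtype.ext (funext fun c =>
    (congrArg _ (idList_propHom _ c)).trans (T.laws.vcomp_idList _))
  idList_vcomp f := Subtype.ext (funext fun c =>
    (congrArg (fun x => T.vcomp x _) (idList_propHom _ c)).trans (T.laws.idList_vcomp _))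
  hcomp_assoc f g h := Subtype.ext (funext fun c => by
    refine (congrArg (T.act _ _ _ _) ((hcomp_act_left ..).trans
      (congrArg _ (T.laws.hcomp_assoc _ _ _)))).trans
      (Eq.trans ?_ (congrArg (T.act _ _ _ _) (congrArg (T.act _ _ _ _) (hcomp_act_right ..))).symm)
    refine ((congrArg _ (T.act_act ..)).trans (T.act_act ..)).trans
      (Eq.trans ?_ ((congrArg _ (T.act_act ..)).trans (T.act_act ..)).symm)
    refine T.act_congr _ _ _ _ ?_ ?_ _ <;> intro i <;> simp only [blockSum_refl] <;> rfl)
  unit_hcomp f := Subtype.ext (funext fun c => by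
    refine (congrArg (T.act _ _ _ _) ((hcomp_act_left ..).trans
      (congrArg _ (T.laws.unit_hcomp _)))).trans ?_
    refine ((congrArg _ (T.act_act ..)).trans (T.act_act ..)).trans ?_
    refine T.act_congr _ _ _ _ ?_ ?_ _ <;> intro i <;> simp only [blockSum_refl] <;> rfl)
  hcomp_unit f := Subtype.ext (funext fun c => by
    refine (congrArg (T.act _ _ _ _) ((hcomp_act_right ..).trans
      (congrArg _ (T.laws.hcomp_unit _)))).trans ?_
    refine ((congrArg _ (T.act_act ..)).trans (T.act_act ..)).trans ?_
    refine T.act_congr _ _ _ _ ?_ ?_ _ <;> intro i <;> simp only [blockSum_refl] <;> rfl)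
  interchange f g f' g' := Subtype.ext (funext fun c =>
    (congrArg _ (T.laws.interchange _ _ _ _)).trans
      (T.vcomp_act _ _ _ _ _ _ _ _ (fun _ => rfl) _ _).symm)
  vcomp_out σ h h' f g := Subtype.ext (funext fun c => T.laws.vcomp_out _ _ _ _ _)
  inp_vcomp σ h f g := Subtype.ext (funext fun c => T.laws.inp_vcomp _ _ _ _)
  out_vcomp τ h f g := Subtype.ext (funext fun c => T.laws.out_vcomp _ _ _ _)
  inp_hcomp σ h σ' h' f g := Subtype.ext (funext fun c => by
    refine (congrArg (T.act _ _ _ _) ((T.laws.inp_hcomp _ _ _ _ _ _).trans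
      (congrArg (T.inp _ _) (T.laws.out_refl _).symm))).trans
      ((T.act_act ..).trans (Eq.trans ?_ ((congrArg (T.inp _ _) (T.laws.out_refl _).symm).trans
        (T.act_act ..)).symm))
    exact T.act_congr _ _ _ _ (fun _ => rfl) (fun _ => rfl) _)
  out_hcomp τ h τ' h' f g := Subtype.ext (funext fun c => by
    refine (congrArg (T.act _ _ _ _) ((T.laws.out_hcomp _ _ _ _ _ _).trans
      (T.laws.inp_refl _).symm)).trans
      ((T.act_act ..).trans (Eq.trans ?_ ((T.laws.inp_refl _).symm.trans
        (T.act_act ..)).symm))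
    exact T.act_congr _ _ _ _ (fun _ => rfl) (fun _ => rfl) _)
  hcomp_swap f g := Subtype.ext (funext fun c => by
    refine (T.act_act ..).trans (Eq.trans ?_ ((congrArg (T.act _ _ _ _)
      (T.laws.hcomp_swap _ _).symm).trans (T.act_act ..)).symm)
    exact T.act_congr _ _ _ _ (fun _ => rfl) (fun _ => rfl) _)
  inp_out σ h τ h' f := Subtype.ext (funext fun c => T.laws.inp_out _ _ _ _ _)
  inp_refl f := Subtype.ext (funext fun c => T.laws.inp_refl _)
  out_refl f := Subtype.ext (funext fun c => T.laws.out_refl _)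
  inp_inp σ h σ' h' f := Subtype.ext (funext fun c => T.laws.inp_inp _ _ _ _ _)
  out_out σ h σ' h' f := Subtype.ext (funext fun c => T.laws.out_out _ _ _ _ _)

variable (R T) in
/-- The mapping prop. -/
def propHom : ColoredProp.{u} := ⟨propHomData R T, isProp_propHom⟩

end
end PropOperad

namespace PropOperad
open Listed ColoredOperad

section
variable {O M : ColoredOperad.{u}} {P P' Q : Type} [Listed P] [Listed P'] [Listed Q]

/-- A family `ξ_c : ⟨f_j c⟩_j → g c` is a natural transformation of operad maps if for every
`φ : ⟨a_i⟩_i → b` one has `γ(g φ, ⟨ξ_{a_i}⟩_i) = γ(ξ_b, ⟨f_j φ⟩_j)` up to the interchange of two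
indices. -/
def IsOperadNatural (f : P → OperadHom O M) (g : OperadHom O M)
    (ξ : ∀ c, M.Ext (fun p => (f p).col c) (g.col c)) : Prop :=
  ∀ ⦃n : ℕ⦄ ⦃a : Fin n → O.Col⦄ ⦃b : O.Col⦄ (φ : O.Op a b),
    cp (J := Fin n) (I := fun _ => P) (b := fun i => g.col (a i)) (a := fun i p => (f p).col (a i))
        (g.map φ) (fun i => ξ (a i)) =
      rel (a := fun s : Σ _ : P, Fin n => (f s.1).col (a s.2))
        (a' := fun s : Σ _ : Fin n, P => (f s.2).col (a s.1)) (sigmaSwap P (Fin n))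
        (pf fun _ => rfl) rfl
        (cp (J := P) (I := fun _ => Fin n) (b := fun p => (f p).col b)
          (a := fun p i => (f p).col (a i)) (ξ b) (fun p => (f p).map φ))

theorem IsOperadNatural.congr {f : P → OperadHom O M} {g : OperadHom O M}
    {ξ ζ : ∀ c, M.Ext (fun p => (f p).col c) (g.col c)}
    (h : IsOperadNatural f g ξ) (e : ∀ c, ξ c = ζ c) : IsOperadNatural f g ζ := by
  obtain rfl : ξ = ζ := funext e
  exact h

theorem IsOperadNatural.rel {f : P → OperadHom O M} {f' : P' → OperadHom O M} {g : OperadHom O M}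
    {ξ : ∀ c, M.Ext (fun p => (f p).col c) (g.col c)} (σ : P ≃ P')
    (hf : ∀ p, f' (σ p) = f p) (h : IsOperadNatural f g ξ) :
    IsOperadNatural f' g fun c => rel (a' := fun p => (f' p).col c) σ
      (pf fun p => congrArg (fun h => OperadHom.col h c) (hf p)) rfl (ξ c) := by
  obtain rfl : (fun p => f' (σ p)) = f := funext hf
  intro n a b φ
  refine (cp_rel (J := Fin n) (a := fun i p => (f' (σ p)).col (a i))
    (a' := fun i p => (f' p).col (a i)) (fun _ => σ) (fun _ _ => rfl) (g.map φ)
    fun i => ξ (a i)).trans ?_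
  refine (congrArg _ (h φ)).trans ?_
  refine Eq.trans ?_ (congrArg _ (rel_cp_left (b := fun p => (f' p).col b)
    (a := fun p i => (f' p).col (a i)) σ (ξ b) fun p => (f' p).map φ)).symm
  refine (rel_rel ..).trans (Eq.trans ?_ (rel_rel ..).symm)
  exact ColoredOperad.rel_congr _ _ _ _ _ fun _ => rfl

theorem isOperadNatural_id (f : OperadHom O M) :
    IsOperadNatural (fun _ : Fin 1 => f) f fun c => M.id (f.col c) := by
  intro n a b φ
  refine (cp_id (b := fun i => f.col (a i)) (f.map φ)).trans
    (Eq.trans ?_ (congrArg _ (id_cp (b := fun i => f.col (a i)) (f.map φ))).symm)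
  refine Eq.trans ?_ (rel_rel ..).symm
  refine ColoredOperad.rel_congr (a := fun i => f.col (a i)) _ _ _ _ (f.map φ) fun _ => rfl

theorem IsOperadNatural.cp {I : Q → Type} [∀ q, Listed (I q)] {f : ∀ q, I q → OperadHom O M}
    {h : Q → OperadHom O M} {g : OperadHom O M}
    {ξ : ∀ c, M.Ext (fun p => (h p).col c) (g.col c)}
    {ζ : ∀ q c, M.Ext (fun p => (f q p).col c) ((h q).col c)}
    (hξ : IsOperadNatural h g ξ) (hζ : ∀ q, IsOperadNatural (f q) (h q) (ζ q)) :
    IsOperadNatural (fun s : Σ q, I q => f s.1 s.2) g fun c =>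
      cp (b := fun p => (h p).col c) (a := fun q p => (f q p).col c) (ξ c) fun q => ζ q c := by
  intro n a b φ
  have e1 := cp_assoc (J := Fin n) (I := fun _ => Q) (M := fun _ q => I q)
    (b := fun i => g.col (a i)) (a := fun i q => (h q).col (a i))
    (d := fun i q p => (f q p).col (a i)) (g.map φ) (fun i => ξ (a i)) fun i q => ζ q (a i)
  have e2 := rel_cp_left (J := Σ _ : Q, Fin n) (Q := Σ _ : Fin n, Q) (I := fun s => I s.2)
    (b := fun s => (h s.2).col (a s.1)) (a := fun s p => (f s.2 p).col (a s.1))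
    (sigmaSwap Q (Fin n)) (ColoredOperad.cp (J := Q) (I := fun _ => Fin n)
      (b := fun p => (h p).col b)
      (a := fun p i => (h p).col (a i)) (ξ b) (fun p => (h p).map φ)) fun s => ζ s.2 (a s.1)
  have e3 := cp_assoc (J := Q) (I := fun _ => Fin n) (M := fun q _ => I q)
    (b := fun q => (h q).col b) (a := fun q i => (h q).col (a i))
    (d := fun q i p => (f q p).col (a i)) (ξ b) (fun q => (h q).map φ) fun q i => ζ q (a i)
  have e4 := cp_rel (J := Q) (I := fun q => Σ _ : I q, Fin n) (I' := fun q => Σ _ : Fin n, I q)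
    (b := fun q => (h q).col b) (a := fun q s => (f q s.1).col (a s.2))
    (a' := fun q s => (f q s.2).col (a s.1)) (fun q => sigmaSwap (I q) (Fin n))
    (fun _ _ => rfl) (ξ b) fun q => ColoredOperad.cp (J := I q) (I := fun _ => Fin n)
      (b := fun p => (f q p).col b) (a := fun p i => (f q p).col (a i)) (ζ q b)
      fun p => (f q p).map φ
  have e5 := cp_assoc (J := Q) (I := I) (M := fun _ _ => Fin n)
    (b := fun q => (h q).col b) (a := fun q p => (f q p).col b)
    (d := fun q p i => (f q p).col (a i)) (ξ b) (fun q => ζ q b) fun q p => (f q p).map φ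
  have e6 : (fun q => ColoredOperad.cp (J := Fin n) (I := fun _ => I q)
      (b := fun i => (h q).col (a i)) (a := fun i p => (f q p).col (a i)) ((h q).map φ)
      fun i => ζ q (a i)) = _ := funext fun q => hζ q φ
  have e7 := e1.symm.trans ((congrArg (fun x => ColoredOperad.cp x _) (hξ φ)).trans
    (e2.trans (congrArg _ (e3.trans (congrArg _ ((congrArg _ e6).trans e4))))))
  have e8 := congrArg (ColoredOperad.rel (c' := g.col b)
    (a' := fun s : Σ _ : Fin n, Σ q, I q => (f s.2.1 s.2.2).col (a s.1))
    (Equiv.sigmaAssoc fun (_ : Fin n) (q : Q) => I q) (pf fun _ => rfl) rfl) e7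
  refine Eq.trans ?_ (e8.trans (Eq.trans ?_ (congrArg _ e5).symm))
  · exact ((rel_rel ..).trans (rel_id _ _ _ fun _ => rfl)).symm
  · refine ((congrArg _ ((congrArg _ (rel_rel ..)).trans (rel_rel ..))).trans (rel_rel ..)).trans
      (Eq.trans ?_ (rel_rel ..).symm)
    exact ColoredOperad.rel_congr _ _ _ _ _ fun _ => rfl

end
end PropOperad

namespace PropOperad
open Listed ColoredOperad

section
variable {O M : ColoredOperad.{u}}

theorem isOperadNatural_perm {p p' : ℕ} {f : Fin p → OperadHom O M} {f' : Fin p' → OperadHom O M}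
    {g : OperadHom O M} (σ : Fin p' ≃ Fin p) (hf : ∀ i, f' i = f (σ i))
    {ξ : ∀ c, M.Op (fun p => (f p).col c) (g.col c)} (h : IsOperadNatural f g ξ) :
    IsOperadNatural f' g fun c => M.perm (a := fun i => (f i).col c)
      (a' := fun i => (f' i).col c) σ
      (pf fun i => congrArg (fun h => OperadHom.col h c) (hf i)) (ξ c) := by
  refine IsOperadNatural.congr (h.rel (f' := f') σ.symm ?_) fun c => ?_
  · exact fun i => (hf _).trans (congrArg f (σ.apply_symm_apply i))
  · exact perm_congr _ _ (fun _ => rfl) _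

theorem isOperadNatural_comp {n : ℕ} {p : Fin n → ℕ} {f : ∀ i, Fin (p i) → OperadHom O M}
    {h : Fin n → OperadHom O M} {g : OperadHom O M} {ξ : ∀ c, M.Op (fun i => (h i).col c) (g.col c)}
    {ζ : ∀ i c, M.Op (fun j => (f i j).col c) ((h i).col c)}
    (hξ : IsOperadNatural h g ξ) (hζ : ∀ i, IsOperadNatural (f i) (h i) (ζ i)) :
    IsOperadNatural (flat f) g fun c =>
      M.comp (p := p) (b := fun i j => (f i j).col c) (ξ c) fun i => ζ i c := by
  refine IsOperadNatural.congr ((hξ.cp (I := fun i => Fin (p i)) (f := f) hζ).rel (f' := flat f) finSigmaFinEquiv ?_) fun c => ?_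
  · exact fun s => congrArg (fun s : Σ i, Fin (p i) => f s.1 s.2)
      (finSigmaFinEquiv.symm_apply_apply s)
  · refine (perm_congr _ _ (fun i => ?_) _).trans (M.perm_refl _)
    exact (Equiv.symm_apply_eq (finSigmaFinEquiv (n := p)).symm).2 rfl

/-- The set of natural transformations from a list of operad maps to an operad map. -/
def OperadNatTrans {p : ℕ} (f : Fin p → OperadHom O M) (g : OperadHom O M) : Type u :=
  {ξ : ∀ c, M.Op (fun i => (f i).col c) (g.col c) // IsOperadNatural f g ξ}

variable (O M) in
/-- The internal hom of operads: its colours are the maps `O → M`, its operations are the natural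
transformations, and the structure is that of `M` at each colour of `O`. -/
def operadHom : ColoredOperad.{u} where
  Col := OperadHom O M
  Op f g := OperadNatTrans f g
  id f := ⟨fun c => M.id (f.col c), isOperadNatural_id f⟩
  perm σ h ξ := ⟨_, isOperadNatural_perm σ h ξ.2⟩
  comp ξ ζ := ⟨_, isOperadNatural_comp ξ.2 fun i => (ζ i).2⟩
  perm_refl f := Subtype.ext (funext fun c => M.perm_refl _)
  perm_perm σ h σ' h' f := Subtype.ext (funext fun c => M.perm_perm _ _ _ _ _)
  id_comp f := Subtype.ext (funext fun c => M.id_comp _)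
  comp_id f := Subtype.ext (funext fun c => M.comp_id _)
  assoc f g h := Subtype.ext (funext fun c => M.assoc (f.1 c)
    (fun i => (g i).1 c) fun i j => (h i j).1 c)
  perm_comp σ f g := Subtype.ext (funext fun c => M.perm_comp σ (f.1 c)
    fun i => (g i).1 c)
  comp_perm σ h f g := Subtype.ext (funext fun c => M.comp_perm σ
    (fun i j => congrArg (fun x => OperadHom.col x c) (h i j)) (f.1 c) fun i => (g i).1 c)

end
end PropOperad

namespace PropOperad
open Listed ColoredOperad

theorem ColoredOperad.cp_rel_rel {O : ColoredOperad.{u}} {J Q : Type} [Listed J] [Listed Q]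
    {I : J → Type} {I' : Q → Type} [∀ j, Listed (I j)] [∀ q, Listed (I' q)] {b : J → O.Col}
    {b' : Q → O.Col} {c c' : O.Col} {a : ∀ j, I j → O.Col} {a' : ∀ q, I' q → O.Col} (σ : J ≃ Q)
    (hb : ∀ j, b' (σ j) = b j) (hc : c' = c) (ε : ∀ j, I j ≃ I' (σ j))
    (ha : ∀ j i, a' (σ j) (ε j i) = a j i) (g : O.Ext b c) (f : ∀ j, O.Ext (a j) (b j))
    (f' : ∀ q, O.Ext (a' q) (b' q)) (hf : ∀ j, f' (σ j) = rel (ε j) (ha j) (hb j) (f j)) :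
    cp (rel σ hb hc g) f' = rel (a := fun s : Σ j, I j => a s.1 s.2)
      (a' := fun s : Σ q, I' q => a' s.1 s.2)
      ((Equiv.sigmaCongrRight ε).trans (Equiv.sigmaCongrLeft σ)) (pf fun s => ha s.1 s.2) hc
      (cp g f) := by
  subst hc
  obtain rfl : (fun j => b' (σ j)) = b := funext hb
  refine (rel_cp_left σ g f').trans ?_
  have e : (fun j => f' (σ j)) = fun j => rel (ε j) (ha j) rfl (f j) := funext hf
  rw [e]
  refine (congrArg _ (cp_rel ε ha g f)).trans (rel_rel ..)

/-- The free prop on an operad: an operation from `⟨a_i⟩_i` to `⟨b_j⟩_j` is a function `θ` from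
the inputs to the outputs, with an operation `⟨a_i⟩_{θ i = j} → b_j` for each `j`. -/
structure FreeOp (O : ColoredOperad.{u}) {I J : Type} [Listed I] (a : I → O.Col)
    (b : J → O.Col) : Type u where
  fn : I → J
  op : ∀ j, O.Ext (fun i : {i // fn i = j} => a i) (b j)

namespace FreeOp
variable {O : ColoredOperad.{u}}
variable {I I' I'' J J' J'' K K' L L' : Type} [Listed I] [Listed I'] [Listed I''] [Listed J]
  [Listed J'] [Listed J''] [Listed K] [Listed K'] [Listed L] [Listed L']

theorem ext' {a : I → O.Col} {b : J → O.Col} {x y : FreeOp O a b} (h : ∀ i, x.fn i = y.fn i)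
    (h' : ∀ j, y.op j = rel (Equiv.subtypeEquivRight fun i => by rw [h i]) (pf fun _ => rfl) rfl (x.op j)) :
    x = y := by
  obtain ⟨θ, f⟩ := x
  obtain ⟨θ', f'⟩ := y
  obtain rfl : θ = θ' := funext h
  refine congrArg (FreeOp.mk θ) (funext fun j => ?_)
  exact (rel_id _ _ _ fun _ => rfl).symm.trans (h' j).symm

theorem fib {a : I → O.Col} {b : J → O.Col} (x : FreeOp O a b) {j j' : J} (h : j = j')
    {a' : K → O.Col} {c : O.Col} (E : {i // x.fn i = j} ≃ K) (E' : {i // x.fn i = j'} ≃ K)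
    (ha : ∀ i, a' (E i) = a i) (ha' : ∀ i, a' (E' i) = a i) (hc : c = b j) (hc' : c = b j')
    (hE : ∀ i h h', E ⟨i, h⟩ = E' ⟨i, h'⟩) : rel E ha hc (x.op j) = rel E' ha' hc' (x.op j') := by
  subst h
  exact ColoredOperad.rel_congr _ _ _ _ _ fun i => hE _ _ _

/-- Relabelling of inputs and outputs. -/
noncomputable def frel {a : I → O.Col} {a' : I' → O.Col} {b : J → O.Col} {b' : J' → O.Col} (σ : I ≃ I')
    (τ : J ≃ J') (ha : ∀ i, a' (σ i) = a i) (hb : ∀ j, b' (τ j) = b j) (x : FreeOp O a b) :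
    FreeOp O a' b' :=
  ⟨fun i => τ (x.fn (σ.symm i)), fun j =>
    rel (a := fun i : {i // x.fn i = τ.symm j} => a i)
      (σ.subtypeEquiv fun i => by rw [σ.symm_apply_apply, Equiv.eq_symm_apply]) (pf fun i => ha i)
      (by rw [← hb, τ.apply_symm_apply]) (x.op (τ.symm j))⟩

/-- The iterated fibres of a composite function. -/
noncomputable def fibEquiv (φ : J → K) (θ : I → J) (k : K) :
    (Σ j : {j // φ j = k}, {i // θ i = j.1}) ≃ {i // φ (θ i) = k} where
  toFun s := ⟨s.2.1, by rw [s.2.2, s.1.2]⟩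
  invFun i := ⟨⟨θ i, i.2⟩, ⟨i, rfl⟩⟩
  left_inv := by
    rintro ⟨⟨j, h⟩, i, h'⟩
    dsimp only at h'
    subst h'
    rfl
  right_inv _ := rfl

/-- Vertical composition. -/
noncomputable def fvc {a : I → O.Col} {b : J → O.Col} {c : K → O.Col} (x : FreeOp O b c) (y : FreeOp O a b) :
    FreeOp O a c :=
  ⟨fun i => x.fn (y.fn i), fun k =>
    rel (a := fun s : Σ j : {j // x.fn j = k}, {i // y.fn i = j.1} => a s.2) (fibEquiv x.fn y.fn k)
      (pf fun _ => rfl) rfl (cp (b := fun j : {j // x.fn j = k} => b j)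
        (a := fun j (i : {i // y.fn i = j.1}) => a i) (x.op k) fun j => y.op j.1)⟩

/-- The fibres of a sum of two functions. -/
def fibInl (θ : I → J) (θ' : I' → J') (j : J) :
    {i // θ i = j} ≃ {i // Sum.map θ θ' i = Sum.inl j} where
  toFun i := ⟨.inl i.1, congrArg Sum.inl i.2⟩
  invFun := fun
    | ⟨.inl i, h⟩ => ⟨i, Sum.inl_injective h⟩
    | ⟨.inr i, h⟩ => (Sum.inr_ne_inl h).elim
  left_inv := fun _ => rfl
  right_inv := by rintro ⟨i | i, h⟩ <;> first | rfl | cases h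

/-- The fibres of a sum of two functions. -/
def fibInr (θ : I → J) (θ' : I' → J') (j : J') :
    {i // θ' i = j} ≃ {i // Sum.map θ θ' i = Sum.inr j} where
  toFun i := ⟨.inr i.1, congrArg Sum.inr i.2⟩
  invFun := fun
    | ⟨.inr i, h⟩ => ⟨i, Sum.inr_injective h⟩
    | ⟨.inl i, h⟩ => (Sum.inl_ne_inr h).elim
  left_inv := fun _ => rfl
  right_inv := by rintro ⟨i | i, h⟩ <;> first | rfl | cases h

/-- Horizontal composition. -/
noncomputable def fhc {a : I → O.Col} {b : J → O.Col} {a' : I' → O.Col} {b' : J' → O.Col}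
    (x : FreeOp O a b) (y : FreeOp O a' b') : FreeOp O (Sum.elim a a') (Sum.elim b b') where
  fn := Sum.map x.fn y.fn
  op
    | .inl j => rel (a := fun i : {i // x.fn i = j} => a i) (fibInl x.fn y.fn j)
        (pf fun _ => rfl) rfl (x.op j)
    | .inr j => rel (a := fun i : {i // y.fn i = j} => a' i) (fibInr x.fn y.fn j)
        (pf fun _ => rfl) rfl (y.op j)

/-- The fibres of the identity function. -/
noncomputable def fibId (j : J) : Fin 1 ≃ {i // i = j} where
  toFun _ := ⟨j, rfl⟩
  invFun _ := 0
  left_inv _ := Subsingleton.elim _ _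
  right_inv _ := Subsingleton.elim _ _

/-- The identity of a list. -/
noncomputable def fil (a : J → O.Col) : FreeOp O a a :=
  ⟨fun i => i, fun j => rel (a := fun _ : Fin 1 => a j) (fibId j)
    (pf fun _ => rfl) rfl (O.id (a j))⟩

theorem frel_congr {a : I → O.Col} {a' : I' → O.Col} {b : J → O.Col} {b' : J' → O.Col}
    {σ σ' : I ≃ I'} {τ τ' : J ≃ J'} (ha : ∀ i, a' (σ i) = a i) (hb : ∀ j, b' (τ j) = b j)
    (ha' : ∀ i, a' (σ' i) = a i) (hb' : ∀ j, b' (τ' j) = b j) (x : FreeOp O a b)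
    (hσ : ∀ i, σ i = σ' i) (hτ : ∀ i, τ i = τ' i) : frel σ τ ha hb x = frel σ' τ' ha' hb' x := by
  obtain rfl := Equiv.ext hσ
  obtain rfl := Equiv.ext hτ
  rfl

theorem frel_frel {a : I → O.Col} {a' : I' → O.Col} {a'' : I'' → O.Col} {b : J → O.Col}
    {b' : J' → O.Col} {b'' : J'' → O.Col} (σ : I ≃ I') (τ : J ≃ J')
    (ha : ∀ i, a' (σ i) = a i) (hb : ∀ j, b' (τ j) = b j) (σ' : I' ≃ I'') (τ' : J' ≃ J'')
    (ha' : ∀ i, a'' (σ' i) = a' i) (hb' : ∀ j, b'' (τ' j) = b' j) (x : FreeOp O a b) :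
    frel σ' τ' ha' hb' (frel σ τ ha hb x) = frel (σ.trans σ') (τ.trans τ')
      (fun i => by rw [Equiv.trans_apply, ha', ha]) (fun i => by rw [Equiv.trans_apply, hb', hb])
      x := by
  refine ext' (fun _ => rfl) fun j => ?_
  dsimp only [frel]
  refine Eq.symm ((congrArg _ (rel_rel ..)).trans ((rel_rel ..).trans ?_))
  exact ColoredOperad.rel_congr _ _ _ _ (x.op _) fun _ => rfl

theorem frel_id {a : I → O.Col} {b : J → O.Col} {σ : I ≃ I} {τ : J ≃ J}
    (ha : ∀ i, a (σ i) = a i) (hb : ∀ j, b (τ j) = b j) (x : FreeOp O a b)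
    (hσ : ∀ i, σ i = i) (hτ : ∀ i, τ i = i) : frel σ τ ha hb x = x := by
  obtain rfl : σ = Equiv.refl _ := Equiv.ext hσ
  obtain rfl : τ = Equiv.refl _ := Equiv.ext hτ
  refine ext' (fun _ => rfl) fun j => ?_
  dsimp only [frel]
  refine Eq.symm ((rel_rel ..).trans ?_)
  exact rel_id _ _ _ fun _ => rfl

theorem fvc_frel {a : I → O.Col} {a' : I' → O.Col} {b : J → O.Col} {b' : J' → O.Col}
    {c : K → O.Col} {c' : K' → O.Col} (σ : I ≃ I') (τ τ' : J ≃ J') (ρ : K ≃ K')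
    (ha : ∀ i, a' (σ i) = a i) (hb : ∀ j, b' (τ j) = b j) (hb' : ∀ j, b' (τ' j) = b j)
    (hc : ∀ k, c' (ρ k) = c k) (hτ : ∀ i, τ i = τ' i) (x : FreeOp O b c) (y : FreeOp O a b) :
    fvc (frel τ ρ hb hc x) (frel σ τ' ha hb' y) = frel σ ρ ha hc (fvc x y) := by
  obtain rfl : τ = τ' := Equiv.ext hτ
  refine ext' (fun i => ?_) fun k => ?_
  · change ρ (x.fn (τ.symm (τ (y.fn (σ.symm i))))) = ρ (x.fn (y.fn (σ.symm i)))
    rw [τ.symm_apply_apply]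
  · dsimp only [frel, fvc]
    have h := cp_rel_rel (O := O) (J := {j // x.fn j = ρ.symm k})
      (Q := {j // ρ (x.fn (τ.symm j)) = k}) (I := fun j => {i // y.fn i = j.1})
      (I' := fun j => {i // τ (y.fn (σ.symm i)) = j.1}) (b := fun j => b j) (b' := fun j => b' j)
      (a := fun _ i => a i) (a' := fun _ i => a' i)
      (τ.subtypeEquiv fun j => by rw [τ.symm_apply_apply, Equiv.eq_symm_apply])
      (fun j => hb j) (c' := c' k) (by rw [← hc, ρ.apply_symm_apply])
      (fun j => σ.subtypeEquiv fun i => by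
        rw [σ.symm_apply_apply]
        exact (τ.apply_eq_iff_eq).symm) (fun _ i => ha i) (x.op (ρ.symm k))
      (fun j => y.op j.1)
      (fun j' => rel (a := fun i : {i // y.fn i = τ.symm j'.1} => a i)
        (σ.subtypeEquiv fun i => by rw [σ.symm_apply_apply, Equiv.eq_symm_apply]) (pf fun i => ha i)
        (by rw [← hb, τ.apply_symm_apply]) (y.op (τ.symm j'.1)))
      (fun j => fib y (τ.symm_apply_apply j.1) _ _ _ _ _ _ fun _ _ _ => rfl)
    refine (rel_rel ..).trans (Eq.trans ?_ ((congrArg _ ((congrArg _ h).trans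
      (rel_rel ..))).trans (rel_rel ..)).symm)
    exact ColoredOperad.rel_congr _ _ _ _ (cp (b := fun j : {j // x.fn j = ρ.symm k} => b j)
        (a := fun j (i : {i // y.fn i = j.1}) => a i) (x.op (ρ.symm k)) fun j => y.op j.1)
        fun _ => rfl

theorem fvc_assoc {a : I → O.Col} {b : J → O.Col} {c : K → O.Col} {d : L → O.Col}
    (f : FreeOp O c d) (g : FreeOp O b c) (h : FreeOp O a b) :
    fvc (fvc f g) h = fvc f (fvc g h) := by
  refine ext' (fun _ => rfl) fun k => ?_
  dsimp only [fvc]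
  have h1 := cp_rel_rel (O := O) (J := Σ l : {l // f.fn l = k}, {j // g.fn j = l.1})
    (Q := {j // f.fn (g.fn j) = k}) (I := fun s => {i // h.fn i = s.2.1})
    (I' := fun j => {i // h.fn i = j.1}) (b := fun s => b s.2) (b' := fun j => b j)
    (a := fun _ i => a i) (a' := fun _ i => a i) (fibEquiv f.fn g.fn k) (fun _ => rfl) rfl
    (fun _ => Equiv.refl _) (fun _ _ => rfl)
    (cp (b := fun l : {l // f.fn l = k} => c l) (a := fun l (j : {j // g.fn j = l.1}) => b j)
      (f.op k) fun l => g.op l.1) (fun s => h.op s.2.1) (fun j => h.op j.1)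
    (fun s => (rel_id (a := fun i : {i // h.fn i = s.2.1} => a i) _ _ _ (fun _ => rfl)).symm)
  have h2 := cp_assoc (O := O) (J := {l // f.fn l = k}) (I := fun l => {j // g.fn j = l.1})
    (M := fun l j => {i // h.fn i = j.1}) (b := fun l => c l) (a := fun _ j => b j)
    (d := fun _ _ i => a i) (f.op k) (fun l => g.op l.1) fun l j => h.op j.1
  have h3 := cp_rel (O := O) (J := {l // f.fn l = k})
    (I := fun l => Σ j : {j // g.fn j = l.1}, {i // h.fn i = j.1})
    (I' := fun l => {i // g.fn (h.fn i) = l.1}) (b := fun l => c l) (a := fun l s => a s.2)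
    (a' := fun l i => a i) (fun l => fibEquiv g.fn h.fn l.1) (fun _ _ => rfl) (f.op k)
    fun l => cp (b := fun j : {j // g.fn j = l.1} => b j)
      (a := fun j (i : {i // h.fn i = j.1}) => a i) (g.op l.1) fun j => h.op j.1
  refine ((congrArg _ h3).trans (rel_rel ..)).trans (Eq.trans ?_
    ((congrArg _ ((congrArg _ (h1.trans ((congrArg _ h2).trans (rel_rel ..)))).trans
      (rel_rel ..))).trans (rel_rel ..)).symm)
  exact ColoredOperad.rel_congr _ _ _ _ _ fun _ => rfl

theorem fil_fvc {a : I → O.Col} {b : J → O.Col} (f : FreeOp O a b) : fvc (fil b) f = f := by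
  refine ext' (fun _ => rfl) fun k => ?_
  dsimp only [fvc, fil]
  have h := cp_rel_rel (O := O) (J := Fin 1) (Q := {j // j = k})
    (I := fun j => {i // f.fn i = k})
    (I' := fun j => {i // f.fn i = j.1}) (b := fun _ => b k) (b' := fun j => b j)
    (a := fun _ i => a i) (a' := fun _ i => a i) (fibId k) (fun _ => rfl) rfl
    (fun _ => Equiv.refl _) (fun _ _ => rfl) (O.id (b k)) (fun _ => f.op k) (fun j => f.op j.1)
    (fun j => (rel_id (a := fun i : {i // f.fn i = k} => a i) _ _ _ (fun _ => rfl)).symm)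
  have h' := id_cp (O := O) (J := {i // f.fn i = k}) (b := fun i => a i) (f.op k)
  refine Eq.symm ((congrArg _ ((congrArg _ (h.trans ((congrArg _ h').trans (rel_rel ..)))).trans
    (rel_rel ..))).trans ((rel_rel ..).trans ?_))
  exact rel_id _ _ _ fun _ => rfl

theorem fvc_fil {a : I → O.Col} {b : J → O.Col} (f : FreeOp O a b) : fvc f (fil a) = f := by
  refine ext' (fun _ => rfl) fun k => ?_
  dsimp only [fvc, fil]
  have h := cp_rel_rel (O := O) (J := {i // f.fn i = k}) (Q := {j // f.fn j = k})
    (I := fun j => Fin 1)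
    (I' := fun j => {i // i = j.1}) (b := fun j => a j) (b' := fun j => a j)
    (a := fun j _ => a j) (a' := fun _ i => a i) (Equiv.refl _) (fun _ => rfl) rfl
    (fun j => fibId j.1) (fun _ _ => rfl) (f.op k) (fun j => O.id (a j.1))
    (fun j => rel (a := fun _ : Fin 1 => a j) (fibId j.1)
    (pf fun _ => rfl) rfl (O.id (a j.1)))
    (fun j => rfl)
  have h0 : rel (a := fun i : {i // f.fn i = k} => a i) (a' := fun i : {i // f.fn i = k} => a i)
    (Equiv.refl _) (pf fun _ => rfl) rfl (f.op k) = f.op k := rel_id _ _ _ fun _ => rfl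
  have h' := cp_id (O := O) (J := {i // f.fn i = k}) (b := fun i => a i) (f.op k)
  refine Eq.symm ((congrArg _ (congrArg _ ((congrArg (fun x => cp x _) h0.symm).trans
    (h.trans ((congrArg _ h').trans (rel_rel ..)))))).trans
    ((congrArg _ (rel_rel ..)).trans ((rel_rel ..).trans ?_)))
  exact rel_id _ _ _ fun _ => rfl

theorem fhc_frel {a : I → O.Col} {a' : I' → O.Col} {b : J → O.Col} {b' : J' → O.Col}
    {c : K → O.Col} {c' : K' → O.Col} {d : L → O.Col} {d' : L' → O.Col} (σ : I ≃ I')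
    (τ : J ≃ J') (ρ : K ≃ K') (π : L ≃ L')
    (ha : ∀ i, a' (σ i) = a i) (hb : ∀ j, b' (τ j) = b j) (hcc : ∀ k, c' (ρ k) = c k)
    (hd : ∀ l, d' (π l) = d l) (f : FreeOp O a b) (g : FreeOp O c d) :
    fhc (frel σ τ ha hb f) (frel ρ π hcc hd g) = frel (σ.sumCongr ρ) (τ.sumCongr π)
      (pf <| by rintro (i | i) <;> simp [ha, hcc]) (pf <| by rintro (i | i) <;> simp [hb, hd]) (fhc f g) := by
  refine ext' (by rintro (i | i) <;> rfl) ?_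
  rintro (j | j)
  · dsimp only [frel, fhc]
    refine (rel_rel ..).trans (Eq.trans ?_ ((congrArg _ (rel_rel ..)).trans (rel_rel ..)).symm)
    exact ColoredOperad.rel_congr _ _ _ _ (f.op _) fun _ => rfl
  · dsimp only [frel, fhc]
    refine (rel_rel ..).trans (Eq.trans ?_ ((congrArg _ (rel_rel ..)).trans (rel_rel ..)).symm)
    exact ColoredOperad.rel_congr _ _ _ _ (g.op _) fun _ => rfl

theorem fhc_assoc {a : I → O.Col} {b : J → O.Col} {a' : I' → O.Col} {b' : J' → O.Col}
    {c : K → O.Col} {d : L → O.Col} (f : FreeOp O a b) (g : FreeOp O a' b') (h : FreeOp O c d) :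
    fhc (fhc f g) h = frel (Equiv.sumAssoc ..).symm (Equiv.sumAssoc ..).symm
      (pf <| by rintro (i | i | i) <;> rfl) (pf <| by rintro (i | i | i) <;> rfl)
      (fhc f (fhc g h)) := by
  refine ext' (by rintro ((i | i) | i) <;> rfl) ?_
  rintro ((j | j) | j)
  · dsimp only [frel, fhc, Equiv.symm_symm, Equiv.sumAssoc_apply_inl_inl]
    refine (rel_rel ..).trans (Eq.trans ?_ ((congrArg _ (rel_rel ..)).trans (rel_rel ..)).symm)
    exact ColoredOperad.rel_congr _ _ _ _ (f.op j) fun _ => rfl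
  · dsimp only [frel, fhc, Equiv.symm_symm, Equiv.sumAssoc_apply_inl_inr]
    refine ((congrArg _ (rel_rel ..)).trans (rel_rel ..)).trans
      (Eq.trans ?_ ((congrArg _ (rel_rel ..)).trans (rel_rel ..)).symm)
    exact ColoredOperad.rel_congr _ _ _ _ (g.op j) fun _ => rfl
  · dsimp only [frel, fhc, Equiv.symm_symm, Equiv.sumAssoc_apply_inr]
    refine ((congrArg _ (rel_rel ..)).trans (rel_rel ..)).trans
      (Eq.trans ?_ (rel_rel ..).symm)
    exact ColoredOperad.rel_congr _ _ _ _ (h.op j) fun _ => rfl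

theorem fhc_comm {a : I → O.Col} {b : J → O.Col} {a' : I' → O.Col} {b' : J' → O.Col}
    (f : FreeOp O a b) (g : FreeOp O a' b') :
    fhc g f = frel (Equiv.sumComm ..) (Equiv.sumComm ..)
      (pf <| by rintro (i | i) <;> rfl) (pf <| by rintro (i | i) <;> rfl) (fhc f g) := by
  refine ext' (by rintro (i | i) <;> rfl) ?_
  rintro (j | j)
  · dsimp only [frel, fhc, Equiv.sumComm_symm, Equiv.sumComm_apply, Sum.swap_inl]
    refine (rel_rel ..).trans (Eq.trans ?_ (rel_rel ..).symm)
    exact ColoredOperad.rel_congr _ _ _ _ (g.op j) fun _ => rfl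
  · dsimp only [frel, fhc, Equiv.sumComm_symm, Equiv.sumComm_apply, Sum.swap_inr]
    refine (rel_rel ..).trans (Eq.trans ?_ (rel_rel ..).symm)
    exact ColoredOperad.rel_congr _ _ _ _ (f.op j) fun _ => rfl

theorem fhc_empty [IsEmpty K] [IsEmpty L] {a : I → O.Col} {b : J → O.Col} {c : K → O.Col}
    {d : L → O.Col} (f : FreeOp O a b) (g : FreeOp O c d) :
    fhc f g = frel (Equiv.sumEmpty I K).symm (Equiv.sumEmpty J L).symm
      (fun _ => rfl) (fun _ => rfl) f := by
  refine ext' ?_ ?_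
  · rintro (i | i)
    · rfl
    · exact isEmptyElim i
  · rintro (j | j)
    · dsimp only [frel, fhc, Equiv.symm_symm, Equiv.sumEmpty_apply_inl]
      refine Eq.trans ?_ (rel_rel ..).symm
      exact ColoredOperad.rel_congr _ _ _ _ (f.op j) fun _ => rfl
    · exact isEmptyElim j

theorem fhc_fvc {a : I → O.Col} {b : J → O.Col} {c : K → O.Col} {a' : I' → O.Col}
    {b' : J' → O.Col} {c' : K' → O.Col} (f : FreeOp O b c) (g : FreeOp O a b) (f' : FreeOp O b' c')
    (g' : FreeOp O a' b') : fhc (fvc f g) (fvc f' g') = fvc (fhc f f') (fhc g g') := by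
  refine ext' (by rintro (i | i) <;> rfl) ?_
  rintro (k | k)
  · dsimp only [fhc, fvc]
    refine Eq.trans (congrArg _ (cp_rel_rel (b := fun j : {j // f.fn j = k} => b j)
      (b' := fun j : {j // Sum.map f.fn f'.fn j = Sum.inl k} => Sum.elim b b' j)
      (a := fun j (i : {i // g.fn i = j.1}) => a i)
      (a' := fun j (i : {i // Sum.map g.fn g'.fn i = j.1}) => Sum.elim a a' i)
      (fibInl f.fn f'.fn k) (fun _ => rfl) rfl
      (fun j => fibInl g.fn g'.fn j.1) (fun _ _ => rfl) (f.op k) (fun j => g.op j.1)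
      _ fun _ => rfl)) ?_
    refine (rel_rel ..).trans (Eq.trans ?_ ((congrArg _ (rel_rel ..)).trans (rel_rel ..)).symm)
    exact ColoredOperad.rel_congr _ _ _ _ (cp (f.op k) fun j => g.op j.1) fun _ => rfl
  · dsimp only [fhc, fvc]
    refine Eq.trans (congrArg _ (cp_rel_rel (b := fun j : {j // f'.fn j = k} => b' j)
      (b' := fun j : {j // Sum.map f.fn f'.fn j = Sum.inr k} => Sum.elim b b' j)
      (a := fun j (i : {i // g'.fn i = j.1}) => a' i)
      (a' := fun j (i : {i // Sum.map g.fn g'.fn i = j.1}) => Sum.elim a a' i)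
      (fibInr f.fn f'.fn k) (fun _ => rfl) rfl
      (fun j => fibInr g.fn g'.fn j.1) (fun _ _ => rfl) (f'.op k) (fun j => g'.op j.1)
      _ fun _ => rfl)) ?_
    refine (rel_rel ..).trans (Eq.trans ?_ ((congrArg _ (rel_rel ..)).trans (rel_rel ..)).symm)
    exact ColoredOperad.rel_congr _ _ _ _ (cp (f'.op k) fun j => g'.op j.1) fun _ => rfl

end FreeOp
end PropOperad

namespace PropOperad
open Listed ColoredOperad

namespace FreeOp
variable {O : ColoredOperad.{u}}
variable {I I' J J' K : Type} [Listed I] [Listed I'] [Listed J] [Listed J'] [Listed K]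

theorem fhc_fil (a : I → O.Col) (b : J → O.Col) :
    fhc (fil a) (fil b) = fil (Sum.elim a b) := by
  refine ext' (by rintro (i | i) <;> rfl) ?_
  rintro (j | j)
  · dsimp only [fhc, fil]
    refine Eq.trans ?_ ((congrArg _ (rel_rel ..)).trans (rel_rel ..)).symm
    exact ColoredOperad.rel_congr (a := fun _ : Fin 1 => a j) _ _ _ _ (O.id (a j)) fun _ => rfl
  · dsimp only [fhc, fil]
    refine Eq.trans ?_ ((congrArg _ (rel_rel ..)).trans (rel_rel ..)).symm
    exact ColoredOperad.rel_congr (a := fun _ : Fin 1 => b j) _ _ _ _ (O.id (b j)) fun _ => rfl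

theorem frel_fil {a : I → O.Col} {a' : I' → O.Col} (σ σ' : I ≃ I') (ha : ∀ i, a' (σ i) = a i)
    (ha' : ∀ i, a' (σ' i) = a i) (hσ : ∀ i, σ i = σ' i) :
    frel σ σ' ha ha' (fil a) = fil a' := by
  obtain rfl : σ = σ' := Equiv.ext hσ
  have hs : ∀ i, a (σ.symm i) = a' i := fun i => by rw [← ha, Equiv.apply_symm_apply]
  have e (x : FreeOp O a' a') : frel σ σ ha ha (frel σ.symm σ.symm hs hs x) = x := by
    rw [frel_frel]
    exact frel_id _ _ _ (by simp) (by simp)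
  rw [← fil_fvc (frel σ σ ha ha' (fil a)), ← e (fil a'), fvc_frel _ _ _ _ _ _ _ _ fun _ => rfl, fvc_fil]

theorem fil_empty [IsEmpty J] [IsEmpty I] {a : I → O.Col} {b : J → O.Col} (x y : FreeOp O a b) :
    x = y :=
  ext' (fun i => isEmptyElim i) fun j => isEmptyElim j

end FreeOp

open FreeOp

/-- Sum of blocks. -/
theorem elim_finSum {C : Type u} {n p : ℕ} (a : Fin n → C) (b : Fin p → C) (s : Fin n ⊕ Fin p) :
    Fin.append a b (finSumFinEquiv s) = Sum.elim a b s := by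
  rcases s with i | i
  · exact Fin.append_left a b i
  · exact Fin.append_right a b i

/-- The data of the free prop on an operad. -/
noncomputable abbrev freeData (O : ColoredOperad.{u}) : PropData.{u} where
  Col := O.Col
  Op a b := FreeOp O a b
  id c := fil fun _ : Fin 1 => c
  unit := fil Fin.elim0
  vcomp x y := fvc x y
  hcomp {_ _ _ _ a b a' b'} x y := frel (a' := Fin.append a a') (b' := Fin.append b b')
    finSumFinEquiv finSumFinEquiv (elim_finSum a a') (elim_finSum b b') (fhc x y)
  inp {_ _ _ a a' b} σ h x := frel (a := a) (a' := a') (b := b) (b' := b) σ.symm (Equiv.refl _)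
    (fun i => (h _).trans (congrArg a (σ.apply_symm_apply i))) (pf fun _ => rfl) x
  out {_ _ _ a b b'} τ h x := frel (a := a) (a' := a) (b := b) (b' := b') (Equiv.refl _) τ (pf fun _ => rfl)
    (fun i => (h _).trans (congrArg b (τ.symm_apply_apply i))) x

variable {O : ColoredOperad.{u}}

theorem free_hcomp {n m p q : ℕ} {a : Fin n → O.Col} {b : Fin m → O.Col} {a' : Fin p → O.Col}
    {b' : Fin q → O.Col} (x : FreeOp O a b) (y : FreeOp O a' b') :
    (freeData O).hcomp x y = frel (a' := Fin.append a a') (b' := Fin.append b b')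
      finSumFinEquiv finSumFinEquiv (elim_finSum a a') (elim_finSum b b') (fhc x y) := rfl

theorem free_act {n n' m m' : ℕ} {a : Fin n → O.Col} {a' : Fin n' → O.Col} {b : Fin m → O.Col}
    {b' : Fin m' → O.Col} (σ : Fin n' ≃ Fin n) (τ : Fin m ≃ Fin m') (ha : ∀ i, a' i = a (σ i))
    (hb : ∀ k, b' k = b (τ.symm k)) (x : FreeOp O a b) :
    (freeData O).act σ τ ha hb x = frel (a := a) (a' := a') (b := b) (b' := b') σ.symm τ
      (pf fun i => (ha _).trans (congrArg a (σ.apply_symm_apply i)))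
      (pf fun i => (hb _).trans (congrArg b (τ.symm_apply_apply i))) x := by
  refine (frel_frel (a := a) (a' := a) (b := b) (b' := b') (Equiv.refl (Fin n)) τ (fun _ => rfl)
    (fun i => (hb _).trans (congrArg b (τ.symm_apply_apply i))) σ.symm (Equiv.refl (Fin m'))
    (fun i => (ha _).trans (congrArg a (σ.apply_symm_apply i))) (fun _ => rfl) x).trans ?_
  exact frel_congr _ _ _ _ x (fun _ => rfl) fun _ => rfl

theorem free_idList {n : ℕ} (a : Fin n → O.Col) : (freeData O).idList a = fil a := by
  induction n with
  | zero => exact fil_empty _ _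
  | succ n ih =>
    have h := ih fun i => a i.castSucc
    refine (congrArg (fun x => (freeData O).act _ _ _ _ ((freeData O).hcomp x _)) h).trans ?_
    refine (free_act ..).trans ((congrArg _ ((free_hcomp ..).trans
      (congrArg _ (fhc_fil _ _)))).trans ((congrArg _ (frel_fil _ _ _ _ fun _ => rfl)).trans ?_))
    exact frel_fil _ _ _ _ fun _ => rfl

end PropOperad

namespace PropOperad
open Listed ColoredOperad FreeOp
namespace FreeOp
variable {O : ColoredOperad.{u}}
variable {I I' J J' K L : Type} [Listed I] [Listed I'] [Listed J] [Listed J'] [Listed K] [Listed L]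

theorem fhc_frel_left {a : I → O.Col} {a' : I' → O.Col} {b : J → O.Col} {b' : J' → O.Col}
    {c : K → O.Col} {d : L → O.Col} (σ : I ≃ I')
    (τ : J ≃ J') (ha : ∀ i, a' (σ i) = a i) (hb : ∀ j, b' (τ j) = b j)
    (f : FreeOp O a b) (g : FreeOp O c d) :
    fhc (frel σ τ ha hb f) g = frel (σ.sumCongr (Equiv.refl K)) (τ.sumCongr (Equiv.refl L))
      (pf <| by rintro (i | i) <;> simp [ha]) (pf <| by rintro (i | i) <;> simp [hb]) (fhc f g) := by
  refine Eq.trans ?_ (fhc_frel σ τ (Equiv.refl _) (Equiv.refl _) ha hb (fun _ => rfl)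
    (fun _ => rfl) f g)
  exact congrArg _ (frel_id _ _ _ (fun _ => rfl) (fun _ => rfl)).symm

theorem fhc_frel_right {a : I → O.Col} {a' : I' → O.Col} {b : J → O.Col} {b' : J' → O.Col}
    {c : K → O.Col} {d : L → O.Col} (σ : I ≃ I')
    (τ : J ≃ J') (ha : ∀ i, a' (σ i) = a i) (hb : ∀ j, b' (τ j) = b j)
    (f : FreeOp O a b) (g : FreeOp O c d) :
    fhc g (frel σ τ ha hb f) = frel ((Equiv.refl K).sumCongr σ) ((Equiv.refl L).sumCongr τ)
      (pf <| by rintro (i | i) <;> simp [ha]) (pf <| by rintro (i | i) <;> simp [hb]) (fhc g f) := by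
  refine Eq.trans ?_ (fhc_frel (Equiv.refl _) (Equiv.refl _) σ τ (fun _ => rfl)
    (fun _ => rfl) ha hb g f)
  exact congrArg (fun x => fhc x _) (frel_id _ _ _ (fun _ => rfl) (fun _ => rfl)).symm

end FreeOp
variable {O : ColoredOperad.{u}}

theorem free_inp {n n' m : ℕ} {a : Fin n → O.Col} {a' : Fin n' → O.Col} {b : Fin m → O.Col}
    (σ : Fin n' ≃ Fin n) (ha : ∀ i, a' i = a (σ i)) (x : FreeOp O a b) :
    (freeData O).inp σ ha x = frel (a := a) (a' := a') (b := b) (b' := b) σ.symm (Equiv.refl _)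
      (pf fun i => (ha _).trans (congrArg a (σ.apply_symm_apply i))) (pf fun _ => rfl) x := rfl

theorem free_out {n m m' : ℕ} {a : Fin n → O.Col} {b : Fin m → O.Col}
    {b' : Fin m' → O.Col} (τ : Fin m ≃ Fin m')
    (hb : ∀ k, b' k = b (τ.symm k)) (x : FreeOp O a b) :
    (freeData O).out τ hb x = frel (a := a) (a' := a) (b := b) (b' := b') (Equiv.refl _) τ (pf fun _ => rfl)
      (pf fun i => (hb _).trans (congrArg b (τ.symm_apply_apply i))) x := rfl

theorem free_hcomp_assoc {n m p q r s : ℕ} {a : Fin n → O.Col} {b : Fin m → O.Col}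
    {a' : Fin p → O.Col} {b' : Fin q → O.Col} {a'' : Fin r → O.Col} {b'' : Fin s → O.Col}
    (f : FreeOp O a b) (g : FreeOp O a' b') (h : FreeOp O a'' b'') :
    (freeData O).hcomp ((freeData O).hcomp f g) h =
      (freeData O).act (finCongr (Nat.add_assoc n p r)) (finCongr (Nat.add_assoc m q s).symm)
        (append_assoc_apply a a' a'') (congrOut (append_assoc_apply b b' b''))
        ((freeData O).hcomp f ((freeData O).hcomp g h)) := by
  have h1 := (fhc_frel_left finSumFinEquiv finSumFinEquiv
    (elim_finSum a a') (elim_finSum b b') (fhc f g) h)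
  have h2 := (fhc_frel_right finSumFinEquiv finSumFinEquiv
    (elim_finSum a' a'') (elim_finSum b' b'') (fhc g h) f)
  rw [free_act, free_hcomp, free_hcomp, free_hcomp, free_hcomp, h1, h2, fhc_assoc]
  refine ((congrArg _ (frel_frel ..)).trans (frel_frel ..)).trans
    (Eq.trans ?_ ((congrArg _ (frel_frel ..)).trans (frel_frel ..)).symm)
  refine frel_congr _ _ _ _ (fhc f (fhc g h)) ?_ ?_
  · rintro (i | i | i) <;> ext <;> simp [Nat.add_assoc]
  · rintro (i | i | i) <;> ext <;> simp [Nat.add_assoc]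

theorem free_hcomp_unit {n m : ℕ} {a : Fin n → O.Col} {b : Fin m → O.Col}
    (f : FreeOp O a b) :
    (freeData O).hcomp f (freeData O).unit =
      (freeData O).act (finCongr (Nat.add_zero n)) (finCongr (Nat.add_zero m).symm)
        (append_elim0_apply a) (congrOut (append_elim0_apply b)) f := by
  rw [free_act, free_hcomp, fhc_empty (K := Fin 0) (L := Fin 0) f (fil Fin.elim0)]
  refine (frel_frel ..).trans (frel_congr _ _ _ _ f (fun i => Fin.ext ?_) fun i => Fin.ext ?_) <;> rfl

theorem free_hcomp_swap {n m p q : ℕ} {a : Fin n → O.Col} {b : Fin m → O.Col} {a' : Fin p → O.Col}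
    {b' : Fin q → O.Col} (f : FreeOp O a b) (g : FreeOp O a' b') :
    (freeData O).inp finAddFlip (append_flip a a') ((freeData O).out finAddFlip
      (append_flip_symm b b') ((freeData O).hcomp f g)) = (freeData O).hcomp g f := by
  refine (free_act ..).trans ?_
  rw [free_hcomp, free_hcomp, fhc_comm f g]
  refine (frel_frel ..).trans (Eq.trans ?_ (frel_frel ..).symm)
  refine frel_congr _ _ _ _ (fhc f g) ?_ ?_
  · rintro (i | i) <;> simp [finAddFlip]
  · rintro (i | i) <;> simp [finAddFlip]

theorem free_unit_hcomp {n m : ℕ} {a : Fin n → O.Col} {b : Fin m → O.Col}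
    (f : FreeOp O a b) :
    (freeData O).hcomp (freeData O).unit f =
      (freeData O).act (finCongr (Nat.zero_add n)) (finCongr (Nat.zero_add m).symm)
        (elim0_append_apply a) (congrOut (elim0_append_apply b)) f := by
  have h1 := fhc_empty (K := Fin 0) (L := Fin 0) f (fil (Fin.elim0 : Fin 0 → O.Col))
  have h2 := fhc_comm f (fil (Fin.elim0 : Fin 0 → O.Col))
  rw [h1] at h2
  rw [free_act, free_hcomp, h2]
  refine ((congrArg _ (frel_frel ..)).trans (frel_frel ..)).trans
    (frel_congr _ _ _ _ f (fun i => ?_) fun i => ?_) <;> ext <;> simp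

theorem free_vcomp_out {n m m' k : ℕ} {a : Fin n → O.Col} {b : Fin m → O.Col} {b' : Fin m' → O.Col}
    {c : Fin k → O.Col} (σ : Fin m ≃ Fin m') (h : ∀ k, b' k = b (σ.symm k))
    (h' : ∀ i, b i = b' (σ i)) (f : FreeOp O b' c) (g : FreeOp O a b) :
    (freeData O).vcomp f ((freeData O).out σ h g) =
      (freeData O).vcomp ((freeData O).inp σ h' f) g := by
  rw [free_out, free_inp]
  have hs : ∀ i, b' (σ i) = b i := fun i => (h' i).symm
  have hs' : ∀ i, b (σ.symm i) = b' i := fun i => (h i).symm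
  have e : frel (a := b) (a' := b') (b := c) (b' := c) σ (Equiv.refl _) hs (fun _ => rfl)
      (frel (a := b') (a' := b) (b := c) (b' := c) σ.symm (Equiv.refl _) hs' (fun _ => rfl) f) = f := by
    refine (frel_frel ..).trans (frel_id _ _ f ?_ ?_) <;> simp
  refine Eq.trans (congrArg (fun x => fvc x _) e.symm) ((fvc_frel (Equiv.refl _) σ σ (Equiv.refl _)
    (fun _ => rfl) hs hs (fun _ => rfl) (fun _ => rfl) (frel (a := b') (a' := b) (b := c) (b' := c)
     σ.symm (Equiv.refl _) hs' (fun _ => rfl) f) g).trans ?_)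
  exact frel_id _ _ _ (fun _ => rfl) (fun _ => rfl)

theorem free_inp_vcomp {n n' m k : ℕ} {a : Fin n → O.Col} {a' : Fin n' → O.Col} {b : Fin m → O.Col}
    {c : Fin k → O.Col} (σ : Fin n' ≃ Fin n) (h : ∀ i, a' i = a (σ i))
    (f : FreeOp O b c) (g : FreeOp O a b) :
    (freeData O).inp σ h ((freeData O).vcomp f g) =
      (freeData O).vcomp f ((freeData O).inp σ h g) := by
  rw [free_inp, free_inp]
  have hs : ∀ i, a' (σ.symm i) = a i := fun i => (h _).trans (congrArg a (σ.apply_symm_apply i))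
  have e : frel (a := b) (a' := b) (b := c) (b' := c) (Equiv.refl _) (Equiv.refl _) (fun _ => rfl)
    (fun _ => rfl) f = f := frel_id _ _ f (fun _ => rfl) (fun _ => rfl)
  exact (fvc_frel σ.symm (Equiv.refl _) (Equiv.refl _) (Equiv.refl _) hs (fun _ => rfl)
    (fun _ => rfl) (fun _ => rfl) (fun _ => rfl) f g).symm.trans
    (congrArg (fun x => fvc x (frel (a := a) (a' := a') (b := b) (b' := b) σ.symm (Equiv.refl _) hs
      (fun _ => rfl) g)) e)

theorem free_out_vcomp {n m k k' : ℕ} {a : Fin n → O.Col} {b : Fin m → O.Col}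
    {c : Fin k → O.Col} {c' : Fin k' → O.Col} (τ : Fin k ≃ Fin k')
    (h : ∀ i, c' i = c (τ.symm i)) (f : FreeOp O b c) (g : FreeOp O a b) :
    (freeData O).out τ h ((freeData O).vcomp f g) =
      (freeData O).vcomp ((freeData O).out τ h f) g := by
  rw [free_out, free_out]
  have hs : ∀ i, c' (τ i) = c i := fun i => (h _).trans (congrArg c (τ.symm_apply_apply i))
  have e : frel (a := a) (a' := a) (b := b) (b' := b) (Equiv.refl _) (Equiv.refl _) (fun _ => rfl)
    (fun _ => rfl) g = g := frel_id _ _ g (fun _ => rfl) (fun _ => rfl)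
  exact (fvc_frel (Equiv.refl _) (Equiv.refl _) (Equiv.refl _) τ (fun _ => rfl) (fun _ => rfl)
    (fun _ => rfl) hs (fun _ => rfl) f g).symm.trans
    (congrArg (fun x => fvc (frel (a := b) (a' := b) (b := c) (b' := c') (Equiv.refl _) τ
      (fun _ => rfl) hs f) x) e)

theorem free_inp_hcomp {n n' m p p' q : ℕ} {a : Fin n → O.Col} {a₁ : Fin n' → O.Col}
    {b : Fin m → O.Col} {a' : Fin p → O.Col} {a₁' : Fin p' → O.Col} {b' : Fin q → O.Col}
    (σ : Fin n' ≃ Fin n) (h : ∀ i, a₁ i = a (σ i)) (σ' : Fin p' ≃ Fin p)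
    (h' : ∀ i, a₁' i = a' (σ' i)) (f : FreeOp O a b) (g : FreeOp O a' b') :
    (freeData O).hcomp ((freeData O).inp σ h f) ((freeData O).inp σ' h' g) =
      (freeData O).inp (blockSum σ σ') (append_blockSum h h') ((freeData O).hcomp f g) := by
  rw [free_inp, free_inp, free_inp, free_hcomp, free_hcomp, fhc_frel]
  refine (frel_frel ..).trans (Eq.trans ?_ (frel_frel ..).symm)
  refine frel_congr _ _ _ _ (fhc f g) ?_ ?_
  · rintro (i | i) <;> simp [blockSum]
  · rintro (i | i) <;> simp

theorem free_out_hcomp {n m m' p q q' : ℕ} {a : Fin n → O.Col} {b : Fin m → O.Col}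
    {b₁ : Fin m' → O.Col} {a' : Fin p → O.Col} {b' : Fin q → O.Col} {b₁' : Fin q' → O.Col}
    (τ : Fin m ≃ Fin m') (h : ∀ i, b₁ i = b (τ.symm i)) (τ' : Fin q ≃ Fin q')
    (h' : ∀ i, b₁' i = b' (τ'.symm i)) (f : FreeOp O a b) (g : FreeOp O a' b') :
    (freeData O).hcomp ((freeData O).out τ h f) ((freeData O).out τ' h' g) =
      (freeData O).out (blockSum τ τ') (append_blockSum_symm h h') ((freeData O).hcomp f g) := by
  rw [free_out, free_out, free_out, free_hcomp, free_hcomp, fhc_frel]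
  refine (frel_frel ..).trans (Eq.trans ?_ (frel_frel ..).symm)
  refine frel_congr _ _ _ _ (fhc f g) ?_ ?_
  · rintro (i | i) <;> simp
  · rintro (i | i) <;> simp [blockSum]

theorem free_inp_out {n n' m m' : ℕ} {a : Fin n → O.Col} {a' : Fin n' → O.Col} {b : Fin m → O.Col}
    {b' : Fin m' → O.Col} (σ : Fin n' ≃ Fin n) (h : ∀ i, a' i = a (σ i)) (τ : Fin m ≃ Fin m')
    (h' : ∀ k, b' k = b (τ.symm k)) (f : FreeOp O a b) :
    (freeData O).inp σ h ((freeData O).out τ h' f) =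
      (freeData O).out τ h' ((freeData O).inp σ h f) := by
  rw [free_inp, free_out, free_inp, free_out, frel_frel, frel_frel]
  exact frel_congr (a := a) (b := b) _ _ _ _ f (fun _ => rfl) fun _ => rfl

theorem free_inp_inp {n n' n'' m : ℕ} {a : Fin n → O.Col} {a' : Fin n' → O.Col}
    {a'' : Fin n'' → O.Col} {b : Fin m → O.Col} (σ : Fin n'' ≃ Fin n') (h : ∀ i, a'' i = a' (σ i))
    (σ' : Fin n' ≃ Fin n) (h' : ∀ i, a' i = a (σ' i)) (f : FreeOp O a b) :
    (freeData O).inp σ h ((freeData O).inp σ' h' f) =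
      (freeData O).inp (σ.trans σ') (fun i => by simp only [Equiv.trans_apply, h, h']) f := by
  have hh : ∀ i, a'' i = a ((σ.trans σ') i) := fun i => by rw [Equiv.trans_apply, h, h']
  change _ = (freeData O).inp (σ.trans σ') hh f
  rw [free_inp, free_inp, free_inp, frel_frel]
  exact frel_congr (a := a) (b := b) _ _ _ _ f (fun _ => rfl) fun _ => rfl

theorem free_out_out {n m m' m'' : ℕ} {a : Fin n → O.Col} {b : Fin m → O.Col} {b' : Fin m' → O.Col}
    {b'' : Fin m'' → O.Col} (τ : Fin m' ≃ Fin m'') (h : ∀ k, b'' k = b' (τ.symm k))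
    (τ' : Fin m ≃ Fin m') (h' : ∀ k, b' k = b (τ'.symm k)) (f : FreeOp O a b) :
    (freeData O).out τ h ((freeData O).out τ' h' f) = (freeData O).out (τ'.trans τ)
      (fun k => by simp only [Equiv.symm_trans_apply, h, h']) f := by
  have hh : ∀ k, b'' k = b ((τ'.trans τ).symm k) := fun k => by
    rw [Equiv.symm_trans_apply, h, h']
  change _ = (freeData O).out (τ'.trans τ) hh f
  rw [free_out, free_out, free_out, frel_frel]
  exact frel_congr (a := a) (b := b) _ _ _ _ f (fun _ => rfl) fun _ => rfl

theorem free_interchange {n m k n' m' k' : ℕ} {a : Fin n → O.Col} {b : Fin m → O.Col}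
    {c : Fin k → O.Col} {a' : Fin n' → O.Col} {b' : Fin m' → O.Col} {c' : Fin k' → O.Col}
    (f : FreeOp O b c) (g : FreeOp O a b) (f' : FreeOp O b' c') (g' : FreeOp O a' b') :
    (freeData O).hcomp ((freeData O).vcomp f g) ((freeData O).vcomp f' g') =
      (freeData O).vcomp ((freeData O).hcomp f f') ((freeData O).hcomp g g') := by
  rw [free_hcomp, free_hcomp, free_hcomp]
  exact (congrArg _ (fhc_fvc f g f' g')).trans
    (fvc_frel finSumFinEquiv finSumFinEquiv finSumFinEquiv finSumFinEquiv (elim_finSum _ _)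
      (elim_finSum _ _) (elim_finSum _ _) (elim_finSum _ _) (fun _ => rfl) (fhc f f') (fhc g g')).symm

theorem free_vcomp_idList {n m : ℕ} {a : Fin n → O.Col} {b : Fin m → O.Col} (f : FreeOp O a b) :
    (freeData O).vcomp f ((freeData O).idList a) = f :=
  (congrArg (fvc f) (free_idList a)).trans (fvc_fil f)

theorem free_idList_vcomp {n m : ℕ} {a : Fin n → O.Col} {b : Fin m → O.Col} (f : FreeOp O a b) :
    (freeData O).vcomp ((freeData O).idList b) f = f :=
  (congrArg (fun x => fvc x f) (free_idList b)).trans (fil_fvc f)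

theorem free_inp_refl {n m : ℕ} {a : Fin n → O.Col} {b : Fin m → O.Col} (f : FreeOp O a b) :
    (freeData O).inp (Equiv.refl _) (reflIn fun _ => rfl) f = f :=
  frel_id (a := a) (b := b) (fun _ => rfl) (fun _ => rfl) f (fun _ => rfl) fun _ => rfl

theorem free_out_refl {n m : ℕ} {a : Fin n → O.Col} {b : Fin m → O.Col} (f : FreeOp O a b) :
    (freeData O).out (Equiv.refl _) (reflOut fun _ => rfl) f = f :=
  frel_id (a := a) (b := b) (fun _ => rfl) (fun _ => rfl) f (fun _ => rfl) fun _ => rfl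

theorem isProp_free (O : ColoredOperad.{u}) : IsProp (freeData O) where
  vcomp_assoc f g h := fvc_assoc f g h
  vcomp_idList := free_vcomp_idList
  idList_vcomp := free_idList_vcomp
  hcomp_assoc := free_hcomp_assoc
  unit_hcomp := free_unit_hcomp
  hcomp_unit := free_hcomp_unit
  interchange := free_interchange
  vcomp_out := free_vcomp_out
  inp_vcomp := free_inp_vcomp
  out_vcomp := free_out_vcomp
  inp_hcomp := free_inp_hcomp
  out_hcomp := free_out_hcomp
  hcomp_swap := free_hcomp_swap
  inp_out := free_inp_out
  inp_refl := free_inp_refl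
  out_refl := free_out_refl
  inp_inp := free_inp_inp
  out_out := free_out_out

/-- The free prop on an operad: the operations `a → b` are the functions `θ` from the places of
`a` to those of `b`, with an operation of the operad from the colours over `j` to the `j`th colour
of `b`, for every `j`. -/
noncomputable abbrev freeProp (O : ColoredOperad.{u}) : ColoredProp.{u} := ⟨freeData O, isProp_free O⟩

end PropOperad

namespace PropOperad
open Listed ColoredOperad FreeOp

namespace FreeOp
variable {O : ColoredOperad.{u}}
variable {I I' J J' K : Type} [Listed I] [Listed I'] [Listed J] [Listed J'] [Listed K]

/-- The fibres of the function to a one-point set. -/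
def fibOne (I : Type) (j : Fin 1) : I ≃ {_i : I // (0 : Fin 1) = j} where
  toFun i := ⟨i, Subsingleton.elim _ _⟩
  invFun i := i.1
  left_inv _ := rfl
  right_inv _ := rfl

/-- The operation `(*, x)`, where `*` is the function to a one-point set. -/
noncomputable def feta {a : I → O.Col} {c : O.Col} (x : O.Ext a c) :
    FreeOp O a (fun _ : Fin 1 => c) :=
  ⟨fun _ => 0, fun j => rel (a := a) (fibOne I j) (pf fun _ => rfl) rfl x⟩

theorem frel_feta {a : I → O.Col} {a' : I' → O.Col} {c : O.Col} (σ : I ≃ I')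
    (ha : ∀ i, a' (σ i) = a i) (x : O.Ext a c) :
    frel (b := fun _ : Fin 1 => c) (b' := fun _ : Fin 1 => c) σ (Equiv.refl (Fin 1)) ha (pf fun _ => rfl) (feta x) = feta (rel σ ha rfl x) := by
  refine ext' (fun _ => rfl) fun j => ?_
  dsimp only [frel, feta]
  refine (rel_rel ..).trans (Eq.trans ?_ ((congrArg _ (rel_rel ..)).trans (rel_rel ..)).symm)
  exact ColoredOperad.rel_congr _ _ _ _ x fun _ => rfl

/-- The fibres of a disjoint union of functions. -/
def fibSigma {I J : K → Type} (θ : ∀ k, I k → J k) (s : Σ k, J k) :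
    {i // θ s.1 i = s.2} ≃ {t : Σ k, I k // (⟨t.1, θ t.1 t.2⟩ : Σ k, J k) = s} where
  toFun i := ⟨⟨s.1, i.1⟩, Sigma.ext rfl (heq_of_eq i.2)⟩
  invFun t := ⟨(congrArg Sigma.fst t.2) ▸ t.1.2, by
    obtain ⟨⟨k, i⟩, rfl⟩ := t
    rfl⟩
  left_inv _ := rfl
  right_inv t := by
    obtain ⟨⟨k, i⟩, rfl⟩ := t
    rfl

/-- The horizontal composite of a family. -/
noncomputable def fbig {I J : K → Type} [∀ k, Listed (I k)] {a : ∀ k, I k → O.Col}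
    {b : ∀ k, J k → O.Col} (x : ∀ k, FreeOp O (a k) (b k)) :
    FreeOp O (fun s : Σ k, I k => a s.1 s.2) (fun s : Σ k, J k => b s.1 s.2) :=
  ⟨fun s => ⟨s.1, (x s.1).fn s.2⟩, fun s =>
    rel (a := fun i : {i // (x s.1).fn i = s.2} => a s.1 i) (fibSigma (fun k => (x k).fn) s)
      (pf fun _ => rfl) rfl ((x s.1).op s.2)⟩

theorem frel_eq {a : I → O.Col} {a' : I' → O.Col} {b : J → O.Col} {b' : J' → O.Col} {σ : I ≃ I'}
    {τ : J ≃ J'} (ha : ∀ i, a' (σ i) = a i) (hb : ∀ j, b' (τ j) = b j) {x : FreeOp O a b}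
    {y : FreeOp O a' b'} (h : ∀ i, y.fn (σ i) = τ (x.fn i))
    (h' : ∀ j, y.op (τ j) = rel (a := fun i : {i // x.fn i = j} => a i)
      (σ.subtypeEquiv fun i => by rw [h, τ.apply_eq_iff_eq]) (pf fun i => ha i) (hb j) (x.op j)) :
    frel σ τ ha hb x = y := by
  refine ext' ?_ ?_
  · intro i
    obtain ⟨i, rfl⟩ := σ.surjective i
    dsimp only [frel]
    rw [σ.symm_apply_apply, h]
  · intro j
    obtain ⟨j, rfl⟩ := τ.surjective j
    dsimp only [frel]
    refine (h' j).trans (Eq.trans ?_ (rel_rel ..).symm)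
    exact (fib x (τ.symm_apply_apply j) _ _ _ _ _ _ fun _ _ _ => rfl).symm

theorem fbig_succ {n : ℕ} {I J : Fin (n + 1) → Type} [∀ k, Listed (I k)] [∀ k, Listed (J k)]
    {a : ∀ k, I k → O.Col} {b : ∀ k, J k → O.Col} (x : ∀ k, FreeOp O (a k) (b k)) :
    frel (a' := fun s : Σ k, I k => a s.1 s.2) (b' := fun s : Σ k, J k => b s.1 s.2)
      (sigmaSucc I) (sigmaSucc J) (pf <| by rintro (i | i) <;> rfl)
      (pf <| by rintro (i | i) <;> rfl) (fhc (x 0) (fbig fun k => x k.succ)) = fbig x := by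
  refine frel_eq _ _ (by rintro (i | i) <;> rfl) ?_
  rintro (j | j)
  · dsimp only [fhc, fbig]
    refine Eq.trans ?_ (rel_rel ..).symm
    exact ColoredOperad.rel_congr _ _ _ _ ((x 0).op j) fun _ => rfl
  · dsimp only [fhc, fbig]
    refine Eq.trans ?_ ((congrArg _ (rel_rel ..)).trans (rel_rel ..)).symm
    exact ColoredOperad.rel_congr _ _ _ _ ((x j.1.succ).op j.2) fun _ => rfl

theorem fbig_equiv {Q : Type} [Listed Q] {I J : K → Type} [∀ k, Listed (I k)] [∀ k, Listed (J k)]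
    {a : ∀ k, I k → O.Col} {b : ∀ k, J k → O.Col} (e : Q ≃ K) (x : ∀ k, FreeOp O (a k) (b k)) :
    frel (a := fun s : Σ q, I (e q) => a (e s.1) s.2) (b := fun s : Σ q, J (e q) => b (e s.1) s.2)
      (a' := fun s : Σ k, I k => a s.1 s.2) (b' := fun s : Σ k, J k => b s.1 s.2)
      (Equiv.sigmaCongrLeft e) (Equiv.sigmaCongrLeft e) (pf fun _ => rfl)
      (pf fun _ => rfl) (fbig fun k => x (e k)) = fbig x := by
  refine frel_eq _ _ (fun _ => rfl) fun j => ?_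
  dsimp only [fbig]
  refine Eq.trans ?_ (rel_rel ..).symm
  exact ColoredOperad.rel_congr _ _ _ _ ((x (e j.1)).op j.2) fun _ => rfl

/-- The fibres of the projection from a disjoint union. -/
def fibFst (I : J → Type) (j : J) : I j ≃ {s : Σ j, I j // s.1 = j} where
  toFun i := ⟨⟨j, i⟩, rfl⟩
  invFun t := t.2 ▸ t.1.2
  left_inv _ := rfl
  right_inv t := by
    obtain ⟨⟨k, i⟩, rfl⟩ := t
    rfl

/-- The horizontal composite of operations with one output each. -/
noncomputable def fone {I : J → Type} [∀ j, Listed (I j)] {a : ∀ j, I j → O.Col} {b : J → O.Col}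
    (f : ∀ j, O.Ext (a j) (b j)) : FreeOp O (fun s : Σ j, I j => a s.1 s.2) b :=
  ⟨fun s => s.1, fun j => rel (a := a j) (a' := fun s : {s : Σ j, I j // s.1 = j} => a s.1.1 s.1.2)
    (fibFst I j) (pf fun _ => rfl) rfl (f j)⟩

theorem fbig_feta {I : J → Type} [∀ j, Listed (I j)] {a : ∀ j, I j → O.Col} {b : J → O.Col}
    (f : ∀ j, O.Ext (a j) (b j)) :
    frel (a := fun s : Σ j, I j => a s.1 s.2) (a' := fun s : Σ j, I j => a s.1 s.2)
      (b := fun s : Σ _ : J, Fin 1 => b s.1) (b' := b) (Equiv.refl _) (sigmaOnes J)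
      (pf fun _ => rfl) (pf fun _ => rfl)
      (fbig (b := fun j _ => b j) fun j => feta (f j)) = fone f := by
  refine frel_eq _ _ (fun _ => rfl) ?_
  rintro ⟨j, k⟩
  dsimp only [fbig, feta, fone]
  refine Eq.trans ?_ ((congrArg _ (rel_rel ..)).trans (rel_rel ..)).symm
  exact ColoredOperad.rel_congr _ _ _ _ (f j) fun _ => rfl

theorem fvc_feta {I : J → Type} [∀ j, Listed (I j)] {a : ∀ j, I j → O.Col} {b : J → O.Col}
    {c : O.Col} (g : O.Ext b c) (f : ∀ j, O.Ext (a j) (b j)) :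
    fvc (feta g) (fone f) = feta (cp g f) := by
  refine ext' (fun _ => rfl) fun k => ?_
  dsimp only [fvc, feta, fone]
  have h := cp_rel_rel (O := O) (J := J) (Q := {_j : J // (0 : Fin 1) = k}) (I := I)
    (I' := fun q => {s : Σ j, I j // s.1 = q.1}) (b := b) (b' := fun q => b q.1)
    (a := a) (a' := fun _ s => a s.1.1 s.1.2) (fibOne J k) (fun _ => rfl) rfl
    (fun j => fibFst I j) (fun _ _ => rfl) g f
    (fun q => rel (a := a q.1) (a' := fun s : {s : Σ j, I j // s.1 = q.1} => a s.1.1 s.1.2)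
      (fibFst I q.1) (pf fun _ => rfl) rfl (f q.1)) fun _ => rfl
  refine Eq.trans ?_ ((congrArg _ ((congrArg _ h).trans (rel_rel ..))).trans (rel_rel ..)).symm
  exact ColoredOperad.rel_congr _ _ _ _ (cp g f) fun _ => rfl

end FreeOp
end PropOperad

namespace PropOperad
open Listed FreeOp

section
variable {O : ColoredOperad.{u}}
variable {I I' J J' K : Type} [Listed I] [Listed I'] [Listed J] [Listed J'] [Listed K]

/-- Operations of the free prop between lists, in terms of the index sets. -/
noncomputable def toFree {a : I → O.Col} {b : J → O.Col} (x : (freeProp O).Ext a b) : FreeOp O a b :=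
  frel (I := Fin (size I)) (J := Fin (size J)) (a := fun i => a (enum i)) (a' := a)
    (b := fun j => b (enum j)) (b' := b) enum enum (fun _ => rfl) (fun _ => rfl) x

theorem toFree_inj {a : I → O.Col} {b : J → O.Col} {x y : (freeProp O).Ext a b}
    (h : toFree x = toFree y) : x = y := by
  have e (z : (freeProp O).Ext a b) : frel (a := a) (a' := fun i => a (enum i))
      (b := b) (b' := fun i => b (enum i)) (enum (I := I)).symm
      (enum (I := J)).symm (pf fun i => congrArg a (enum.apply_symm_apply i))
      (pf fun i => congrArg b (enum.apply_symm_apply i)) (toFree z) = z := by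
    refine (frel_frel (a := fun i => a (enum i)) (a' := a) (a'' := fun i => a (enum i))
      (b := fun i => b (enum i)) (b' := b) (b'' := fun i => b (enum i)) ..).trans ?_
    exact frel_id (a := fun i => a (enum i)) (b := fun i => b (enum i)) _ _ _
      (fun i => enum.symm_apply_apply i) (fun i => enum.symm_apply_apply i)
  rw [← e x, h, e]

theorem toFree_rel {a : I → O.Col} {a' : I' → O.Col} {b : J → O.Col} {b' : J' → O.Col} (σ : I ≃ I')
    (τ : J ≃ J') (ha : ∀ i, a' (σ i) = a i) (hb : ∀ j, b' (τ j) = b j) (x : (freeProp O).Ext a b) :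
    toFree (ColoredProp.rel (T := freeProp O) (a := a) (a' := a') (b := b) (b' := b') σ τ ha hb x) =
      frel σ τ ha hb (toFree x) := by
  unfold toFree ColoredProp.rel
  refine (congrArg _ (free_act (a := fun i => a (enum i)) (a' := fun i => a' (enum i))
    (b := fun i => b (enum i)) (b' := fun i => b' (enum i)) ..)).trans ?_
  refine (frel_frel (a := fun i => a (enum i)) (a' := fun i => a' (enum i)) (a'' := a')
    (b := fun i => b (enum i)) (b' := fun i => b' (enum i)) (b'' := b') ..).trans
    (Eq.trans ?_ (frel_frel (a := fun i => a (enum i)) (a' := a) (a'' := a')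
    (b := fun i => b (enum i)) (b' := b) (b'' := b') ..).symm)
  refine frel_congr (a := fun i => a (enum i)) (b := fun i => b (enum i)) _ _ _ _ x ?_ ?_
  · intro i
    simp
  · intro i
    simp

theorem toFree_hc {a : I → O.Col} {b : J → O.Col} {a' : I' → O.Col} {b' : J' → O.Col}
    (x : (freeProp O).Ext a b) (y : (freeProp O).Ext a' b') :
    toFree (ColoredProp.hc (T := freeProp O) (a := a) (b := b) (a' := a') (b' := b') x y) =
      fhc (toFree x) (toFree y) := by
  unfold toFree ColoredProp.hc
  refine Eq.trans ?_ (fhc_frel (a := fun i => a (enum i)) (a' := a) (b := fun i => b (enum i))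
    (b' := b) (c := fun i => a' (enum i)) (c' := a') (d := fun i => b' (enum i)) (d' := b') ..).symm
  refine (congrArg _ (free_act (a := Fin.append (fun i => a (enum i)) fun i => a' (enum i))
    (a' := fun i => Sum.elim a a' (enum i))
    (b := Fin.append (fun i => b (enum i)) fun i => b' (enum i))
    (b' := fun i => Sum.elim b b' (enum i)) ..)).trans ?_
  refine ((congrArg _ (congrArg _ (free_hcomp (a := fun i => a (enum i)) (b := fun i => b (enum i))
    (a' := fun i => a' (enum i)) (b' := fun i => b' (enum i)) x y))).trans
    ((congrArg _ (frel_frel ..)).trans (frel_frel ..))).trans ?_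
  refine frel_congr _ _ _ _ (fhc (a := fun i => a (enum i)) (b := fun i => b (enum i))
    (a' := fun i => a' (enum i)) (b' := fun i => b' (enum i)) x y) ?_ ?_
  · rintro (i | i)
    · exact enum_castAdd i
    · exact enum_natAdd i
  · rintro (i | i)
    · exact enum_castAdd i
    · exact enum_natAdd i

theorem toFree_vc {a : I → O.Col} {b : J → O.Col} {c : K → O.Col}
    (x : (freeProp O).Ext b c) (y : (freeProp O).Ext a b) :
    toFree (ColoredProp.vc (T := freeProp O) (a := a) (b := b) (c := c) x y) =
      fvc (toFree x) (toFree y) :=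
  (fvc_frel (a := fun i => a (enum i)) (a' := a) (b := fun i => b (enum i))
    (b' := b) (c := fun i => c (enum i)) (c' := c) enum enum enum enum (fun _ => rfl)
    (fun _ => rfl) (fun _ => rfl) (fun _ => rfl) (fun _ => rfl) x y).symm

theorem toFree_hl {n : ℕ} {I J : Fin n → Type} [∀ i, Listed (I i)] [∀ i, Listed (J i)]
    {a : ∀ i, I i → O.Col} {b : ∀ i, J i → O.Col} (f : ∀ i, (freeProp O).Ext (a i) (b i)) :
    toFree (ColoredProp.hl (T := freeProp O) (a := a) (b := b) f) = fbig fun i => toFree (f i) := by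
  induction n with
  | zero =>
    have : IsEmpty (Σ i : Fin 0, I i) := ⟨fun s => s.1.elim0⟩
    have : IsEmpty (Σ i : Fin 0, J i) := ⟨fun s => s.1.elim0⟩
    exact fil_empty _ _
  | succ n ih =>
    refine (toFree_rel ..).trans ((congrArg _ ((toFree_hc ..).trans (congrArg _
      (ih fun i => f i.succ)))).trans ?_)
    exact fbig_succ fun i => toFree (f i)

theorem toFree_big {I J : K → Type} [∀ i, Listed (I i)] [∀ i, Listed (J i)]
    {a : ∀ i, I i → O.Col} {b : ∀ i, J i → O.Col} (f : ∀ i, (freeProp O).Ext (a i) (b i)) :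
    toFree (ColoredProp.big (T := freeProp O) (a := a) (b := b) f) = fbig fun i => toFree (f i) :=
  (toFree_rel ..).trans ((congrArg _ (toFree_hl fun k => f (enum k))).trans
    (fbig_equiv (Q := Fin (size K)) enum fun k => toFree (f k)))

end
end PropOperad

namespace PropOperad
open Listed FreeOp ColoredOperad

section
variable {O : ColoredOperad.{u}}
variable {I I' J J' K : Type} [Listed I] [Listed I'] [Listed J] [Listed J'] [Listed K]

theorem toFree_fin {n m : ℕ} {a : Fin n → O.Col} {b : Fin m → O.Col} (x : FreeOp O a b) :
    toFree (I := Fin n) (J := Fin m) (a := a) (b := b) x = x :=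
  frel_id (a := a) (b := b) (fun _ => rfl) (fun _ => rfl) x (fun _ => rfl) (fun _ => rfl)

theorem toFree_feta {a : I → O.Col} {c : O.Col} (x : O.Ext a c) :
    toFree (O := O) (a := a) (b := fun _ : Fin 1 => c)
      (feta (I := Fin (size I)) (a := fun i => a (enum i)) x) = feta x := by
  refine (frel_feta (I := Fin (size I)) (a := fun i => a (enum i)) (a' := a) enum
    (fun _ => rfl) x).trans (congrArg _ ?_)
  refine (O.perm_refl _).symm.trans ?_ |>.symm
  refine ColoredOperad.perm_congr _ _ (fun i => ?_) x
  exact (enum.symm_apply_apply i).symm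

theorem toFree_hs {I : J → Type} [∀ j, Listed (I j)] {a : ∀ j, I j → O.Col} {b : J → O.Col}
    (f : ∀ j, O.Ext (a j) (b j)) :
    toFree (ColoredProp.hs (T := freeProp O) (a := a) (b := b)
      fun j => feta (I := Fin (size (I j))) (a := fun i => a j (enum i)) (f j)) = fone f := by
  unfold ColoredProp.hs
  refine (toFree_rel ..).trans ((congrArg _ ((toFree_big ..).trans (congrArg fbig (funext fun j =>
    toFree_feta (f j))))).trans ?_)
  exact fbig_feta f

end

theorem feta_id {O : ColoredOperad.{u}} (c : O.Col) :
    feta (I := Fin 1) (a := fun _ : Fin 1 => c) (O.id c) = fil fun _ : Fin 1 => c := by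
  refine ext' (fun _ => Subsingleton.elim (α := Fin 1) _ _) fun j => ?_
  dsimp only [feta, fil]
  refine Eq.trans ?_ (rel_rel ..).symm
  exact ColoredOperad.rel_congr (I := Fin 1) (a := fun _ : Fin 1 => c) _ _ _ _ (O.id c)
    fun i => Subtype.ext (Subsingleton.elim (α := Fin 1) _ _)

/-- The unit of the adjunction: the map from an operad to the operad underlying the free prop on it,
which is the identity on colours and takes `x` to `(*, x)`. -/
noncomputable def adjUnit (O : ColoredOperad.{u}) : O ⟶ U.obj (freeProp O) where
  col c := c
  map {n a c} x := feta (I := Fin n) (a := a) x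
  map_id c := feta_id c
  map_perm {n n' a a' c} σ h x := by
    have hs : ∀ i, a' (σ.symm i) = a i :=
      fun i => (h _).trans (congrArg a (σ.apply_symm_apply i))
    exact (frel_feta (I := Fin n) (I' := Fin n') (a := a) (a' := a') σ.symm hs x).symm
  map_comp {n p a c b} g f := by
    refine toFree_inj (I := Σ i, Fin (p i)) (J := Fin 1) (a := fun s => b s.1 s.2)
      (b := fun _ => c) ?_
    refine (toFree_feta (I := Σ i, Fin (p i)) (a := fun s => b s.1 s.2) _).trans ?_
    refine (fvc_feta (J := Fin n) (I := fun i => Fin (p i)) (a := b) (b := a) g f).symm.trans ?_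
    refine Eq.trans ?_ (toFree_vc (O := O) (I := Σ i, Fin (p i)) (J := Fin n) (K := Fin 1)
      (a := fun s => b s.1 s.2) (b := a) (c := fun _ => c) ..).symm
    exact congrArg₂ fvc (toFree_fin (feta (I := Fin n) (a := a) g)).symm
      (toFree_hs (J := Fin n) (I := fun i => Fin (p i)) (a := b) (b := a) f).symm

end PropOperad

/-!
The free prop `F O` is generated by the operad `O`: every operation `(θ, ⟨f_j⟩_j)` is, up to the
order of its inputs, the horizontal composite of the operations `(*, f_j)` (`freeOp_eq_rel_hs`).

Hence a map of props `f` out of `F O` is determined by `U f ∘ η`. Conversely a map of operads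
`G : O → U T` extends to `F O` by sending `(θ, ⟨f_j⟩_j)` to `⟨G f_j⟩_j` with its inputs, which come
grouped by the fibres of `θ`, put back in order (`liftOp`). Compatibility with relabelling and
horizontal composition is reindexing of horizontal composites; compatibility with vertical
composition (`liftOp_fvc`) is the interchange law, in the form `hs_hs`. So `lift` is inverse to
`f ↦ U f ∘ η` (`adjoint_lift`, `lift_adjoint`).

For the internal homs, fix a family `ξ` with one output. The operations `φ` of a prop at which `ξ`
satisfies the naturality condition are closed under relabelling, horizontal composition and the
empty composite (`NaturalAt.rel`, `NaturalAt.hc`, `naturalAt_un`). At an operation `(*, φ)` the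
condition is that of operad naturality at `φ` (`naturalAt_one_iff`). As these operations generate
`F O`, the two notions of naturality agree (`isNatural_iff_isOperadNatural`), and keeping components
identifies the operations of the two internal homs. It respects composition because evaluation at a
colour is a map of props from the mapping prop (`evalAt`), so that horizontal composites of families
are computed componentwise.
-/

namespace PropOperad
open Listed ColoredProp FreeOp

/-! ### Composition in the operad underlying a prop -/

section
variable {T : ColoredProp.{u}}
variable {I I' J : Type} [Listed I] [Listed I'] [Listed J]

theorem underlying_rel {a : I → T.Col} {a' : I' → T.Col} {c c' : T.Col} (σ : I ≃ I')
    (ha : ∀ i, a' (σ i) = a i) (hc : c' = c) (x : (U.obj T).Ext a c) :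
    ColoredOperad.rel (O := U.obj T) (a := a) (a' := a') σ ha hc x =
      rel (T := T) (a := a) (a' := a') (b := fun _ : Fin 1 => c) (b' := fun _ : Fin 1 => c') σ
        (Equiv.refl _) ha (pf fun _ => hc.symm ▸ rfl) x := by
  subst hc
  refine inp_eq_rel (T := T) (a := a) (a' := a') (b := fun _ : Fin 1 => c') σ _ _ (fun k => ?_) ha x
  simp

/-- The composite `hs` is insensitive to replacing index sets by their enumerations. It is what
identifies the composition of `U T`, which is formed over `Fin`, with composition over arbitrary
finite ordered index sets. -/
theorem hs_enum {I : J → Type} [∀ j, Listed (I j)] {a : ∀ j, I j → T.Col} {b : J → T.Col}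
    (f : ∀ j, T.Ext (a j) (fun _ : Fin 1 => b j)) :
    hs (J := Fin (size J)) (I := fun k => Fin (size (I (enum k))))
      (a := fun k i => a (enum k) (enum i)) (b := fun k => b (enum k)) (fun k => f (enum k)) =
      hs (a := a) (b := b) f := by
  have e : (fun k : Fin (size J) => f (enum k)) = fun k => rel (a := fun i => a (enum k) (enum i))
      (a' := a (enum k)) (b := fun _ : Fin 1 => b (enum k)) (b' := fun _ : Fin 1 => b (enum k))
      (enum : Fin (size (I (enum k))) ≃ _) (Equiv.refl _) (pf fun _ => rfl) (pf fun _ => rfl)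
      (f (enum k)) := by
    funext k
    refine (T.act_id _ _ (fun i => ?_) (fun _ => rfl) _).symm
    exact enum.symm_apply_apply i
  refine Eq.symm ((hs_equiv (a := a) (b := b) enum f).trans ((congrArg _ ((congrArg _ e).trans
    (hs_rel (a := fun k i => a (enum k) (enum i)) (a' := fun k => a (enum k))
      (b := fun k => b (enum k)) (fun k => enum) (fun _ _ => rfl) fun k => f (enum k)))).trans
    ((rel_rel ..).trans (T.act_id _ _ (fun i => ?_) (fun i => ?_) _))))
  · exact (congrArg finSigmaFinEquiv (Equiv.symm_apply_apply
      ((Equiv.sigmaCongrRight fun k => (enum : _ ≃ I (enum k))).trans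
        (Equiv.sigmaCongrLeft (β := I) (enum : _ ≃ J))) (finSigmaFinEquiv.symm i))).trans
      (finSigmaFinEquiv.apply_symm_apply i)
  · exact Equiv.symm_apply_apply _ _

theorem underlying_cp {I : J → Type} [∀ j, Listed (I j)] {b : J → T.Col} {c : T.Col}
    {a : ∀ j, I j → T.Col} (g : (U.obj T).Ext b c) (f : ∀ j, (U.obj T).Ext (a j) (b j)) :
    ColoredOperad.cp (O := U.obj T) (b := b) (a := a) g f =
      vc (T := T) (a := fun s : Σ j, I j => a s.1 s.2) (b := b) (c := fun _ : Fin 1 => c) g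
        (hs (a := a) (b := b) f) :=
  congrArg (T.vcomp g) (hs_enum (a := a) (b := b) f)

end

section
variable {O M : ColoredOperad.{u}} {T : ColoredProp.{u}}
variable {I I' J J' K Q : Type} [Listed I] [Listed I'] [Listed J] [Listed J'] [Listed K]
  [Listed Q]

theorem OperadHom.map_rel (G : OperadHom O M) {a : I → O.Col} {a' : I' → O.Col} {c c' : O.Col}
    (σ : I ≃ I') (ha : ∀ i, a' (σ i) = a i) (hc : c' = c) (x : O.Ext a c) :
    G.map (ColoredOperad.rel (a := a) (a' := a') σ ha hc x) =
      ColoredOperad.rel (O := M) (a := fun i => G.col (a i)) (a' := fun i => G.col (a' i)) σ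
        (pf fun i => congrArg G.col (ha i)) (congrArg G.col hc) (G.map x) := by
  subst hc
  exact G.map_perm ..

theorem OperadHom.map_cp (G : OperadHom O M) {I : J → Type} [∀ j, Listed (I j)] {b : J → O.Col}
    {c : O.Col} {a : ∀ j, I j → O.Col} (g : O.Ext b c) (f : ∀ j, O.Ext (a j) (b j)) :
    G.map (ColoredOperad.cp (b := b) (a := a) g f) =
      ColoredOperad.cp (O := M) (b := fun j => G.col (b j)) (a := fun j i => G.col (a j i))
        (G.map g) fun j => G.map (f j) :=
  G.map_comp ..

/-! ### Horizontal composites of operations with one output -/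

/-- Reindexing of a horizontal composite along bijections of the outputs and of the inputs of each
factor; the analogue for props of `ColoredOperad.cp_rel_rel`. -/
theorem hs_reindex {I : J → Type} {I' : Q → Type} [∀ j, Listed (I j)] [∀ q, Listed (I' q)]
    {a : ∀ j, I j → T.Col} {b : J → T.Col} {a' : ∀ q, I' q → T.Col} {b' : Q → T.Col} (σ : J ≃ Q)
    (hb : ∀ j, b' (σ j) = b j) (ε : ∀ j, I j ≃ I' (σ j)) (ha : ∀ j i, a' (σ j) (ε j i) = a j i)
    (f : ∀ j, T.Ext (a j) (fun _ : Fin 1 => b j)) (f' : ∀ q, T.Ext (a' q) (fun _ : Fin 1 => b' q))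
    (hf : ∀ j, f' (σ j) = rel (a := a j) (a' := a' (σ j)) (b := fun _ : Fin 1 => b j)
      (b' := fun _ : Fin 1 => b' (σ j)) (ε j) (Equiv.refl _) (ha j) (pf fun _ => hb j) (f j)) :
    hs (a := a') (b := b') f' =
      rel (a := fun s : Σ j, I j => a s.1 s.2) (a' := fun s : Σ q, I' q => a' s.1 s.2) (b := b)
        (b' := b') ((Equiv.sigmaCongrRight ε).trans (Equiv.sigmaCongrLeft σ)) σ
        (pf fun s => ha s.1 s.2) hb (hs (a := a) (b := b) f) := by
  obtain rfl : (fun j => b' (σ j)) = b := funext hb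
  refine (hs_equiv (a := a') (b := b') σ f').trans ?_
  refine (congrArg _ ((congrArg _ (funext hf)).trans
    (hs_rel (a := a) (a' := fun j => a' (σ j)) (b := fun j => b' (σ j)) ε ha f))).trans ?_
  refine (rel_rel ..).trans ?_
  exact rel_congr _ _ _ _ (hs (a := a) (b := fun j => b' (σ j)) f) (fun _ => rfl) fun _ => rfl

theorem hs_sum {I : J ⊕ J' → Type} [∀ j, Listed (I j)] {a : ∀ j, I j → T.Col} {b : J ⊕ J' → T.Col}
    (f : ∀ j, T.Ext (a j) (fun _ : Fin 1 => b j)) :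
    hs (a := a) (b := b) f =
      rel (a' := fun s : Σ j, I j => a s.1 s.2) (b' := b) (Equiv.sumSigmaDistrib I).symm
        (Equiv.refl _) (pf <| by rintro (i | i) <;> rfl) (pf <| by rintro (i | i) <;> rfl)
        (hc (hs (a := fun j => a (.inl j)) (b := fun j => b (.inl j)) fun j => f (.inl j))
          (hs (a := fun j => a (.inr j)) (b := fun j => b (.inr j)) fun j => f (.inr j))) := by
  unfold hs
  refine (congrArg _ (big_sum f)).trans ((rel_rel ..).trans (Eq.trans ?_
    ((congrArg _ (hc_rel ..)).trans (rel_rel ..)).symm))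
  refine rel_congr _ _ _ _ (hc (big fun j => f (.inl j)) (big fun j => f (.inr j))) ?_ ?_ <;>
    rintro (i | i) <;> rfl

/-! ### The extension of an operad map to the free prop -/

/-- The value at `(θ, ⟨f_j⟩_j)` of the extension of `G` to the free prop: the horizontal composite
`⟨G f_j⟩_j`, with its inputs, which are grouped by the fibres of `θ`, put back in their order. -/
noncomputable def liftOp (G : OperadHom O (U.obj T)) {a : I → O.Col} {b : J → O.Col}
    (x : FreeOp O a b) : T.Ext (fun i => G.col (a i)) (fun j => G.col (b j)) :=
  rel (a := fun s : Σ j, {i // x.fn i = j} => G.col (a s.2)) (b := fun j => G.col (b j))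
    (Equiv.sigmaFiberEquiv x.fn) (Equiv.refl _) (pf fun _ => rfl) (pf fun _ => rfl)
    (hs (T := T) (I := fun j => {i // x.fn i = j}) (a := fun _ i => G.col (a i))
      (b := fun j => G.col (b j)) fun j => G.map (x.op j))

variable (G : OperadHom O (U.obj T))

/-- Operad maps into `U T` turn relabelling of inputs into the relabelling of `T`; a change of the
output colour becomes a relabelling of the one-element list of outputs. -/
theorem map_rel_underlying {a : I → O.Col} {a' : I' → O.Col} {c c' : O.Col}
    (σ : I ≃ I') (ha : ∀ i, a' (σ i) = a i) (hc : c' = c) (x : O.Ext a c) :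
    G.map (ColoredOperad.rel (a := a) (a' := a') σ ha hc x) =
      rel (T := T) (a := fun i => G.col (a i)) (a' := fun i => G.col (a' i))
        (b := fun _ : Fin 1 => G.col c) (b' := fun _ : Fin 1 => G.col c') σ (Equiv.refl _)
        (pf fun i => congrArg G.col (ha i)) (pf fun _ => congrArg G.col hc) (G.map x) :=
  (G.map_rel ..).trans (underlying_rel ..)

/-- The operation of a relabelled pair over `τ j` is that over `j`, relabelled: this form avoids the
transport along `τ.symm (τ j) = j` in the definition of `frel`. -/
theorem frel_op {J' : Type} {a : I → O.Col} {a' : I' → O.Col} {b : J → O.Col} {b' : J' → O.Col}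
    (σ : I ≃ I') (τ : J ≃ J') (ha : ∀ i, a' (σ i) = a i) (hb : ∀ j, b' (τ j) = b j)
    (x : FreeOp O a b) (j : J) : (frel σ τ ha hb x).op (τ j) =
      ColoredOperad.rel (a := fun i : {i // x.fn i = j} => a i)
        (a' := fun i : {i // τ (x.fn (σ.symm i)) = τ j} => a' i)
        (σ.subtypeEquiv fun i => by rw [σ.symm_apply_apply, τ.apply_eq_iff_eq])
        (pf fun i => ha i) (hb j) (x.op j) :=
  fib x (τ.symm_apply_apply j) (K := {i // τ (x.fn (σ.symm i)) = τ j}) (a' := fun i => a' i)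
    _ _ (fun i => ha i) (fun i => ha i) ((hb j).trans (congrArg b (τ.symm_apply_apply j).symm))
    (hb j) fun _ _ _ => rfl

theorem liftOp_frel {a : I → O.Col} {a' : I' → O.Col} {b : J → O.Col} {b' : J' → O.Col}
    (σ : I ≃ I') (τ : J ≃ J') (ha : ∀ i, a' (σ i) = a i) (hb : ∀ j, b' (τ j) = b j)
    (x : FreeOp O a b) :
    liftOp G (frel σ τ ha hb x) = rel (a' := fun i => G.col (a' i)) (b' := fun j => G.col (b' j))
      σ τ (pf fun i => congrArg G.col (ha i)) (pf fun j => congrArg G.col (hb j))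
      (liftOp G x) := by
  unfold liftOp
  refine (congrArg _ (hs_reindex (T := T) (J := J) (Q := J') (I := fun j => {i // x.fn i = j})
    (I' := fun j => {i // τ (x.fn (σ.symm i)) = j}) (a := fun _ i => G.col (a i))
    (a' := fun _ i => G.col (a' i)) (b := fun j => G.col (b j)) (b' := fun j => G.col (b' j)) τ
    (fun j => congrArg G.col (hb j))
    (fun j => σ.subtypeEquiv fun i => by rw [σ.symm_apply_apply, τ.apply_eq_iff_eq])
    (fun j i => congrArg G.col (ha i)) (fun j => G.map (x.op j))
    (fun j => G.map ((frel σ τ ha hb x).op j)) fun j => ?_)).trans ?_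
  · refine Eq.trans (congrArg _ (frel_op σ τ ha hb x j)) ?_
    exact map_rel_underlying G ..
  · refine (rel_rel ..).trans (Eq.trans ?_ (rel_rel ..).symm)
    exact rel_congr _ _ _ _ (hs (T := T) (I := fun j => {i // x.fn i = j})
      (a := fun _ i => G.col (a i)) (b := fun j => G.col (b j)) fun j => G.map (x.op j))
      (fun _ => rfl) fun _ => rfl

/-- Compatibility with vertical composition. Grouping the fibres of `y` by the outputs of `x` puts
`⟨G y_j⟩_j` in the form required by `hs_hs`, which is interchange for composites of operations with
one output. -/
theorem liftOp_fvc {a : I → O.Col} {b : J → O.Col} {c : K → O.Col} (x : FreeOp O b c)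
    (y : FreeOp O a b) : liftOp G (fvc x y) = vc (liftOp G x) (liftOp G y) := by
  -- The operation over `k` is a composite in `O`, so `G` takes it to a composite in `U T`.
  have h1 : (fun k => (G.map ((fvc x y).op k) :
        T.Ext (fun i : {i // x.fn (y.fn i) = k} => G.col (a i)) (fun _ : Fin 1 => G.col (c k)))) =
      fun k => rel (T := T)
        (a := fun s : Σ j : {j // x.fn j = k}, {i // y.fn i = j.1} => G.col (a s.2))
        (a' := fun i : {i // x.fn (y.fn i) = k} => G.col (a i))
        (b := fun _ : Fin 1 => G.col (c k)) (b' := fun _ : Fin 1 => G.col (c k))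
        (fibEquiv x.fn y.fn k) (Equiv.refl _) (pf fun _ => rfl) (pf fun _ => rfl)
        (vc (T := T) (b := fun j : {j // x.fn j = k} => G.col (b j)) (G.map (x.op k))
          (hs (T := T) (I := fun j : {j // x.fn j = k} => {i // y.fn i = j.1})
            (a := fun _ i => G.col (a i)) (b := fun j : {j // x.fn j = k} => G.col (b j))
            fun j => G.map (y.op j.1))) := by
    funext k
    refine (map_rel_underlying G
      (a := fun s : Σ j : {j // x.fn j = k}, {i // y.fn i = j.1} => a s.2)
      (a' := fun i : {i // x.fn (y.fn i) = k} => a i) (fibEquiv x.fn y.fn k) (fun _ => rfl) rfl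
      _).trans (congrArg _ ((G.map_cp ..).trans ?_))
    exact underlying_cp (T := T) (I := fun j : {j // x.fn j = k} => {i // y.fn i = j.1})
      (b := fun j : {j // x.fn j = k} => G.col (b j))
      (a := fun _ i => G.col (a i)) ..
  have h2 := hs_hs (T := T) (J := K) (I := fun k => {j // x.fn j = k})
    (M := fun _ j => {i // y.fn i = j.1}) (b := fun k => G.col (c k))
    (a := fun _ j => G.col (b j)) (d := fun _ _ i => G.col (a i)) (fun k => G.map (x.op k))
    fun k j => G.map (y.op j.1)
  have h3 := hs_equiv (T := T) (J := Σ k, {j // x.fn j = k}) (Q := J)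
    (I := fun j => {i // y.fn i = j}) (a := fun _ i => G.col (a i)) (b := fun j => G.col (b j))
    (Equiv.sigmaFiberEquiv x.fn) fun j => G.map (y.op j)
  let X := hs (T := T) (J := K) (I := fun k => {j // x.fn j = k}) (a := fun _ j => G.col (b j))
    (b := fun k => G.col (c k)) fun k => G.map (x.op k)
  let Y := hs (T := T) (J := Σ k, {j // x.fn j = k}) (I := fun s => {i // y.fn i = s.2.1})
    (a := fun _ i => G.col (a i)) (b := fun s => G.col (b s.2)) fun s => G.map (y.op s.2.1)
  -- `liftOp G y`, with its outputs indexed by the pairs of an output `k` of `x` and a point over it.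
  have h4 : liftOp G y = rel (T := T)
      (a := fun s : Σ s : Σ k, {j // x.fn j = k}, {i // y.fn i = s.2.1} => G.col (a s.2))
      (b := fun s : Σ k, {j // x.fn j = k} => G.col (b s.2)) (a' := fun i => G.col (a i))
      (b' := fun j => G.col (b j))
      ((Equiv.sigmaCongrLeft (β := fun j => {i // y.fn i = j}) (Equiv.sigmaFiberEquiv x.fn)).trans
        (Equiv.sigmaFiberEquiv y.fn))
      (Equiv.sigmaFiberEquiv x.fn) (pf fun _ => rfl) (pf fun _ => rfl) Y := by
    unfold liftOp
    refine (congrArg _ h3).trans ((rel_rel ..).trans ?_)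
    exact rel_congr _ _ _ _ Y (fun _ => rfl) fun _ => rfl
  have h5 : vc (liftOp G x) (liftOp G y) = rel (T := T)
      (a := fun s : Σ s : Σ k, {j // x.fn j = k}, {i // y.fn i = s.2.1} => G.col (a s.2))
      (b := fun k => G.col (c k)) (a' := fun i => G.col (a i)) (b' := fun k => G.col (c k))
      ((Equiv.sigmaCongrLeft (β := fun j => {i // y.fn i = j}) (Equiv.sigmaFiberEquiv x.fn)).trans
        (Equiv.sigmaFiberEquiv y.fn))
      (Equiv.refl _) (pf fun _ => rfl) (pf fun _ => rfl) (vc X Y) := by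
    rw [h4]
    exact vc_rel _ _ _ _ _ _ _ _ (fun _ => rfl) X Y
  refine Eq.trans ?_ (h5.trans ((congrArg _ h2).trans (rel_rel ..))).symm
  unfold liftOp
  refine (congrArg _ ((congrArg _ h1).trans (hs_rel (T := T) (J := K)
    (a := fun k (s : Σ j : {j // x.fn j = k}, {i // y.fn i = j.1}) => G.col (a s.2))
    (a' := fun k (i : {i // x.fn (y.fn i) = k}) => G.col (a i)) (b := fun k => G.col (c k))
    (fun k => fibEquiv x.fn y.fn k)
    (fun _ _ => rfl) _))).trans ((rel_rel ..).trans ?_)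
  exact rel_congr _ _ _ _ (hs (T := T) (J := K)
    (I := fun k => Σ j : {j // x.fn j = k}, {i // y.fn i = j.1})
    (a := fun _ s => G.col (a s.2)) (b := fun k => G.col (c k)) fun k =>
      vc (T := T) (b := fun j : {j // x.fn j = k} => G.col (b j)) (G.map (x.op k))
        (hs (T := T) (I := fun j : {j // x.fn j = k} => {i // y.fn i = j.1})
          (a := fun _ i => G.col (a i)) (b := fun j : {j // x.fn j = k} => G.col (b j))
          fun j => G.map (y.op j.1))) (fun _ => rfl) fun _ => rfl

theorem liftOp_fhc {a : I → O.Col} {b : J → O.Col} {a' : I' → O.Col} {b' : J' → O.Col}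
    (x : FreeOp O a b) (y : FreeOp O a' b') :
    liftOp G (fhc x y) =
      rel (a' := fun i => G.col (Sum.elim a a' i)) (b' := fun j => G.col (Sum.elim b b' j))
        (Equiv.refl _) (Equiv.refl _) (pf <| by rintro (i | i) <;> rfl)
        (pf <| by rintro (i | i) <;> rfl) (hc (liftOp G x) (liftOp G y)) := by
  have h1 : (fun j => (G.map ((fhc x y).op (.inl j)) :
        T.Ext (fun i : {i // Sum.map x.fn y.fn i = Sum.inl j} => G.col (Sum.elim a a' i))
          (fun _ : Fin 1 => G.col (b j)))) = fun j => rel (T := T)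
        (a := fun i : {i // x.fn i = j} => G.col (a i))
        (a' := fun i : {i // Sum.map x.fn y.fn i = Sum.inl j} => G.col (Sum.elim a a' i))
        (b := fun _ : Fin 1 => G.col (b j)) (b' := fun _ : Fin 1 => G.col (b j))
        (fibInl x.fn y.fn j) (Equiv.refl _) (pf fun _ => rfl) (pf fun _ => rfl)
        (G.map (x.op j)) := funext fun j =>
    map_rel_underlying G (a := fun i : {i // x.fn i = j} => a i)
      (a' := fun i : {i // Sum.map x.fn y.fn i = Sum.inl j} => Sum.elim a a' i)
      (fibInl x.fn y.fn j) (fun _ => rfl) rfl (x.op j)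
  have h2 : (fun j => (G.map ((fhc x y).op (.inr j)) :
        T.Ext (fun i : {i // Sum.map x.fn y.fn i = Sum.inr j} => G.col (Sum.elim a a' i))
          (fun _ : Fin 1 => G.col (b' j)))) = fun j => rel (T := T)
        (a := fun i : {i // y.fn i = j} => G.col (a' i))
        (a' := fun i : {i // Sum.map x.fn y.fn i = Sum.inr j} => G.col (Sum.elim a a' i))
        (b := fun _ : Fin 1 => G.col (b' j)) (b' := fun _ : Fin 1 => G.col (b' j))
        (fibInr x.fn y.fn j) (Equiv.refl _) (pf fun _ => rfl) (pf fun _ => rfl)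
        (G.map (y.op j)) := funext fun j =>
    map_rel_underlying G (a := fun i : {i // y.fn i = j} => a' i)
      (a' := fun i : {i // Sum.map x.fn y.fn i = Sum.inr j} => Sum.elim a a' i)
      (fibInr x.fn y.fn j) (fun _ => rfl) rfl (y.op j)
  have h3 := hs_rel (T := T) (J := J) (a := fun j (i : {i // x.fn i = j}) => G.col (a i))
    (a' := fun j (i : {i // Sum.map x.fn y.fn i = Sum.inl j}) => G.col (Sum.elim a a' i))
    (b := fun j => G.col (b j)) (fibInl x.fn y.fn) (fun _ _ => rfl) fun j => G.map (x.op j)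
  have h4 := hs_rel (T := T) (J := J') (a := fun j (i : {i // y.fn i = j}) => G.col (a' i))
    (a' := fun j (i : {i // Sum.map x.fn y.fn i = Sum.inr j}) => G.col (Sum.elim a a' i))
    (b := fun j => G.col (b' j)) (fibInr x.fn y.fn) (fun _ _ => rfl) fun j => G.map (y.op j)
  unfold liftOp
  refine (congrArg _ (hs_sum (T := T)
    (I := fun j => {i // Sum.map x.fn y.fn i = j}) (a := fun _ i => G.col (Sum.elim a a' i))
    (b := fun j => G.col (Sum.elim b b' j)) fun j => G.map ((fhc x y).op j))).trans ?_
  refine ((congrArg _ (congrArg _ (congrArg₂ hc ((congrArg _ h1).trans h3)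
    ((congrArg _ h2).trans h4)))).trans ((congrArg _ (congrArg _ (hc_rel ..))).trans
    ((congrArg _ (rel_rel ..)).trans (rel_rel ..)))).trans
    (Eq.trans ?_ ((congrArg _ (hc_rel ..)).trans (rel_rel ..)).symm)
  refine rel_congr _ _ _ _ (hc _ _) ?_ ?_ <;> rintro (i | i) <;> rfl

theorem liftOp_fil (a : J → O.Col) : liftOp G (fil a) = il fun j => G.col (a j) := by
  have h1 : (fun j => (G.map ((fil a).op j) :
        T.Ext (fun i : {i // i = j} => G.col (a i)) (fun _ : Fin 1 => G.col (a j)))) =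
      fun j => rel (T := T) (a := fun _ : Fin 1 => G.col (a j))
        (a' := fun i : {i // i = j} => G.col (a i)) (b := fun _ : Fin 1 => G.col (a j))
        (b' := fun _ : Fin 1 => G.col (a j)) (fibId j) (Equiv.refl _) (pf fun _ => rfl) (pf fun _ => rfl) (T.id (G.col (a j))) :=
    funext fun j => (map_rel_underlying G (a := fun _ : Fin 1 => a j)
      (a' := fun i : {i // i = j} => a i) (fibId j) (fun _ => rfl) rfl (O.id (a j))).trans
      (congrArg _ (G.map_id (a j)))
  have h2 := hs_rel (T := T) (J := J) (I := fun _ => Fin 1) (a := fun j _ => G.col (a j))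
    (a' := fun j (i : {i // i = j}) => G.col (a i)) (b := fun j => G.col (a j)) fibId
    (fun _ _ => rfl) fun j => T.id (G.col (a j))
  unfold liftOp
  refine (congrArg _ ((congrArg _ h1).trans (h2.trans (congrArg _ (hs_id _))))).trans ?_
  refine ((congrArg _ (rel_rel ..)).trans (rel_rel ..)).trans ?_
  exact rel_id _ _ _ (fun _ => rfl) fun _ => rfl

theorem liftOp_feta {a : I → O.Col} {c : O.Col} (x : O.Ext a c) :
    liftOp G (feta (a := a) x) = G.map x := by
  have h1 : (fun j => (G.map ((feta (a := a) x).op j) :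
        T.Ext (fun i : {_i : I // (0 : Fin 1) = j} => G.col (a i)) (fun _ : Fin 1 => G.col c))) =
      fun j => rel (T := T) (a := fun i => G.col (a i))
        (a' := fun i : {_i : I // (0 : Fin 1) = j} => G.col (a i))
        (b := fun _ : Fin 1 => G.col c) (b' := fun _ : Fin 1 => G.col c)
        (fibOne I j) (Equiv.refl _) (pf fun _ => rfl) (pf fun _ => rfl) (G.map x) :=
    funext fun j => map_rel_underlying G (a := a)
      (a' := fun i : {_i : I // (0 : Fin 1) = j} => a i) (fibOne I j) (fun _ => rfl) rfl x
  have h2 := hs_rel (T := T) (J := Fin 1) (I := fun _ => I) (a := fun _ i => G.col (a i))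
    (a' := fun j (i : {_i : I // (0 : Fin 1) = j}) => G.col (a i)) (b := fun _ => G.col c)
    (fibOne I) (fun _ _ => rfl) fun _ => G.map x
  unfold liftOp
  refine (congrArg _ ((congrArg _ h1).trans (h2.trans (congrArg _
    (hs_one (T := T) (a := fun i => G.col (a i)) (G.map x)))))).trans ?_
  refine ((congrArg _ (rel_rel ..)).trans (rel_rel ..)).trans ?_
  exact rel_id _ _ _ (fun _ => rfl) fun _ => rfl

end

section
variable {O : ColoredOperad.{u}} {T : ColoredProp.{u}}

/-- The extension of an operad map `O → U T` to a prop map `F O → T`. -/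
noncomputable def lift (G : OperadHom O (U.obj T)) : PropHom (freeProp O) T where
  col := G.col
  map {n m a b} x := liftOp G (I := Fin n) (J := Fin m) (a := a) (b := b) x
  map_id c := (liftOp_fil G (J := Fin 1) fun _ => c).trans (il_one (G.col c))
  map_unit := liftOp_fil G (J := Fin 0) Fin.elim0
  map_vcomp {n m k a b c} f g :=
    liftOp_fvc G (I := Fin n) (J := Fin m) (K := Fin k) (a := a) (b := b) (c := c) f g
  map_hcomp {n m p q a b a' b'} f g := by
    refine (liftOp_frel G (a' := Fin.append a a') (b' := Fin.append b b')
      finSumFinEquiv finSumFinEquiv (elim_finSum a a') (elim_finSum b b') (fhc f g)).trans ?_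
    refine (congrArg _ (liftOp_fhc G (I := Fin n) (J := Fin m) (I' := Fin p) (J' := Fin q)
      (a := a) (b := b) (a' := a') (b' := b') f g)).trans ((rel_rel ..).trans
      ((T.act_act ..).trans ?_))
    refine T.act_congr _ _ _ _ (fun i => ?_) (fun i => ?_) _
    · exact ((Equiv.symm_apply_eq (@enum (Fin n ⊕ Fin p) _)).2 (enum_finSum i).symm)
    · exact (Equiv.eq_symm_apply finSumFinEquiv).1 (enum_finSum (p := m) (p' := q) i)
  map_inp {n n' m a a' b} σ h f := by
    refine (liftOp_frel G (I := Fin n) (I' := Fin n') (J := Fin m) (J' := Fin m) (a := a)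
      (a' := a') (b := b) (b' := b) σ.symm (Equiv.refl _)
      (fun i => (h _).trans (congrArg a (σ.apply_symm_apply i))) (fun _ => rfl) f).trans ?_
    exact (inp_eq_rel (T := T) (I := Fin n) (I' := Fin n') (J := Fin m) (a := fun i => G.col (a i))
      (a' := fun i => G.col (a' i)) (b := fun j => G.col (b j)) σ.symm σ _
      (fun k => (σ.symm_apply_apply k).symm) _ _).symm
  map_out {n m m' a b b'} τ h f := by
    refine (liftOp_frel G (I := Fin n) (I' := Fin n) (J := Fin m) (J' := Fin m') (a := a)
      (a' := a) (b := b) (b' := b') (Equiv.refl _) τ (fun _ => rfl)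
      (fun i => (h _).trans (congrArg b (τ.symm_apply_apply i))) f).trans ?_
    exact (out_eq_rel (T := T) (I := Fin n) (J := Fin m) (J' := Fin m') (a := fun i => G.col (a i))
      (b := fun j => G.col (b j)) (b' := fun j => G.col (b' j)) τ τ _ (fun _ => rfl) _ _).symm

/-! ### The adjunction -/

theorem OperadHom.ext_apply {O M : ColoredOperad.{u}} {F G : OperadHom O M}
    (hcol : ∀ c, F.col c = G.col c)
    (hmap : ∀ {n : ℕ} {a : Fin n → O.Col} {c : O.Col} (x : O.Op a c), HEq (F.map x) (G.map x)) :
    F = G := by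
  obtain ⟨col, map, _, _, _⟩ := F
  obtain ⟨col', map', _, _, _⟩ := G
  obtain rfl : col = col' := funext hcol
  congr
  funext n a c x
  exact eq_of_heq (hmap x)

theorem PropHom.ext_apply {R T : ColoredProp.{u}} {F G : PropHom R T}
    (hcol : ∀ c, F.col c = G.col c)
    (hmap : ∀ {n m : ℕ} {a : Fin n → R.Col} {b : Fin m → R.Col} (x : R.Op a b),
      HEq (F.map x) (G.map x)) : F = G := by
  obtain ⟨col, map, _, _, _, _, _, _⟩ := F
  obtain ⟨col', map', _, _, _, _, _, _⟩ := G
  obtain rfl : col = col' := funext hcol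
  congr
  funext n m a b x
  exact eq_of_heq (hmap x)

/-- The operad map adjoint to a map out of the free prop. -/
noncomputable abbrev adjoint (f : freeProp O ⟶ T) : O ⟶ U.obj T := adjUnit O ≫ U.map f

theorem adjoint_lift (G : O ⟶ U.obj T) : adjoint (lift G) = G :=
  OperadHom.ext_apply (fun _ => rfl) fun {n a _} x =>
    heq_of_eq (liftOp_feta G (I := Fin n) (a := a) x)

/-- Every operation of the free prop is, up to the order of its inputs, a horizontal composite of
operations of the operad. -/
theorem freeOp_eq_rel_hs {n m : ℕ} {a : Fin n → O.Col} {b : Fin m → O.Col} (x : FreeOp O a b) :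
    x = rel (T := freeProp O) (I := Σ j, {i // x.fn i = j}) (I' := Fin n) (J := Fin m)
      (J' := Fin m) (a := fun s => a s.2) (a' := a) (b := b) (b' := b)
      (Equiv.sigmaFiberEquiv x.fn) (Equiv.refl _) (pf fun _ => rfl) (pf fun _ => rfl)
      (hs (T := freeProp O) (J := Fin m) (I := fun j => {i // x.fn i = j}) (a := fun _ i => a i)
        (b := b) fun j => feta (I := Fin (size {i // x.fn i = j}))
          (a := fun i => a (enum (I := {i // x.fn i = j}) i)) (x.op j)) := by
  refine toFree_inj (I := Fin n) (J := Fin m) (a := a) (b := b) ?_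
  refine (toFree_fin x).trans (Eq.trans ?_ ((toFree_rel ..).trans (congrArg _ (toFree_hs
    (J := Fin m) (I := fun j => {i // x.fn i = j}) (a := fun _ i => a i) (b := b) x.op))).symm)
  refine (frel_eq (a := fun s : Σ j, {i // x.fn i = j} => a s.2) (a' := a) (b := b) (b' := b)
    (σ := Equiv.sigmaFiberEquiv x.fn) (τ := Equiv.refl _) (fun _ => rfl) (fun _ => rfl)
    (fun s => s.2.2) fun j => ?_).symm
  dsimp only [fone]
  refine Eq.trans ?_ (ColoredOperad.rel_rel ..).symm
  exact (ColoredOperad.rel_id (a := fun i : {i // x.fn i = j} => a i) _ _ (x.op j)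
    fun _ => rfl).symm

/-- A prop map out of the free prop is determined by its restriction to the operad, as it preserves
relabelling and horizontal composition. -/
theorem lift_adjoint (f : freeProp O ⟶ T) : lift (adjoint f) = f :=
  PropHom.ext_apply (fun _ => rfl) fun {n m a b} x => heq_of_eq (by
    refine Eq.symm ((congrArg (PropHom.map f) (freeOp_eq_rel_hs x)).trans ?_)
    refine (PropHom.app_rel (R := freeProp O) (J := Fin m) (a' := a) (b := b) (b' := b)
      f ..).trans (congrArg _ ?_)
    exact PropHom.app_hs (R := freeProp O) (J := Fin m) (I := fun j => {i // x.fn i = j})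
      (a := fun _ i => a i) (b := b) f ..)

end

/-! ### Operations at which a family is natural -/

section
variable {R T : ColoredProp.{u}} {P Q : Type} [Listed P] [Listed Q]
variable {I I' J J' K : Type} [Listed I] [Listed I'] [Listed J] [Listed J'] [Listed K]

/-- The horizontal composite `⟨f_p φ⟩_p`, with inputs and outputs arranged by those of `φ`: the
version of `simages` for lists indexed by finite ordered sets. -/
def extImages (f : P → PropHom R T) {a : I → R.Col} {b : J → R.Col} (φ : R.Ext a b) :
    T.Ext (fun s : Σ _ : I, P => (f s.2).col (a s.1))
      (fun s : Σ _ : J, P => (f s.2).col (b s.1)) :=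
  rel (a := fun s : Σ _ : P, I => (f s.1).col (a s.2))
    (b := fun s : Σ _ : P, J => (f s.1).col (b s.2))
    (sigmaSwap P I) (sigmaSwap P J) (pf fun _ => rfl) (pf fun _ => rfl)
    (big (I := fun _ => I) (J := fun _ => J) (a := fun p i => (f p).col (a i))
      (b := fun p j => (f p).col (b j)) fun p => (f p).app φ)

/-- The horizontal composite `⟨ξ_{a_i}⟩_i`: the version of `components` for lists indexed by finite
ordered sets. -/
def extComponents {f : P → PropHom R T} {g : Q → PropHom R T}
    (ξ : ∀ c, T.Ext (fun p => (f p).col c) (fun q => (g q).col c)) (a : I → R.Col) :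
    T.Ext (fun s : Σ _ : I, P => (f s.2).col (a s.1))
      (fun s : Σ _ : I, Q => (g s.2).col (a s.1)) :=
  big (I := fun _ => P) (J := fun _ => Q) (a := fun i p => (f p).col (a i))
    (b := fun i q => (g q).col (a i)) fun i => ξ (a i)

/-- The naturality of the family `ξ` at the operation `φ`. -/
def NaturalAt (f : P → PropHom R T) (g : Q → PropHom R T)
    (ξ : ∀ c, T.Ext (fun p => (f p).col c) (fun q => (g q).col c)) {a : I → R.Col} {b : J → R.Col}
    (φ : R.Ext a b) : Prop :=
  vc (extImages g φ) (extComponents ξ a) = vc (extComponents ξ b) (extImages f φ)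

variable {f : P → PropHom R T} {g : Q → PropHom R T}
  {ξ : ∀ c, T.Ext (fun p => (f p).col c) (fun q => (g q).col c)}

theorem isNatural_iff_naturalAt : IsNatural f g ξ ↔
    ∀ ⦃n m : ℕ⦄ ⦃a : Fin n → R.Col⦄ ⦃b : Fin m → R.Col⦄ (φ : R.Op a b),
      NaturalAt (I := Fin n) (J := Fin m) (a := a) (b := b) f g ξ φ :=
  isNatural_iff f g ξ

theorem extImages_rel (f : P → PropHom R T) {a : I → R.Col} {a' : I' → R.Col} {b : J → R.Col}
    {b' : J' → R.Col} (σ : I ≃ I') (τ : J ≃ J') (ha : ∀ i, a' (σ i) = a i)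
    (hb : ∀ j, b' (τ j) = b j) (φ : R.Ext a b) :
    extImages (a := a') (b := b') f (rel σ τ ha hb φ) =
      rel (a' := fun s : Σ _ : I', P => (f s.2).col (a' s.1))
        (b' := fun s : Σ _ : J', P => (f s.2).col (b' s.1))
        (Equiv.sigmaCongrLeft (β := fun _ => P) σ) (Equiv.sigmaCongrLeft (β := fun _ => P) τ)
        (pf fun s => congrArg (f s.2).col (ha s.1)) (pf fun s => congrArg (f s.2).col (hb s.1))
        (extImages f φ) := by
  have h : (fun p => (f p).app (rel σ τ ha hb φ)) = fun p =>
      rel (a' := fun i => (f p).col (a' i)) (b' := fun i => (f p).col (b' i))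
        σ τ (pf fun i => congrArg (f p).col (ha i)) (pf fun i => congrArg (f p).col (hb i))
        ((f p).app φ) := funext fun p => (f p).app_rel σ τ ha hb φ
  unfold extImages
  refine (congrArg _ ((congrArg _ h).trans (big_rel (fun _ => σ) (fun _ => τ) _ _ _))).trans
    ((rel_rel ..).trans (Eq.trans ?_ (rel_rel ..).symm))
  exact rel_congr _ _ _ _ (big fun p => (f p).app φ) (fun _ => rfl) fun _ => rfl

theorem extComponents_rel {a : I → R.Col} {a' : I' → R.Col} (σ : I ≃ I')
    (ha : ∀ i, a' (σ i) = a i) :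
    extComponents ξ a' =
      rel (a' := fun s : Σ _ : I', P => (f s.2).col (a' s.1))
        (b' := fun s : Σ _ : I', Q => (g s.2).col (a' s.1))
        (Equiv.sigmaCongrLeft (β := fun _ => P) σ) (Equiv.sigmaCongrLeft (β := fun _ => Q) σ)
        (pf fun s => congrArg (f s.2).col (ha s.1)) (pf fun s => congrArg (g s.2).col (ha s.1))
        (extComponents ξ a) := by
  obtain rfl : (fun i => a' (σ i)) = a := funext ha
  exact big_equiv σ fun i => ξ (a' i)

theorem NaturalAt.rel {a : I → R.Col} {a' : I' → R.Col} {b : J → R.Col} {b' : J' → R.Col}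
    (σ : I ≃ I') (τ : J ≃ J') (ha : ∀ i, a' (σ i) = a i) (hb : ∀ j, b' (τ j) = b j)
    {φ : R.Ext a b} (h : NaturalAt f g ξ φ) :
    NaturalAt (a := a') (b := b') f g ξ (rel σ τ ha hb φ) := by
  unfold NaturalAt at *
  rw [extImages_rel, extImages_rel, extComponents_rel σ ha, extComponents_rel τ hb]
  refine (vc_rel _ _ _ _ _ _ _ _ (fun _ => rfl) _ _).trans ((congrArg _ h).trans
    (vc_rel _ _ _ _ _ _ _ _ (fun _ => rfl) _ _).symm)

theorem extImages_hc (f : P → PropHom R T) {a : I → R.Col} {a' : I' → R.Col} {b : J → R.Col}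
    {b' : J' → R.Col} (φ : R.Ext a b) (ψ : R.Ext a' b') :
    extImages (a := Sum.elim a a') (b := Sum.elim b b') f (hc φ ψ) =
      rel (a' := fun s : Σ _ : I ⊕ I', P => (f s.2).col (Sum.elim a a' s.1))
        (b' := fun s : Σ _ : J ⊕ J', P => (f s.2).col (Sum.elim b b' s.1))
        (Equiv.sumSigmaDistrib fun _ => P).symm (Equiv.sumSigmaDistrib fun _ => P).symm
        (pf <| by rintro (i | i) <;> rfl) (pf <| by rintro (i | i) <;> rfl)
        (hc (extImages f φ) (extImages f ψ)) := by
  have h : (fun p => (f p).app (hc φ ψ)) = fun p =>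
      rel (a' := fun i => (f p).col (Sum.elim a a' i)) (b' := fun i => (f p).col (Sum.elim b b' i))
        (Equiv.refl _) (Equiv.refl _) (pf <| by rintro (i | i) <;> rfl)
        (pf <| by rintro (i | i) <;> rfl) (hc ((f p).app φ) ((f p).app ψ)) :=
    funext fun p => (f p).app_hc φ ψ
  unfold extImages
  refine (congrArg _ ((congrArg _ h).trans ((big_rel (fun _ => Equiv.refl _) (fun _ => Equiv.refl _)
    _ _ _).trans (congrArg _ (big_hc _ _))))).trans
    (((congrArg _ (rel_rel ..)).trans (rel_rel ..)).trans (Eq.trans ?_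
      ((congrArg _ (hc_rel ..)).trans (rel_rel ..)).symm))
  refine rel_congr _ _ _ _ (hc (big fun p => (f p).app φ) (big fun p => (f p).app ψ)) ?_ ?_ <;>
    rintro (i | i) <;> rfl

theorem extComponents_sum (a : I → R.Col) (a' : I' → R.Col) :
    extComponents ξ (Sum.elim a a') =
      rel (a' := fun s : Σ _ : I ⊕ I', P => (f s.2).col (Sum.elim a a' s.1))
        (b' := fun s : Σ _ : I ⊕ I', Q => (g s.2).col (Sum.elim a a' s.1))
        (Equiv.sumSigmaDistrib fun _ => P).symm (Equiv.sumSigmaDistrib fun _ => Q).symm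
        (pf <| by rintro (i | i) <;> rfl) (pf <| by rintro (i | i) <;> rfl)
        (hc (extComponents ξ a) (extComponents ξ a')) :=
  big_sum fun s => ξ (Sum.elim a a' s)

theorem NaturalAt.hc {a : I → R.Col} {a' : I' → R.Col} {b : J → R.Col} {b' : J' → R.Col}
    {φ : R.Ext a b} {ψ : R.Ext a' b'} (h : NaturalAt f g ξ φ) (h' : NaturalAt f g ξ ψ) :
    NaturalAt (a := Sum.elim a a') (b := Sum.elim b b') f g ξ (hc φ ψ) := by
  unfold NaturalAt at *
  rw [extImages_hc, extImages_hc, extComponents_sum, extComponents_sum]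
  refine (vc_rel _ _ _ _ _ _ _ _ (fun _ => rfl) _ _).trans (Eq.trans (congrArg _ ?_)
    (vc_rel _ _ _ _ _ _ _ _ (fun _ => rfl) _ _).symm)
  rw [← hc_vc, ← hc_vc, h, h']

theorem extImages_un (f : P → PropHom R T) :
    extImages f (un : R.Ext (Fin.elim0 : Fin 0 → R.Col) (Fin.elim0 : Fin 0 → R.Col)) = il _ := by
  have h : (fun p => (f p).app (un : R.Ext _ _)) = fun p =>
      (il fun i : Fin 0 => (f p).col (Fin.elim0 i) : T.Ext _ _) := by
    funext p
    refine ((f p).app_un).trans ?_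
    exact rel_il _ _ _ _ fun _ => rfl
  unfold extImages
  refine (congrArg _ ((congrArg _ h).trans (big_il _))).trans ?_
  exact rel_il _ _ _ _ fun _ => rfl

theorem naturalAt_un : NaturalAt f g ξ
    (un : R.Ext (Fin.elim0 : Fin 0 → R.Col) (Fin.elim0 : Fin 0 → R.Col)) := by
  unfold NaturalAt
  rw [extImages_un, extImages_un, il_vc, vc_il]

theorem naturalAt_hl {n : ℕ} {I J : Fin n → Type} [∀ i, Listed (I i)] [∀ i, Listed (J i)]
    {a : ∀ i, I i → R.Col} {b : ∀ i, J i → R.Col} {φ : ∀ i, R.Ext (a i) (b i)}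
    (h : ∀ i, NaturalAt f g ξ (φ i)) :
    NaturalAt (a := fun s : Σ i, I i => a s.1 s.2) (b := fun s : Σ i, J i => b s.1 s.2) f g ξ
      (hl φ) := by
  induction n with
  | zero => exact naturalAt_un.rel ..
  | succ n ih => exact ((h 0).hc (ih fun i => h i.succ)).rel ..

theorem naturalAt_big {I J : K → Type} [∀ i, Listed (I i)] [∀ i, Listed (J i)]
    {a : ∀ i, I i → R.Col} {b : ∀ i, J i → R.Col} {φ : ∀ i, R.Ext (a i) (b i)}
    (h : ∀ i, NaturalAt f g ξ (φ i)) :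
    NaturalAt (a := fun s : Σ i, I i => a s.1 s.2) (b := fun s : Σ i, J i => b s.1 s.2) f g ξ
      (big φ) :=
  (naturalAt_hl fun k => h (enum k)).rel _ _ (pf fun _ => rfl) (pf fun _ => rfl)

theorem naturalAt_hs {I : J → Type} [∀ j, Listed (I j)] {a : ∀ j, I j → R.Col} {b : J → R.Col}
    {φ : ∀ j, R.Ext (a j) (fun _ : Fin 1 => b j)}
    (h : ∀ j, NaturalAt (b := fun _ : Fin 1 => b j) f g ξ (φ j)) :
    NaturalAt (a := fun s : Σ j, I j => a s.1 s.2) f g ξ (hs (a := a) (b := b) φ) :=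
  (naturalAt_big h).rel ..

end

section
variable {R T : ColoredProp.{u}} {P : Type} [Listed P] {I : Type} [Listed I]
  {f : P → PropHom R T} {g : PropHom R T}
  {ξ : ∀ c, T.Ext (fun p => (f p).col c) (fun _ : Fin 1 => g.col c)}

theorem rel_inj {I I' J J' : Type} [Listed I] [Listed I'] [Listed J] [Listed J']
    {a : I → T.Col} {a' : I' → T.Col} {b : J → T.Col} {b' : J' → T.Col}
    (σ : I ≃ I') (τ : J ≃ J') (ha : ∀ i, a' (σ i) = a i) (hb : ∀ j, b' (τ j) = b j) {x y : T.Ext a b} :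
    rel σ τ ha hb x = rel σ τ ha hb y ↔ x = y := by
  refine ⟨fun h => ?_, fun h => congrArg _ h⟩
  have e (z : T.Ext a b) : rel (a := a') (b := b') (a' := a) (b' := b) σ.symm τ.symm
      (pf fun i => by rw [← ha, σ.apply_symm_apply]) (pf fun i => by rw [← hb, τ.apply_symm_apply])
      (rel σ τ ha hb z) = z := by
    rw [rel_rel]
    exact rel_id _ _ _ (by simp) (by simp)
  rw [← e x, h, e]

/-- For a family with one output, naturality at an operation with one output is the condition for
operads: blocks of length one disappear. -/
theorem naturalAt_one_iff {a : I → R.Col} {c : R.Col} (φ : R.Ext a (fun _ : Fin 1 => c)) :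
    NaturalAt (b := fun _ : Fin 1 => c) f (fun _ : Fin 1 => g) ξ φ ↔
      vc (g.app (b := fun _ : Fin 1 => c) φ) (hs (T := T) (I := fun _ : I => P)
        (a := fun i p => (f p).col (a i)) (b := fun i => g.col (a i)) fun i => ξ (a i)) =
      rel (a := fun s : Σ _ : P, I => (f s.1).col (a s.2))
        (a' := fun s : Σ _ : I, P => (f s.2).col (a s.1)) (b := fun _ : Fin 1 => g.col c)
        (b' := fun _ : Fin 1 => g.col c) (sigmaSwap P I) (Equiv.refl _) (pf fun _ => rfl)
        (pf fun _ => rfl) (vc (ξ c) (hs (T := T) (I := fun _ : P => I)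
          (a := fun p i => (f p).col (a i)) (b := fun p => (f p).col c)
          fun p => (f p).app (b := fun _ : Fin 1 => c) φ)) := by
  have e1 : extImages (b := fun _ : Fin 1 => c) (fun _ : Fin 1 => g) φ =
      rel (a := fun i => g.col (a i)) (a' := fun s : Σ _ : I, Fin 1 => g.col (a s.1))
        (b := fun _ : Fin 1 => g.col c) (b' := fun _ : Σ _ : Fin 1, Fin 1 => g.col c)
        (sigmaOnes I).symm (sigmaOnes (Fin 1)).symm (pf fun _ => rfl) (pf fun _ => rfl)
        (g.app (b := fun _ : Fin 1 => c) φ) := by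
    unfold extImages
    refine (congrArg _ (big_unique (K := Fin 1) (I := fun _ => I) (J := fun _ => Fin 1)
      (a := fun _ i => g.col (a i)) (b := fun _ _ => g.col c) fun _ => g.app
        (b := fun _ : Fin 1 => c) φ)).trans ((rel_rel ..).trans ?_)
    exact rel_congr _ _ _ _ (g.app (b := fun _ : Fin 1 => c) φ) (fun _ => rfl)
      fun _ => (sigmaOnes (Fin 1)).injective (Subsingleton.elim _ _)
  have e2 : extComponents (g := fun _ : Fin 1 => g) ξ a =
      rel (a := fun s : Σ _ : I, P => (f s.2).col (a s.1))
        (a' := fun s : Σ _ : I, P => (f s.2).col (a s.1))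
        (b := fun i => g.col (a i)) (b' := fun s : Σ _ : I, Fin 1 => g.col (a s.1))
        (Equiv.refl _) (sigmaOnes I).symm (pf fun _ => rfl) (pf fun _ => rfl)
        (hs (T := T) (I := fun _ : I => P)
        (a := fun i p => (f p).col (a i)) (b := fun i => g.col (a i)) fun i => ξ (a i)) := by
    refine Eq.symm ((rel_rel ..).trans ?_)
    exact rel_id _ _ _ (fun _ => rfl) fun i => (sigmaOnes I).symm_apply_apply i
  have e3 : extComponents (g := fun _ : Fin 1 => g) ξ (fun _ : Fin 1 => c) =
      rel (a := fun p => (f p).col c) (a' := fun s : Σ _ : Fin 1, P => (f s.2).col c)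
        (b := fun _ : Fin 1 => g.col c) (b' := fun _ : Σ _ : Fin 1, Fin 1 => g.col c)
        (sigmaOne P).symm (sigmaOnes (Fin 1)).symm (pf fun _ => rfl) (pf fun _ => rfl) (ξ c) := by
    refine (big_unique (K := Fin 1) (I := fun _ => P) (J := fun _ => Fin 1)
      (a := fun _ p => (f p).col c) (b := fun _ _ => g.col c) fun _ => ξ c).trans ?_
    exact rel_congr _ _ _ _ (ξ c) (fun _ => rfl)
      fun _ => (sigmaOnes (Fin 1)).injective (Subsingleton.elim _ _)
  have e4 : extImages (b := fun _ : Fin 1 => c) f φ =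
      rel (a := fun s : Σ _ : P, I => (f s.1).col (a s.2))
        (a' := fun s : Σ _ : I, P => (f s.2).col (a s.1)) (b := fun p => (f p).col c)
        (b' := fun s : Σ _ : Fin 1, P => (f s.2).col c)
        (sigmaSwap P I) (sigmaOne P).symm (pf fun _ => rfl) (pf fun _ => rfl)
        (hs (T := T) (I := fun _ : P => I) (a := fun p i => (f p).col (a i))
          (b := fun p => (f p).col c) fun p => (f p).app (b := fun _ : Fin 1 => c) φ) := by
    refine Eq.symm ((rel_rel ..).trans ?_)
    refine rel_congr _ _ _ _ (big fun p => (f p).app (b := fun _ : Fin 1 => c) φ) (fun _ => rfl) ?_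
    exact fun s => Sigma.ext (Subsingleton.elim _ _) HEq.rfl
  unfold NaturalAt
  rw [e1, e2, e3, e4]
  refine Iff.trans (Iff.of_eq (congrArg₂ Eq (vc_rel _ _ _ _ _ _ _ _ (fun _ => rfl) _ _)
    ((vc_rel _ _ _ _ _ _ _ _ (fun _ => rfl) _ _).trans (Eq.trans ?_ (rel_rel ..).symm))))
    (rel_inj (T := T) (I := Σ _ : I, P) (I' := Σ _ : I, P)
      (a := fun s => (f s.2).col (a s.1)) (a' := fun s => (f s.2).col (a s.1))
      (b := fun _ : Fin 1 => g.col c) (b' := fun _ : Σ _ : Fin 1, Fin 1 => g.col c)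
      (Equiv.refl (Σ _ : I, P)) (sigmaOnes (Fin 1)).symm (fun _ => rfl) (fun _ => rfl))
  exact rel_congr _ _ _ _ _ (fun _ => rfl) fun _ => rfl

end

/-! ### Naturality over the free prop -/

section
variable {O : ColoredOperad.{u}} {T : ColoredProp.{u}} {P : Type} [Listed P]

/-- Naturality at an operation may be checked after replacing its index set of inputs by the
enumeration, which is the form in which operations of an operad occur in `freeOp_eq_rel_hs`. -/
theorem naturalAt_of_fin {R : ColoredProp.{u}} {Q : Type} [Listed Q] {f : P → PropHom R T}
    {g : Q → PropHom R T} {ξ : ∀ c, T.Ext (fun p => (f p).col c) (fun q => (g q).col c)}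
    {I : Type} [Listed I] {m : ℕ} {a : I → R.Col} {b : Fin m → R.Col} {φ : R.Ext a b}
    (h : NaturalAt (I := Fin (size I)) (J := Fin m) (a := fun i => a (enum i)) (b := b) f g ξ φ) :
    NaturalAt f g ξ φ := by
  have e : rel (I := Fin (size I)) (a := fun i => a (enum i)) (a' := a) (b := b) (b' := b)
      enum (Equiv.refl (Fin m)) (pf fun _ => rfl) (pf fun _ => rfl) φ = φ :=
    R.act_id _ _ (fun i => enum.symm_apply_apply i) (fun _ => rfl) φ
  rw [← e]
  exact h.rel ..

/-- A family with one output is natural over the free prop if and only if it is natural over the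
operad: the free prop is generated by the operad under relabelling and horizontal composition. -/
theorem isNatural_iff_isOperadNatural (f : P → (freeProp O ⟶ T)) (g : freeProp O ⟶ T)
    (ξ : ∀ c, T.Ext (fun p => PropHom.col (f p) c) (fun _ : Fin 1 => PropHom.col g c)) :
    IsNatural (R := freeProp O) f (fun _ : Fin 1 => g) ξ ↔
      IsOperadNatural (O := O) (M := U.obj T) (fun p => adjoint (f p)) (adjoint g) ξ := by
  -- At an operation `(*, φ)` the two conditions coincide.
  have key {n : ℕ} {a : Fin n → O.Col} {c : O.Col} (φ : O.Op a c) :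
      NaturalAt (R := freeProp O) (I := Fin n) (a := a) (b := fun _ : Fin 1 => c) f
        (fun _ : Fin 1 => g) ξ (feta (I := Fin n) (a := a) φ) ↔
      ColoredOperad.cp (O := U.obj T) (J := Fin n) (I := fun _ => P)
        (b := fun i => PropHom.col g (a i)) (a := fun i p => PropHom.col (f p) (a i))
        (OperadHom.map (adjoint g) φ) (fun i => ξ (a i)) =
      ColoredOperad.rel (O := U.obj T) (a := fun s : Σ _ : P, Fin n => PropHom.col (f s.1) (a s.2))
        (a' := fun s : Σ _ : Fin n, P => PropHom.col (f s.2) (a s.1)) (sigmaSwap P (Fin n))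
        (pf fun _ => rfl) rfl
        (ColoredOperad.cp (O := U.obj T) (J := P) (I := fun _ => Fin n)
          (b := fun p => PropHom.col (f p) c)
          (a := fun p i => PropHom.col (f p) (a i)) (ξ c)
          fun p => OperadHom.map (adjoint (f p)) φ) := by
    refine (naturalAt_one_iff (R := freeProp O) (I := Fin n) (a := a) (c := c) _).trans
      (Iff.of_eq (congrArg₂ Eq ?_ ?_))
    · exact (underlying_cp (T := T) (J := Fin n) (I := fun _ => P)
        (b := fun i => PropHom.col g (a i)) (a := fun i p => PropHom.col (f p) (a i)) ..).symm
    · refine Eq.symm ((underlying_rel (T := T) (a := fun s : Σ _ : P, Fin n =>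
        PropHom.col (f s.1) (a s.2)) (a' := fun s : Σ _ : Fin n, P => PropHom.col (f s.2) (a s.1))
        ..).trans (congrArg _ ?_))
      exact underlying_cp (T := T) (J := P) (I := fun _ => Fin n)
        (b := fun p => PropHom.col (f p) c) (a := fun p i => PropHom.col (f p) (a i)) ..
  rw [isNatural_iff_naturalAt]
  refine ⟨fun h n a c φ => (key φ).1 (h _), fun h n m a b φ => ?_⟩
  rw [freeOp_eq_rel_hs φ]
  refine (naturalAt_hs (R := freeProp O) (J := Fin m) (I := fun j => {i // φ.fn i = j})
    (a := fun _ i => a i) (b := b) fun j => ?_).rel (R := freeProp O) ..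
  refine naturalAt_of_fin (R := freeProp O) (m := 1) (I := {i // φ.fn i = j}) (a := fun i => a i)
    (b := fun _ => b j) ?_
  exact (key (φ.op j)).2 (h (φ.op j))

/-- Naturality over the operad implies naturality over the free prop for the extended maps. -/
theorem isNatural_lift {f : P → (O ⟶ U.obj T)} {g : O ⟶ U.obj T}
    {ξ : ∀ c, (U.obj T).Ext (fun p => OperadHom.col (f p) c) (OperadHom.col g c)}
    (h : IsOperadNatural (O := O) (M := U.obj T) f g ξ) :
    IsNatural (R := freeProp O) (fun p => lift (f p)) (fun _ : Fin 1 => lift g) ξ := by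
  refine (isNatural_iff_isOperadNatural (fun p => lift (f p)) (lift g) ξ).2 fun n a c φ => ?_
  have e (G : O ⟶ U.obj T) : OperadHom.map (adjoint (lift G)) φ = OperadHom.map G φ :=
    liftOp_feta G (I := Fin n) (a := a) φ
  refine (congrArg (fun x => ColoredOperad.cp (O := U.obj T) (J := Fin n) (I := fun _ => P)
    (b := fun i => OperadHom.col g (a i)) (a := fun i p => OperadHom.col (f p) (a i)) x
    fun i => ξ (a i)) (e g)).trans ((h φ).trans (congrArg _ (congrArg _ ?_)))
  exact funext fun p => (e (f p)).symm

end

/-! ### The isomorphism of operads -/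

section
variable {R T : ColoredProp.{u}}

/-- Evaluation at a colour of `R`, as a map of props from the mapping prop. -/
def evalAt (c : R.Col) : PropHom (propHom R T) T where
  col f := f.col c
  map ξ := ξ.1 c
  map_id _ := rfl
  map_unit := rfl
  map_vcomp _ _ := rfl
  map_hcomp _ _ := rfl
  map_inp _ _ _ := rfl
  map_out _ _ _ := rfl

variable {O M : ColoredOperad.{u}}

/-- The types of two families differ by equalities of maps, which are not definitional for
`lift (adjoint f)` and `f`; only the components have to be compared. -/
theorem natTrans_heq {p q : ℕ} {f f' : Fin p → PropHom R T} {g g' : Fin q → PropHom R T}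
    (hf : ∀ i, f i = f' i) (hg : ∀ i, g i = g' i) {ξ : NatTrans f g} {ζ : NatTrans f' g'}
    (h : ∀ c, HEq (ξ.1 c) (ζ.1 c)) : HEq ξ ζ := by
  obtain rfl := funext hf
  obtain rfl := funext hg
  exact heq_of_eq (Subtype.ext (funext fun c => eq_of_heq (h c)))

theorem operadNatTrans_heq {p : ℕ} {f f' : Fin p → OperadHom O M} {g g' : OperadHom O M}
    (hf : ∀ i, f i = f' i) (hg : g = g') {ξ : OperadNatTrans f g} {ζ : OperadNatTrans f' g'}
    (h : ∀ c, HEq (ξ.1 c) (ζ.1 c)) : HEq ξ ζ := by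
  obtain rfl := funext hf
  subst hg
  exact heq_of_eq (Subtype.ext (funext fun c => eq_of_heq (h c)))

end

section
variable (O : ColoredOperad.{u}) (T : ColoredProp.{u})

/-- The map of operads which is `f ↦ U f ∘ η` on colours and keeps the components of a family. -/
noncomputable def homToOperadHom :
    OperadHom (U.obj (propHom (freeProp O) T)) (operadHom O (U.obj T)) where
  col f := adjoint f
  map {p f g} ξ := ⟨ξ.1, (isNatural_iff_isOperadNatural (P := Fin p) f g ξ.1).1 ξ.2⟩
  map_id _ := rfl
  map_perm _ _ _ := rfl
  map_comp {n p f _ g} ξ ζ := Subtype.ext (funext fun c => congrArg (T.vcomp (ξ.1 c))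
    ((evalAt (R := freeProp O) (T := T) c).app_hs (J := Fin n) (I := fun i => Fin (p i))
      (a := g) (b := f) ζ))

/-- The inverse of `homToOperadHom`: it is `lift` on colours and keeps the components of a
family. -/
noncomputable def operadHomToHom :
    OperadHom (operadHom O (U.obj T)) (U.obj (propHom (freeProp O) T)) where
  col f := lift f
  map {p _ _} ξ := ⟨ξ.1, isNatural_lift (P := Fin p) ξ.2⟩
  map_id _ := rfl
  map_perm _ _ _ := rfl
  map_comp {n p f _ g} ξ ζ := Subtype.ext (funext fun c => congrArg (T.vcomp (ξ.1 c))
    ((evalAt (R := freeProp O) (T := T) c).app_hs (J := Fin n) (I := fun i => Fin (p i))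
      (a := fun i j => lift (g i j)) (b := fun i => lift (f i))
      fun i => ⟨(ζ i).1, isNatural_lift (P := Fin (p i)) (ζ i).2⟩).symm)

/-- The isomorphism `U (Hom (F O, T)) ≅ Hom (O, U T)` of operads. -/
noncomputable def homIso : U.obj (propHom (freeProp O) T) ≅ operadHom O (U.obj T) where
  hom := homToOperadHom O T
  inv := operadHomToHom O T
  hom_inv_id := OperadHom.ext_apply lift_adjoint fun {_ f g} _ =>
    natTrans_heq (fun i => lift_adjoint (f i)) (fun _ => lift_adjoint g) fun _ => HEq.rfl
  inv_hom_id := OperadHom.ext_apply adjoint_lift fun {_ f g} _ =>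
    operadNatTrans_heq (fun i => adjoint_lift (f i)) (adjoint_lift g) fun _ => HEq.rfl

end

end PropOperad

open PropOperad in
theorem propositionP (O : ColoredOperad.{u}) (T : ColoredProp.{u}) :
    Function.Bijective (fun f : freeProp O ⟶ T => (adjUnit O ≫ U.map f : O ⟶ U.obj T)) ∧
    ∃ Φ : U.obj (propHom (freeProp O) T) ≅ operadHom O (U.obj T),
      (∀ f : freeProp O ⟶ T, OperadHom.col Φ.hom f = (adjUnit O ≫ U.map f : O ⟶ U.obj T)) ∧
      ∀ (p : ℕ) (f : Fin p → (freeProp O ⟶ T)) (g : freeProp O ⟶ T)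
        (ξ : (U.obj (propHom (freeProp O) T)).Op f g) (c : O.Col),
        HEq ((OperadHom.map Φ.hom ξ).1 c) (ξ.1 c) :=
  ⟨Function.bijective_iff_has_inverse.2 ⟨lift, lift_adjoint, adjoint_lift⟩,
    homIso O T, fun _ => rfl, fun _ _ _ _ _ => HEq.rfl⟩
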